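/- Let $N,K$ be natural numbers, and let $g:\mathbb{R}\to\mathbb{R}$ be a differentiable real-valued function with $g\in L^2(\mathbb{R})$ and $g'\in L^2(\mathbb{R})$. Write $\hat u(f)=\int u(t)e^{-2\pi \mathrm{j} f t}\,dt$ for the (Plancherel) Fourier transform, let $J_N=[-\frac{N-1}{2},\frac{N-1}{2}]$ and let $f_i=\frac{2i-N-1}{2}$, $i=1,\dots,N$; the samples $\hat g(f_i)$ are taken from a version of $\hat g$ whose restriction to $J_N$ is continuous at each $f_i$. Put $$E_0=\|\hat g\,\mathbb{1}_{J_N}\|_{L^2}^2,\qquad E_1=\|\widehat{g'}\,\mathbb{1}_{J_N}\|_{L^2}^2,\qquad \rho=\max\left\{\frac{\mathrm{TV}(|\hat g|^2\mathbb{1}_{J_N})}{E_0},\ \frac{\mathrm{TV}(|\widehat{g'}|^2\mathbb{1}_{J_N})}{E_1}\right\},$$ where $E_1>0$ is assumed and $\mathrm{TV}(w)=\sup\{\int w\varphi' : \varphi\in C_c^\infty(\mathbb{R}),\ |\varphi|\le 1\}\in[0,\infty]$ is the total variation on $\mathbb{R}$ of the function $w$ (the total variation norm of its distributional derivative, the jumps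 at the ends of $J_N$ included). Let $\tau_1,\dots,\tau_K\in\mathbb{R}$ and $\Delta\le 1$ satisfy $|\tau_k-\tau_{k'}+j|\ge\Delta$ for all $k\ne k'$ and $j\in\mathbb{Z}$. Let $\Phi_\tau\in\mathbb{C}^{N\times K}$ have the entries $e^{-2\pi \mathrm{j}\tau_k f_i}$, let $G=\mathrm{diag}(\hat g(f_1),\dots,\hat g(f_N))$ and $\Lambda=\mathrm{diag}(-2\pi \mathrm{j} f_1,\dots,-2\pi \mathrm{j} f_N)$, let $P_\tau^\perp$ be the orthogonal projection of $\mathbb{C}^N$ onto the orthogonal complement of the column space of $G\Phi_\tau$, and let $S=\Phi_\tau^*\Lambda^*G^*P_\tau^\perp G\Lambda\Phi_\tau$. If $\Delta>\frac23\rho$, then, in the spectral norm, $$\|S-E_1 I_K\|\le \tfrac23\,E_1\,\rho\,\Delta^{-1}.$$ -/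

import Mathlib

open MeasureTheory
open scoped ContDiff ENNReal FourierTransform Matrix Matrix.Norms.L2Operator

noncomputable section

namespace PulseSensitivity

/-- The bandwidth `J_N = [-(N-1)/2, (N-1)/2]`. -/
def band (N : ℕ) : Set ℝ :=
  Set.Icc (-(((N : ℝ) - 1) / 2)) (((N : ℝ) - 1) / 2)

/-- The sampling frequencies `f_i = (2 i - N - 1) / 2` for `i = 1, …, N`; the index `i : Fin N`
starts at `0`, so it stands for the index `i + 1` of this list. -/
def freq (N : ℕ) (i : Fin N) : ℝ :=
  (2 * ((i : ℝ) + 1) - (N : ℝ) - 1) / 2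

/-- The Fourier transform `û(f) = ∫ u(t) exp(-2 π i f t) dt` of a real-valued function
`u ∈ L²(ℝ)`, as an element of `L²(ℝ; ℂ)` (the unitary Fourier transform of Plancherel). -/
def fourierL2 (u : ℝ → ℝ) (hu : MemLp u 2 volume) : Lp ℂ 2 (volume : Measure ℝ) :=
  𝓕 ((hu.ofReal (K := ℂ)).toLp (fun t => (u t : ℂ)))

/-- The power spectral density of `u` cut off to the band: `|û|² 𝟙_{J_N}`. -/
def bandSpectrum (N : ℕ) (u : ℝ → ℝ) (hu : MemLp u 2 volume) : ℝ → ℝ :=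
  (band N).indicator (fun f => ‖fourierL2 u hu f‖ ^ 2)

/-- The bandlimited energy `‖û 𝟙_{J_N}‖²` in `L²`. -/
def bandEnergy (N : ℕ) (u : ℝ → ℝ) (hu : MemLp u 2 volume) : ℝ :=
  ∫ f, bandSpectrum N u hu f

/-- The total variation on `ℝ` of a locally integrable function `w`, that is, the total variation
norm of its distributional derivative: the supremum of `∫ w φ'` over the smooth compactly supported
`φ` with `|φ| ≤ 1`. It is `∞` if the derivative is not a finite measure, and it does not change if
`w` is changed on a null set. -/
def totalVariation (w : ℝ → ℝ) : ℝ≥0∞ :=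
  ⨆ (φ : ℝ → ℝ) (_ : ContDiff ℝ ∞ φ) (_ : HasCompactSupport φ) (_ : ∀ x, |φ x| ≤ 1),
    ENNReal.ofReal (∫ x, w x * deriv φ x)

/-- The normalized total variation of `u` in the band: the total variation of `|û|² 𝟙_{J_N}`
(the jumps at the two ends of the band included) divided by the bandlimited energy. -/
def normalizedVariation (N : ℕ) (u : ℝ → ℝ) (hu : MemLp u 2 volume) : ℝ≥0∞ :=
  totalVariation (bandSpectrum N u hu) / ENNReal.ofReal (bandEnergy N u hu)

/-- The flatness parameter `ρ`: the maximum of the normalized total variations of `g` and `g'`. -/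
def rho (N : ℕ) (g : ℝ → ℝ) (hg : MemLp g 2 volume) (hg' : MemLp (deriv g) 2 volume) : ℝ≥0∞ :=
  max (normalizedVariation N g hg) (normalizedVariation N (deriv g) hg')

/-- `[Φ_τ]_{i,k} = exp(-2 π i τ_k f_i)`. -/
def Phi (N : ℕ) {K : ℕ} (τ : Fin K → ℝ) : Matrix (Fin N) (Fin K) ℂ :=
  Matrix.of fun i k =>
    Complex.exp (-(Complex.I * 2 * (Real.pi : ℂ) * (τ k : ℂ) * (freq N i : ℂ)))

/-- `G = diag(ĝ(f_1), …, ĝ(f_N))`. -/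
def G (N : ℕ) (ghat : ℝ → ℂ) : Matrix (Fin N) (Fin N) ℂ :=
  Matrix.diagonal fun i => ghat (freq N i)

/-- `Λ = diag(-2 π i f_1, …, -2 π i f_N)`. -/
def Lam (N : ℕ) : Matrix (Fin N) (Fin N) ℂ :=
  Matrix.diagonal fun i => -(Complex.I * 2 * (Real.pi : ℂ) * (freq N i : ℂ))

/-- The matrix of the orthogonal projection onto the orthogonal complement of the column space
of `A`, that is `I - A A†` with the Moore-Penrose inverse `A†`. -/
def projPerp {N K : ℕ} (A : Matrix (Fin N) (Fin K) ℂ) : Matrix (Fin N) (Fin N) ℂ :=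
  (Matrix.toEuclideanCLM (n := Fin N) (𝕜 := ℂ)).symm
    ((LinearMap.range (Matrix.toEuclideanLin A))ᗮ.starProjection)

/-- The Schur-complement matrix `S = Φ_τ* Λ* G* P_τ^⊥ G Λ Φ_τ`, where `P_τ^⊥` is the orthogonal
projection onto the orthogonal complement of the column space of `G Φ_τ`. -/
def S (N : ℕ) {K : ℕ} (ghat : ℝ → ℂ) (τ : Fin K → ℝ) : Matrix (Fin K) (Fin K) ℂ :=
  (Phi N τ)ᴴ * (Lam N)ᴴ * (G N ghat)ᴴ * projPerp (G N ghat * Phi N τ) *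
    G N ghat * Lam N * Phi N τ

end PulseSensitivity

end

/-!
Write `p_u(f) = ∑ₖ uₖ exp(-2 π i τₖ f)`. The quadratic form of `S` at `b` is the squared distance of
`G Λ Φ b` from the range of `G Φ` (`inner_S`), so up to the factor `(2 π)²` it is the minimum over
`a` of `∑ᵢ |ĝ(f_i)|² |p_a(f_i) + f_i p_b(f_i)|²`. As `|ĝ'(f)|² = (2 π f)² |ĝ(f)|²`
(`fourierL2_deriv`), everything is expressed by the even weight `W = |ĝ|² 𝟙_{J_N}`
(`norm_fourierL2_neg`), and with `S - E₁` Hermitian the claim reduces to two bounds for sums over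
the sampling frequencies (`norm_S_sub_le`): an upper bound for `a = 0`
(`sum_freq_norm_sq_expSum_le`) and a lower bound for all `a`, `b` (`sum_freq_pair_ge`).

Both are first proved for integrals over the line against a smooth weight `w`, with frequencies that
are `δ`-separated reals. The off-diagonal part of `|p_u|²` has a primitive bounded by
`‖u‖² / (2 δ)`, by the inequality of Montgomery and Vaughan (`hilbert_inequality`), and a second
primitive bounded by `‖u‖² / (12 δ²)` (`abs_corr_prim₂_le`). One integration by parts gives the
upper bound (`abs_integral_norm_sq_expSum_sub_le`), with `1 / 2` in place of `2 / 3`.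

The lower bound (`integral_pair_ge`) is the heart of the matter, because `a` is free and the
off-diagonal terms of `p_a` and of the mixed products have no counterpart on the right-hand side.
After a rescaling of the variable `a` and `b` have norm `1`, and `|p_a + x p_b|²` is `1 + x²` plus
an excess that is at least `-(1 + x²)`. On the half-line a fraction `1 - k(x)` of the excess is
estimated by this pointwise bound, and the fraction `k(x) = x p(x) + σ(x)` is integrated by parts
twice: the first primitive enters with the sharp operator norm, and what is left is paired with the
second primitive through a trace norm. The multipliers `p`, `σ` may be chosen freely, and a
compensator `e`, whose total derivative is added, moves the budget
`α δ⁻¹ |w'| + 2 / 3 δ⁻¹ |(x² w)'|` along the line. The pointwise inequalities that make the loss fit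
into the budget are `PhaseCond`; by linearity in `(w, w')` three
cases suffice. They depend on the one parameter `η = 1 / δ`. For small and for large `η`
there are explicit multipliers (`PairPotential.exists_integral_nonneg_of_small`,
`PairPotential.exists_integral_nonneg_of_large`). In between, `PhaseCond` is convex in `1 / η`, so
that four piecewise linear choices, verified in rational arithmetic, suffice
(`PairPotential.exists_integral_nonneg`). The condition `Δ > 2 ρ / 3` is used exactly here, as
`η ‖w'‖₁ ≤ 3 / 2 ∫ w`.

Frequencies separated modulo `1` are replaced by their translates `τₖ + j` with `0 ≤ j < M`, which
multiplies the integrand by a Fejér kernel; as `M → ∞` the integrals tend to sums over a shifted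
integer lattice (`tendsto_integral_mul_fejer`). Finally, a weight of bounded variation is
approximated by convolutions with bumps (`smoothing`). The weight is dilated slightly beforehand, so
that the values at the end points of the band are limits from inside, where the samples are
continuous.
-/

namespace PulseSensitivity

/-! ### Well-spaced reals: Hilbert's inequality -/

open Finset in
/-- The integer parts of the `y m / δ` are distinct and positive, which compares the sum with
`∑ 1 / n² = π² / 6`. -/
theorem sum_inv_sq_le_of_pos {ι : Type*} (s : Finset ι) (y : ι → ℝ) {δ : ℝ} (hδ : 0 < δ)
    (hy : ∀ m ∈ s, δ ≤ y m) (hsep : ∀ m ∈ s, ∀ l ∈ s, m ≠ l → δ ≤ |y m - y l|) :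
    ∑ m ∈ s, ((y m)⁻¹) ^ 2 ≤ Real.pi ^ 2 / (6 * δ ^ 2) := by
  classical
  set n : ι → ℕ := fun m => ⌊y m / δ⌋₊ with hn
  have hle : ∀ m ∈ s, (n m : ℝ) ≤ y m / δ := fun m hm =>
    Nat.floor_le (div_nonneg (hδ.le.trans (hy m hm)) hδ.le)
  have hlt : ∀ m, y m / δ < n m + 1 := fun m => Nat.lt_floor_add_one _
  have hn1 : ∀ m ∈ s, 1 ≤ n m := fun m hm => by
    apply Nat.le_floor
    rw [Nat.cast_one, le_div_iff₀ hδ, one_mul]; exact hy m hm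
  have hinj : Set.InjOn n s := by
    intro a ha b hb hab
    by_contra hne
    have h := hsep a ha b hb hne
    have h1 := hle a ha
    have h2 := hle b hb
    have h3 := hlt a
    have h4 := hlt b
    rw [hab] at h1 h3
    have : |y a / δ - y b / δ| < 1 := by
      rw [abs_lt]; constructor <;> linarith
    rw [← sub_div, abs_div, abs_of_pos hδ, div_lt_one hδ] at this
    linarith
  have hz := hasSum_zeta_two
  have h1 : ∑ m ∈ s, ((y m)⁻¹) ^ 2 ≤ ∑ m ∈ s, (δ⁻¹) ^ 2 * (1 / (n m : ℝ) ^ 2) := by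
    refine sum_le_sum fun m hm => ?_
    have hnp : (0 : ℝ) < n m := by exact_mod_cast hn1 m hm
    have hyp : 0 < y m := hδ.trans_le (hy m hm)
    have : δ * n m ≤ y m := by
      have := hle m hm
      rwa [le_div_iff₀ hδ, mul_comm] at this
    have h5 : (y m)⁻¹ ≤ (δ * n m)⁻¹ := inv_anti₀ (by positivity) this
    calc ((y m)⁻¹) ^ 2 ≤ ((δ * n m)⁻¹) ^ 2 := by gcongr
      _ = _ := by field_simp
  have h2 : ∑ m ∈ s, (δ⁻¹) ^ 2 * (1 / (n m : ℝ) ^ 2)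
      = (δ⁻¹) ^ 2 * ∑ j ∈ s.image n, 1 / (j : ℝ) ^ 2 := by
    rw [sum_image hinj, mul_sum]
  have h3 : ∑ j ∈ s.image n, 1 / (j : ℝ) ^ 2 ≤ Real.pi ^ 2 / 6 :=
    sum_le_hasSum _ (fun j _ => by positivity) hz
  calc _ ≤ _ := h1
    _ = _ := h2
    _ ≤ (δ⁻¹) ^ 2 * (Real.pi ^ 2 / 6) := by gcongr
    _ = _ := by field_simp

/-- The reciprocals of the differences of `lam`; the diagonal entries are `0⁻¹ = 0`. -/
noncomputable def invDiff {ι : Type*} (lam : ι → ℝ) (k l : ι) : ℝ := (lam k - lam l)⁻¹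

section
variable {ι : Type*} (lam : ι → ℝ)

theorem invDiff_self (k : ι) : invDiff lam k k = 0 := by simp [invDiff]

theorem invDiff_swap (k l : ι) : invDiff lam l k = -invDiff lam k l := by
  simp only [invDiff]; rw [← inv_neg]; ring_nf

variable [Fintype ι]

/-- `sum_inv_sq_le_of_pos` on both sides of `lam k`. -/
theorem sum_invDiff_sq_le {δ : ℝ} (hδ : 0 < δ)
    (hsep : ∀ k l, k ≠ l → δ ≤ |lam k - lam l|) (k : ι) :
    ∑ m, invDiff lam m k ^ 2 ≤ Real.pi ^ 2 / (3 * δ ^ 2) := by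
  classical
  have hsplit : ∑ m, invDiff lam m k ^ 2
      = ∑ m with 0 < lam m - lam k, ((lam m - lam k)⁻¹) ^ 2
        + ∑ m with 0 < lam k - lam m, ((lam k - lam m)⁻¹) ^ 2 := by
    rw [Finset.sum_filter, Finset.sum_filter, ← Finset.sum_add_distrib]
    refine Finset.sum_congr rfl fun m _ => ?_
    simp only [invDiff]
    rcases lt_trichotomy (lam m) (lam k) with h | h | h
    · rw [if_neg (by linarith), if_pos (by linarith), zero_add]
      rw [← neg_sub (lam k), inv_neg, neg_sq]
    · simp [h]
    · rw [if_pos (by linarith), if_neg (by linarith), add_zero]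
  rw [hsplit]
  have h1 := sum_inv_sq_le_of_pos (Finset.univ.filter fun m => 0 < lam m - lam k)
    (fun m => lam m - lam k) hδ
    (fun m hm => by
      have hm' := (Finset.mem_filter.1 hm).2
      have := hsep m k (by rintro rfl; simp at hm')
      rwa [abs_of_pos hm'] at this)
    (fun m _ l _ hml => by have := hsep m l hml; simpa using this)
  have h2 := sum_inv_sq_le_of_pos (Finset.univ.filter fun m => 0 < lam k - lam m)
    (fun m => lam k - lam m) hδ
    (fun m hm => by
      have hm' := (Finset.mem_filter.1 hm).2
      have := hsep k m (by rintro rfl; simp at hm')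
      rwa [abs_of_pos hm'] at this)
    (fun m _ l _ hml => by
      have := hsep l m hml.symm
      simpa using this)
  calc _ ≤ Real.pi ^ 2 / (6 * δ ^ 2) + Real.pi ^ 2 / (6 * δ ^ 2) := add_le_add h1 h2
    _ = _ := by field_simp; ring

/-- Partial fractions: the entries of `Rᵀ R` for `R = invDiff lam`. -/
theorem sum_invDiff_mul [DecidableEq ι] (hinj : Function.Injective lam) (k l : ι) :
    ∑ m, invDiff lam m k * invDiff lam m l
      = (if k = l then ∑ m, invDiff lam m k ^ 2 else 0)
        + invDiff lam k l * (∑ m, invDiff lam m k - ∑ m, invDiff lam m l)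
        + 2 * invDiff lam k l ^ 2 := by
  by_cases hkl : k = l
  · subst hkl; simp [invDiff_self, sq]
  · rw [if_neg hkl, zero_add]
    have h : ∀ m, invDiff lam m k * invDiff lam m l
        = invDiff lam k l * (invDiff lam m k - invDiff lam m l)
          + ((if m = k then invDiff lam k l ^ 2 else 0)
          + (if m = l then invDiff lam k l ^ 2 else 0)) := by
      intro m
      have hkl' : lam k - lam l ≠ 0 := sub_ne_zero.2 fun h => hkl (hinj h)
      by_cases hmk : m = k
      · subst hmk
        rw [if_pos rfl, if_neg hkl, invDiff_self]; ring
      by_cases hml : m = l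
      · subst hml
        rw [if_pos rfl, if_neg hmk, invDiff_self, invDiff_swap lam k m]; ring
      · rw [if_neg hmk, if_neg hml]
        have h1 : lam m - lam k ≠ 0 := sub_ne_zero.2 fun h => hmk (hinj h)
        have h2 : lam m - lam l ≠ 0 := sub_ne_zero.2 fun h => hml (hinj h)
        simp only [invDiff]
        field_simp
        ring
    rw [Finset.sum_congr rfl fun m _ => h m]
    simp only [Finset.sum_add_distrib, Finset.sum_ite_eq', Finset.mem_univ, if_true,
      ← Finset.mul_sum, Finset.sum_sub_distrib]
    ring

/-- An eigenvalue of the skew-symmetric matrix of reciprocal differences is at most `π / δ`. -/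
theorem invDiff_eigenvalue_le {δ : ℝ} (hδ : 0 < δ)
    (hsep : ∀ k l, k ≠ l → δ ≤ |lam k - lam l|) (u : ι → ℂ) (μ : ℝ) (hu : u ≠ 0)
    (h : ∀ m, ∑ k, (invDiff lam m k : ℂ) * u k = (-Complex.I * μ) * u m) :
    |μ| ≤ Real.pi / δ := by
  classical
  have hinj : Function.Injective lam := by
    intro k l hkl; by_contra hne
    have := hsep k l hne
    rw [hkl] at this; simp at this; linarith
  set ν : ℂ := -Complex.I * μ with hν
  have hνc : (starRingEnd ℂ) ν = -ν := by simp [hν]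
  have hνn : ν * (starRingEnd ℂ) ν = ((μ ^ 2 : ℝ) : ℂ) := by
    rw [hνc, hν]; push_cast; linear_combination (-(μ:ℂ)^2) * Complex.I_sq
  set R := invDiff lam with hR
  -- the norm of `R u` computed in two ways
  have key : ((μ ^ 2 : ℝ) : ℂ) * ∑ m, u m * (starRingEnd ℂ) (u m)
      = ∑ k, ((∑ m, R m k ^ 2 : ℝ) : ℂ) * (u k * (starRingEnd ℂ) (u k))
        + 2 * ∑ k, ∑ l, ((R k l ^ 2 : ℝ) : ℂ) * (u k * (starRingEnd ℂ) (u l)) := by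
    have e1 : ((μ ^ 2 : ℝ) : ℂ) * ∑ m, u m * (starRingEnd ℂ) (u m)
        = ∑ m, (∑ k, (R m k : ℂ) * u k) * (starRingEnd ℂ) (∑ l, (R m l : ℂ) * u l) := by
      rw [Finset.mul_sum]
      refine Finset.sum_congr rfl fun m _ => ?_
      rw [h m, map_mul, ← hνn]; ring
    have e2 : ∑ m, (∑ k, (R m k : ℂ) * u k) * (starRingEnd ℂ) (∑ l, (R m l : ℂ) * u l)
        = ∑ k, ∑ l, ((∑ m, R m k * R m l : ℝ) : ℂ) * (u k * (starRingEnd ℂ) (u l)) := by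
      simp only [map_sum, map_mul, Complex.conj_ofReal, Finset.sum_mul_sum]
      rw [Finset.sum_comm]
      refine Finset.sum_congr rfl fun k _ => ?_
      rw [Finset.sum_comm]
      refine Finset.sum_congr rfl fun l _ => ?_
      push_cast
      rw [Finset.sum_mul]
      refine Finset.sum_congr rfl fun m _ => ?_
      ring
    rw [e1, e2]
    have e3 : ∀ k l, ((∑ m, R m k * R m l : ℝ) : ℂ) * (u k * (starRingEnd ℂ) (u l))
        = (if k = l then ((∑ m, R m k ^ 2 : ℝ) : ℂ) * (u k * (starRingEnd ℂ) (u l)) else 0)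
          + ((((∑ m, R m k : ℝ) : ℂ) * u k) * (starRingEnd ℂ) ((R k l : ℂ) * u l)
            - (((∑ m, R m l : ℝ) : ℂ) * (starRingEnd ℂ) (u l)) * ((R k l : ℂ) * u k))
          + 2 * (((R k l ^ 2 : ℝ) : ℂ) * (u k * (starRingEnd ℂ) (u l))) := by
      intro k l
      rw [sum_invDiff_mul lam hinj k l]
      simp only [map_mul, Complex.conj_ofReal, ← hR]
      split_ifs with hkl
      · push_cast; ring
      · push_cast; ring
    simp only [e3, Finset.sum_add_distrib, Finset.sum_sub_distrib]
    have e4 : ∑ k, ∑ l, (((∑ m, R m k : ℝ) : ℂ) * u k) * (starRingEnd ℂ) ((R k l : ℂ) * u l)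
        = -ν * ∑ k, ((∑ m, R m k : ℝ) : ℂ) * (u k * (starRingEnd ℂ) (u k)) := by
      rw [Finset.mul_sum]
      refine Finset.sum_congr rfl fun k _ => ?_
      rw [← Finset.mul_sum, ← map_sum, h k, map_mul, hνc]; ring
    have e5 : ∑ k, ∑ l, (((∑ m, R m l : ℝ) : ℂ) * (starRingEnd ℂ) (u l)) * ((R k l : ℂ) * u k)
        = -ν * ∑ k, ((∑ m, R m k : ℝ) : ℂ) * (u k * (starRingEnd ℂ) (u k)) := by
      rw [Finset.sum_comm, Finset.mul_sum]
      refine Finset.sum_congr rfl fun l _ => ?_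
      rw [← Finset.mul_sum]
      have : ∑ k, (R k l : ℂ) * u k = -(ν * u l) := by
        rw [← h l, ← Finset.sum_neg_distrib]
        refine Finset.sum_congr rfl fun k _ => ?_
        rw [hR, invDiff_swap lam l k]; push_cast; ring
      rw [this]; ring
    rw [e4, e5, sub_self, add_zero]
    simp only [Finset.sum_ite_eq, Finset.mem_univ, if_true, Finset.mul_sum]
  set U : ℝ := ∑ m, ‖u m‖ ^ 2 with hU
  have hUpos : 0 < U := by
    obtain ⟨m, hm⟩ := Function.ne_iff.1 hu
    refine Finset.sum_pos' (fun _ _ => by positivity) ⟨m, Finset.mem_univ _, ?_⟩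
    have : 0 < ‖u m‖ := norm_pos_iff.2 hm
    positivity
  have hmm : ∀ z : ℂ, z * (starRingEnd ℂ) z = ((‖z‖ ^ 2 : ℝ) : ℂ) := fun z => by
    rw [Complex.mul_conj, Complex.normSq_eq_norm_sq]
  have hSk : ∀ k, ∑ m, R m k ^ 2 ≤ Real.pi ^ 2 / (3 * δ ^ 2) :=
    fun k => sum_invDiff_sq_le lam hδ hsep k
  have hre : μ ^ 2 * U = ∑ k, (∑ m, R m k ^ 2) * ‖u k‖ ^ 2
      + 2 * ∑ k, ∑ l, R k l ^ 2 * (u k * (starRingEnd ℂ) (u l)).re := by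
    have := congrArg Complex.re key
    simp only [hmm, Complex.add_re, ← Complex.ofReal_mul, ← Complex.ofReal_sum,
      Complex.ofReal_re] at this
    rw [show (2:ℂ) = ((2:ℝ):ℂ) by norm_num, Complex.re_ofReal_mul] at this
    simp only [Complex.re_sum, Complex.re_ofReal_mul] at this
    rw [hU, this]
  have hcross : ∑ k, ∑ l, R k l ^ 2 * (u k * (starRingEnd ℂ) (u l)).re
      ≤ ∑ k, (∑ m, R m k ^ 2) * ‖u k‖ ^ 2 := by
    have h1 : ∑ k, ∑ l, R k l ^ 2 * (u k * (starRingEnd ℂ) (u l)).re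
        ≤ ∑ k, ∑ l, (R k l ^ 2 * (‖u k‖ ^ 2 / 2) + R k l ^ 2 * (‖u l‖ ^ 2 / 2)) := by
      refine Finset.sum_le_sum fun k _ => Finset.sum_le_sum fun l _ => ?_
      rw [← mul_add]
      refine mul_le_mul_of_nonneg_left ?_ (sq_nonneg _)
      have h2 := Complex.re_le_norm (u k * (starRingEnd ℂ) (u l))
      rw [norm_mul, RCLike.norm_conj] at h2
      nlinarith [sq_nonneg (‖u k‖ - ‖u l‖)]
    refine h1.trans_eq ?_
    simp only [Finset.sum_add_distrib]
    have h3 : ∑ k, ∑ l, R k l ^ 2 * (‖u l‖ ^ 2 / 2) = ∑ k, ∑ l, R l k ^ 2 * (‖u k‖ ^ 2 / 2) :=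
      Finset.sum_comm
    rw [h3, ← Finset.sum_add_distrib]
    refine Finset.sum_congr rfl fun k _ => ?_
    rw [← Finset.sum_add_distrib, Finset.sum_mul]
    refine Finset.sum_congr rfl fun l _ => ?_
    rw [hR, invDiff_swap lam l k]; ring
  have hfin : ∑ k, (∑ m, R m k ^ 2) * ‖u k‖ ^ 2 ≤ Real.pi ^ 2 / (3 * δ ^ 2) * U := by
    rw [hU, Finset.mul_sum]
    exact Finset.sum_le_sum fun k _ => mul_le_mul_of_nonneg_right (hSk k) (sq_nonneg _)
  have h6 : μ ^ 2 ≤ (Real.pi / δ) ^ 2 := by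
    have : μ ^ 2 * U ≤ (Real.pi / δ) ^ 2 * U := by
      have e : (Real.pi / δ) ^ 2 * U = 3 * (Real.pi ^ 2 / (3 * δ ^ 2) * U) := by
        field_simp
      rw [e]; linarith
    exact le_of_mul_le_mul_right this hUpos
  exact abs_le_of_sq_le_sq h6 (by positivity)

open scoped ComplexOrder in
/-- **Hilbert's inequality** of Montgomery and Vaughan, with the sharp constant `π / δ`. The
diagonal terms vanish because `0⁻¹ = 0`. -/
theorem hilbert_inequality {δ : ℝ} (hδ : 0 < δ)
    (hsep : ∀ k l, k ≠ l → δ ≤ |lam k - lam l|) (u : ι → ℂ) :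
    |(∑ k, ∑ l, Complex.I * (invDiff lam k l : ℂ) * (u l * (starRingEnd ℂ) (u k))).re|
      ≤ Real.pi / δ * ∑ k, ‖u k‖ ^ 2 := by
  classical
  set T : Matrix ι ι ℂ := Matrix.of fun k l => Complex.I * (invDiff lam k l : ℂ) with hT
  have hTh : T.IsHermitian := by
    ext k l
    simp only [hT, Matrix.conjTranspose_apply, Matrix.of_apply, RCLike.star_def, map_mul,
      Complex.conj_I, Complex.conj_ofReal, invDiff_swap lam k l]
    push_cast; ring
  set c : ℝ := Real.pi / δ with hc
  have hmv : ∀ (s : ℝ) (v : ι → ℂ) (m : ι),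
      (((c : ℂ) • (1 : Matrix ι ι ℂ) + (s : ℂ) • T) *ᵥ v) m
        = (c : ℂ) * v m + (s : ℂ) * (Complex.I * ∑ x, (invDiff lam m x : ℂ) * v x) := by
    intro s v m
    rw [Matrix.add_mulVec, Matrix.smul_mulVec, Matrix.smul_mulVec, Matrix.one_mulVec]
    simp only [Pi.add_apply, Pi.smul_apply, smul_eq_mul, Matrix.mulVec, dotProduct, hT,
      Matrix.of_apply, Finset.mul_sum, mul_assoc]
  -- every eigenvalue of `c + s T` with `s = ± 1` is nonnegative by `invDiff_eigenvalue_le`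
  have hpsd : ∀ s : ℝ, s ^ 2 = 1 →
      ((c : ℂ) • (1 : Matrix ι ι ℂ) + (s : ℂ) • T).PosSemidef := by
    intro s hs
    have hH : ((c : ℂ) • (1 : Matrix ι ι ℂ) + (s : ℂ) • T).IsHermitian := by
      refine Matrix.IsHermitian.add ?_ ?_
      · rw [Matrix.IsHermitian, Matrix.conjTranspose_smul, Matrix.conjTranspose_one]; simp
      · rw [Matrix.IsHermitian, Matrix.conjTranspose_smul, hTh.eq]; simp
    rw [hH.posSemidef_iff_eigenvalues_nonneg]
    intro i
    have hev := hH.mulVec_eigenvectorBasis i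
    set v : ι → ℂ := (hH.eigenvectorBasis i).ofLp with hv
    have hv0 : v ≠ 0 := by
      intro h0
      have := hH.eigenvectorBasis.orthonormal.ne_zero i
      apply this
      ext j
      exact congrFun h0 j
    set ev := hH.eigenvalues i
    have hTv : ∀ m, ∑ k, (invDiff lam m k : ℂ) * v k
        = (-Complex.I * ((s * (ev - c) : ℝ) : ℂ)) * v m := by
      intro m
      have := congrFun hev m
      rw [hmv] at this
      simp only [Pi.smul_apply, Complex.real_smul] at this
      have hs' : (s : ℂ) ^ 2 = 1 := by exact_mod_cast hs
      push_cast
      set X := ∑ x, (invDiff lam m x : ℂ) * v x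
      linear_combination (-Complex.I * s) * this + (-X) * hs' + (X * (s : ℂ) ^ 2) * Complex.I_sq
    have hb := invDiff_eigenvalue_le lam hδ hsep v _ hv0 hTv
    rw [abs_mul, show |s| = 1 by rw [← sq_eq_sq₀ (abs_nonneg _) zero_le_one, sq_abs, hs, one_pow],
      one_mul, abs_le] at hb
    simp only [Pi.zero_apply]
    linarith [hb.1]
  have hq : ∀ s : ℝ, s ^ 2 = 1 →
      0 ≤ c * ∑ k, ‖u k‖ ^ 2
        + s * (∑ k, ∑ l, Complex.I * (invDiff lam k l : ℂ) * (u l * (starRingEnd ℂ) (u k))).re := by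
    intro s hs
    have h1 := (hpsd s hs).re_dotProduct_nonneg u
    have h2 : star u ⬝ᵥ (((c : ℂ) • (1 : Matrix ι ι ℂ) + (s : ℂ) • T) *ᵥ u)
        = (c : ℂ) * ∑ k, u k * (starRingEnd ℂ) (u k)
          + (s : ℂ) * ∑ k, ∑ l, Complex.I * (invDiff lam k l : ℂ) * (u l * (starRingEnd ℂ) (u k)) := by
      simp only [dotProduct, hmv, Pi.star_apply, RCLike.star_def, mul_add, Finset.sum_add_distrib,
        Finset.mul_sum]
      congr 1
      · exact Finset.sum_congr rfl fun _ _ => by ring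
      · exact Finset.sum_congr rfl fun _ _ => Finset.sum_congr rfl fun _ _ => by ring
    rw [h2] at h1
    simp only [Complex.mul_conj, Complex.normSq_eq_norm_sq, ← Complex.ofReal_sum, RCLike.re_to_complex,
      Complex.add_re, Complex.re_ofReal_mul, Complex.ofReal_re] at h1
    exact h1
  rw [abs_le]
  constructor
  · have := hq 1 (by norm_num); linarith
  · have := hq (-1) (by norm_num); linarith
end

/-! ### The trace norm of symmetric `2 × 2` matrices -/

/-- The trace norm of the symmetric matrix with rows `(a, b)` and `(b, c)` is at most `T`, stated
through the duality with the operator norm. -/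
def TraceNormLE (a b c T : ℝ) : Prop :=
  ∀ p q r : ℝ, (∀ s t : ℝ, |s ^ 2 * p + 2 * s * t * q + t ^ 2 * r| ≤ s ^ 2 + t ^ 2) →
    |a * p + 2 * b * q + c * r| ≤ T

theorem TraceNormLE.nonneg {a b c T : ℝ} (h : TraceNormLE a b c T) : 0 ≤ T :=
  (abs_nonneg _).trans (h 0 0 0 fun s t => by simp; positivity)

theorem TraceNormLE.bound {a b c T : ℝ} (h : TraceNormLE a b c T) {p q r m : ℝ} (hm : 0 < m)
    (hb : ∀ s t : ℝ, |s ^ 2 * p + 2 * s * t * q + t ^ 2 * r| ≤ m * (s ^ 2 + t ^ 2)) :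
    |a * p + 2 * b * q + c * r| ≤ m * T := by
  have h1 := h (p / m) (q / m) (r / m) fun s t => by
    rw [show s ^ 2 * (p / m) + 2 * s * t * (q / m) + t ^ 2 * (r / m)
      = (s ^ 2 * p + 2 * s * t * q + t ^ 2 * r) / m by ring, abs_div, abs_of_pos hm,
      div_le_iff₀ hm]
    exact (hb s t).trans_eq (mul_comm _ _)
  rw [show a * (p / m) + 2 * b * (q / m) + c * (r / m) = (a * p + 2 * b * q + c * r) / m by ring,
    abs_div, abs_of_pos hm, div_le_iff₀ hm] at h1
  exact h1.trans_eq (mul_comm _ _)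

theorem TraceNormLE.comb {a b c T a' b' c' T' : ℝ} (h : TraceNormLE a b c T)
    (h' : TraceNormLE a' b' c' T') {s t : ℝ} (hs : 0 ≤ s) (ht : 0 ≤ t) :
    TraceNormLE (s * a + t * a') (s * b + t * b') (s * c + t * c') (s * T + t * T') := by
  intro p q r hb
  have h1 := h p q r hb
  have h2 := h' p q r hb
  calc _ = |s * (a * p + 2 * b * q + c * r) + t * (a' * p + 2 * b' * q + c' * r)| := by ring_nf
    _ ≤ |s * (a * p + 2 * b * q + c * r)| + |t * (a' * p + 2 * b' * q + c' * r)| := abs_add_le _ _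
    _ ≤ _ := by
      rw [abs_mul, abs_mul, abs_of_nonneg hs, abs_of_nonneg ht]; gcongr

theorem TraceNormLE.mono {a b c T T' : ℝ} (h : TraceNormLE a b c T) (hT : T ≤ T') :
    TraceNormLE a b c T' := fun p q r hb => (h p q r hb).trans hT

/-- The trace norm is the larger of `|λ₁ + λ₂|` and `|λ₁ - λ₂|`, where `λ₁`, `λ₂` are the
eigenvalues. -/
theorem traceNormLE_of_sq {a b c T : ℝ} (hT : 0 ≤ T) (h1 : |a + c| ≤ T)
    (h2 : (a - c) ^ 2 + 4 * b ^ 2 ≤ T ^ 2) : TraceNormLE a b c T := by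
  intro p q r hb
  set m := (p + r) / 2 with hm
  set d := (p - r) / 2 with hd
  set n := Real.sqrt (d ^ 2 + q ^ 2) with hn
  have hn0 : 0 ≤ n := Real.sqrt_nonneg _
  have hnsq : n ^ 2 = d ^ 2 + q ^ 2 := Real.sq_sqrt (by positivity)
  -- the eigenvalues of the dual matrix are `m ± n`
  have key : |m| + n ≤ 1 := by
    have hall : ∀ s t : ℝ, |m * (s ^ 2 + t ^ 2) + (d * (s ^ 2 - t ^ 2) + q * (2 * s * t))|
        ≤ s ^ 2 + t ^ 2 := fun s t => by
      have := hb s t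
      rwa [show s ^ 2 * p + 2 * s * t * q + t ^ 2 * r
        = m * (s ^ 2 + t ^ 2) + (d * (s ^ 2 - t ^ 2) + q * (2 * s * t)) by
          rw [hm, hd]; ring] at this
    have hdn : |d| ≤ n := Real.abs_le_sqrt (by nlinarith [sq_nonneg q])
    have hdn' := abs_le.1 hdn
    have hfix : ∀ e : ℝ, (e = 1 ∨ e = -1) → e * m + n ≤ 1 := by
      intro e he
      have he2 : e ^ 2 = 1 := by rcases he with rfl | rfl <;> norm_num
      rcases hn0.eq_or_lt with h0 | hpos
      · have hd0 : d = 0 := by nlinarith [sq_nonneg d, sq_nonneg q]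
        have := hall 1 0
        have h3 := abs_le.1 this
        rw [← h0]
        rcases he with rfl | rfl <;> nlinarith [h3.1, h3.2]
      · rcases le_total 0 (e * d) with hed | hed
        · -- the eigenvector `(n + e d, e q)`
          have h4 := abs_le.1 (hall (n + e * d) (e * q))
          have h5 : (n + e * d) ^ 2 + (e * q) ^ 2 = 2 * n * (n + e * d) := by
            linear_combination (d ^ 2 + q ^ 2) * he2 - hnsq
          have h6 : e * (d * ((n + e * d) ^ 2 - (e * q) ^ 2) + q * (2 * (n + e * d) * (e * q)))
              = n * (2 * n * (n + e * d)) := by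
            linear_combination (2 * d ^ 2 * n + e * d * (d ^ 2 + q ^ 2) + 2 * q ^ 2 * n) * he2
              - (2 * n + e * d) * hnsq
          rw [h5] at h4
          have hpp : 0 < 2 * n * (n + e * d) := by positivity
          have : (e * m + n) * (2 * n * (n + e * d)) ≤ 1 * (2 * n * (n + e * d)) := by
            rw [add_mul, ← h6]
            rcases he with rfl | rfl <;> nlinarith [h4.1, h4.2]
          exact le_of_mul_le_mul_right this hpp
        · have h4 := abs_le.1 (hall (e * q) (n - e * d))
          have h5 : (e * q) ^ 2 + (n - e * d) ^ 2 = 2 * n * (n - e * d) := by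
            linear_combination (d ^ 2 + q ^ 2) * he2 - hnsq
          have h6 : e * (d * ((e * q) ^ 2 - (n - e * d) ^ 2) + q * (2 * (e * q) * (n - e * d)))
              = n * (2 * n * (n - e * d)) := by
            linear_combination (2 * d ^ 2 * n - e * d * (d ^ 2 + q ^ 2) + 2 * q ^ 2 * n) * he2
              - (2 * n - e * d) * hnsq
          rw [h5] at h4
          have hpp : 0 < 2 * n * (n - e * d) := by
            have : 0 < n - e * d := by linarith
            positivity
          have : (e * m + n) * (2 * n * (n - e * d)) ≤ 1 * (2 * n * (n - e * d)) := by
            rw [add_mul, ← h6]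
            rcases he with rfl | rfl <;> nlinarith [h4.1, h4.2]
          exact le_of_mul_le_mul_right this hpp
    rcases abs_cases m with ⟨hc, _⟩ | ⟨hc, _⟩ <;> rw [hc]
    · linarith [hfix 1 (Or.inl rfl)]
    · linarith [hfix (-1) (Or.inr rfl)]
  have hcs : |(a - c) * d + 2 * b * q| ≤ T * n := by
    apply abs_le_of_sq_le_sq _ (by positivity)
    rw [mul_pow, hnsq]
    have : ((a - c) * d + 2 * b * q) ^ 2 ≤ ((a - c) ^ 2 + 4 * b ^ 2) * (d ^ 2 + q ^ 2) := by
      nlinarith [sq_nonneg ((a - c) * q - 2 * b * d)]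
    exact this.trans (by gcongr)
  calc |a * p + 2 * b * q + c * r| = |(a + c) * m + ((a - c) * d + 2 * b * q)| := by
        rw [hm, hd]; ring_nf
    _ ≤ |(a + c) * m| + |(a - c) * d + 2 * b * q| := abs_add_le _ _
    _ ≤ T * |m| + T * n := by rw [abs_mul]; gcongr
    _ = T * (|m| + n) := by ring
    _ ≤ T * 1 := by gcongr
    _ = T := mul_one T

/-! ### Potentials for the quadratic form of a pair of exponential sums -/

/-- The off-diagonal parts `A`, `B`, `C` of the (symmetrized) quadratic form
`1 + x² + A + 2 x B + x² C ≥ 0`, with first primitives `H` and second primitives `P` that are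
bounded as symmetric matrices by `η / 2` and `η² / 12`. -/
structure PairPotential (η : ℝ) where
  (A B C H11 H12 H22 P11 P12 P22 : ℝ → ℝ)
  contA : Continuous A
  contB : Continuous B
  contC : Continuous C
  derivH11 : ∀ x, HasDerivAt H11 (A x) x
  derivH12 : ∀ x, HasDerivAt H12 (B x) x
  derivH22 : ∀ x, HasDerivAt H22 (C x) x
  derivP11 : ∀ x, HasDerivAt P11 (H11 x) x
  derivP12 : ∀ x, HasDerivAt P12 (H12 x) x
  derivP22 : ∀ x, HasDerivAt P22 (H22 x) x
  form_nonneg : ∀ x, 0 ≤ 1 + x ^ 2 + (A x + 2 * x * B x + x ^ 2 * C x)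
  boundH : ∀ x s t : ℝ,
    |s ^ 2 * H11 x + 2 * s * t * H12 x + t ^ 2 * H22 x| ≤ η / 2 * (s ^ 2 + t ^ 2)
  boundP : ∀ x s t : ℝ,
    |s ^ 2 * P11 x + 2 * s * t * P12 x + t ^ 2 * P22 x| ≤ η ^ 2 / 12 * (s ^ 2 + t ^ 2)
  H11_zero : H11 0 = 0
  P12_zero : P12 0 = 0

/-- The excess `q - (1 + x²)` of the quadratic form over its diagonal part. -/
def PairPotential.excess {η : ℝ} (D : PairPotential η) (x : ℝ) : ℝ :=
  D.A x + 2 * x * D.B x + x ^ 2 * D.C x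

/-- The boundary term of an integration by parts with the multipliers `p` and `σ`: the value at `x`
of `k (H₁₁ + 2 x H₁₂ + x² H₂₂) + K ⬝ P`, where `k = x p + σ` and
`K = (2 p, x p - σ, -2 σ x)`. -/
noncomputable def PairPotential.boundary {η : ℝ} (D : PairPotential η) (x p σ : ℝ) : ℝ :=
  (x * p + σ) * (D.H11 x + 2 * x * D.H12 x + x ^ 2 * D.H22 x)
    + (2 * p * D.P11 x + 2 * (x * p - σ) * D.P12 x + -2 * σ * x * D.P22 x)

/-- The pointwise conditions on multipliers `p`, `σ` and a compensator `e` (with derivatives `p'`,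
`σ'`, `e'`) under which an integration by parts loses at most the budget `α |w'| + ⅔ |(x² w)'|`.
The loss minus the budget is linear in `(w, w')` where `w'` and `(x² w)'` keep their signs, so that
the last three conjuncts, for `w' = 0`, for `(x² w)' = 0` and for `w = 0`, are enough. Here `g` stands for `1 / η`. -/
def PhaseCond (α g η x p p' σ σ' e e' : ℝ) : Prop :=
  0 ≤ x * p + σ ∧ x * p + σ ≤ 1 ∧ ∃ T₀ T₁ T₂ : ℝ,
    TraceNormLE (2 * p) (x * p - σ) (-2 * σ * x) T₀ ∧
    TraceNormLE (2 * p') (p + x * p' - σ') (-2 * σ - 2 * σ' * x) T₁ ∧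
    TraceNormLE (x * p' - 2 * p) (x / 2 * (p + x * p' - σ') - (x * p - σ))
      (x / 2 * (-2 * σ - 2 * σ' * x) + 2 * σ * x) T₂ ∧
    g * ((1 - (x * p + σ)) * (1 + x ^ 2) - (1 - 3 / 2 * α))
      + 1 / 2 * (1 + x ^ 2) * |p + x * p' + σ' + 2 * p| + η / 12 * T₁ + e' ≤ 4 / 3 * x ∧
    x / 2 * (g * ((1 - (x * p + σ)) * (1 + x ^ 2) - (1 - 3 / 2 * α)))
      + 1 / 2 * (1 + x ^ 2) * |x / 2 * (p + x * p' + σ') - σ| + η / 12 * T₂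
      + x / 2 * e' - e ≤ α ∧
    1 / 2 * (1 + x ^ 2) * (x * p + σ) + η / 12 * T₀ + |e| ≤ α + 2 / 3 * x ^ 2

/-- The conditions are convex in `(g, η, e)` and monotone in `η`. -/
theorem PhaseCond.comb {α g₀ g₁ η₀ η₁ η x p p' σ σ' e₀ e₁ e₀' e₁' s t : ℝ}
    (h₀ : PhaseCond α g₀ η₀ x p p' σ σ' e₀ e₀') (h₁ : PhaseCond α g₁ η₁ x p p' σ σ' e₁ e₁')
    (hη₀ : 0 ≤ η₀) (hη₁ : 0 ≤ η₁) (hs : 0 ≤ s) (ht : 0 ≤ t) (hst : s + t = 1)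
    (hη : η ≤ s * η₀ + t * η₁) :
    PhaseCond α (s * g₀ + t * g₁) η x p p' σ σ' (s * e₀ + t * e₁) (s * e₀' + t * e₁') := by
  obtain ⟨k0, k1, T₀, T₁, T₂, a0, a1, a2, ha, hb, hc⟩ := h₀
  obtain ⟨-, -, U₀, U₁, U₂, b0, b1, b2, ha', hb', hc'⟩ := h₁
  -- use the smaller of the two bounds on each trace norm
  have hmin : ∀ {a b c T U : ℝ}, TraceNormLE a b c T → TraceNormLE a b c U →
      TraceNormLE a b c (min T U) := fun h h' p q r hb => le_min (h p q r hb) (h' p q r hb)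
  have hT : ∀ {T U : ℝ}, 0 ≤ min T U → η / 12 * min T U ≤ s * (η₀ / 12 * T) + t * (η₁ / 12 * U) := by
    intro T U h
    calc η / 12 * min T U ≤ (s * η₀ + t * η₁) / 12 * min T U := by gcongr
      _ = s * (η₀ / 12 * min T U) + t * (η₁ / 12 * min T U) := by ring
      _ ≤ _ := by
        gcongr
        · exact min_le_left _ _
        · exact min_le_right _ _
  obtain rfl : t = 1 - s := by linarith
  have hT0 := hT (hmin a0 b0).nonneg
  have hT1 := hT (hmin a1 b1).nonneg
  have hT2 := hT (hmin a2 b2).nonneg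
  have hab : |s * e₀ + (1 - s) * e₁| ≤ s * |e₀| + (1 - s) * |e₁| :=
    (abs_add_le _ _).trans_eq (by rw [abs_mul, abs_mul, abs_of_nonneg hs, abs_of_nonneg ht])
  refine ⟨k0, k1, min T₀ U₀, min T₁ U₁, min T₂ U₂, hmin a0 b0, hmin a1 b1, hmin a2 b2, ?_, ?_, ?_⟩
  · linear_combination s * ha + (1 - s) * ha' + hT1
  · linear_combination s * hb + (1 - s) * hb' + hT2
  · linear_combination s * hc + (1 - s) * hc' + hT0 + hab

variable {η : ℝ} (D : PairPotential η)

/-- The loss of the integration by parts is within the budget at every point. -/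
theorem PairPotential.deriv_boundary_le (hη : 0 < η) {α x p p' σ σ' e e' W V : ℝ} (hx : 0 < x)
    (hW : 0 ≤ W) (h : PhaseCond α η⁻¹ η x p p' σ σ' e e') :
    ((p + x * p' + σ' + 2 * p) * W + (x * p + σ) * V)
        * (D.H11 x + 2 * x * D.H12 x + x ^ 2 * D.H22 x)
      + (x * p + σ) * W * D.excess x
      + ((2 * p' * W + 2 * p * V) * D.P11 x
        + 2 * ((p + x * p' - σ') * W + (x * p - σ) * V) * D.P12 x
        + ((-2 * σ - 2 * σ' * x) * W + -2 * σ * x * V) * D.P22 x)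
      + η * (e' * W + e * V)
    ≤ W * D.excess x + η * (α * |V| + 2 / 3 * |2 * x * W + x ^ 2 * V|)
      + (1 - 3 / 2 * α) * W := by
  obtain ⟨k0, k1, T₀, T₁, T₂, t0, t1, t2, ha, hb, hc⟩ := h
  set k := x * p + σ with hk
  set S := 1 + x ^ 2 with hS
  set h := D.H11 x + 2 * x * D.H12 x + x ^ 2 * D.H22 x with hh
  have hSp : 0 < S := by positivity
  have hhb : |h| ≤ η / 2 * S := by
    have := D.boundH x 1 x
    rwa [show (1:ℝ) ^ 2 * D.H11 x + 2 * 1 * x * D.H12 x + x ^ 2 * D.H22 x = h by rw [hh]; ring,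
      show (1:ℝ) ^ 2 + x ^ 2 = S by rw [hS]; ring] at this
  have hm : 0 < η ^ 2 / 12 := by positivity
  have B0 := t0.bound hm (D.boundP x)
  have B1 := t1.bound hm (D.boundP x)
  have B2 := t2.bound hm (D.boundP x)
  set Y0 := 2 * p * D.P11 x + 2 * (x * p - σ) * D.P12 x + -2 * σ * x * D.P22 x with hY0
  set Y1 := 2 * p' * D.P11 x + 2 * (p + x * p' - σ') * D.P12 x
    + (-2 * σ - 2 * σ' * x) * D.P22 x with hY1
  have hY2 : (x * p' - 2 * p) * D.P11 x + 2 * (x / 2 * (p + x * p' - σ') - (x * p - σ)) * D.P12 x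
      + (x / 2 * (-2 * σ - 2 * σ' * x) + 2 * σ * x) * D.P22 x = x / 2 * Y1 - Y0 := by
    rw [hY0, hY1]; ring
  rw [hY2] at B2
  have hQ : -S ≤ D.excess x := by
    have := D.form_nonneg x
    simp only [PairPotential.excess, hS]; linarith
  set Q := D.excess x
  have hmul : ∀ r : ℝ, r * h ≤ η * (1 / 2 * S * |r|) := fun r => by
    calc r * h ≤ |r * h| := le_abs_self _
      _ = |r| * |h| := abs_mul _ _
      _ ≤ |r| * (η / 2 * S) := by gcongr
      _ = _ := by ring
  have hkQ : -((1 - k) * Q) ≤ (1 - k) * S := by nlinarith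
  have hgη : η * η⁻¹ = 1 := mul_inv_cancel₀ hη.ne'
  -- the three extreme cases `V = 0`, `V = -2 W / x` and `|V| = ∞`
  have Ca : (p + x * p' + σ' + 2 * p) * h - (1 - k) * Q + Y1 + η * e' - (1 - 3 / 2 * α)
      ≤ η * (4 / 3 * x) := by
    have h1 := hmul (p + x * p' + σ' + 2 * p)
    have h2 := (abs_le.1 B1).2
    have h3 := mul_le_mul_of_nonneg_left ha hη.le
    linear_combination h1 + h2 + h3 + hkQ - ((1 - k) * S - (1 - 3 / 2 * α)) * hgη
  have Cb : (x / 2 * (p + x * p' + σ') - σ) * h - x / 2 * ((1 - k) * Q) + (x / 2 * Y1 - Y0)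
      + η * (x / 2 * e' - e) - x / 2 * (1 - 3 / 2 * α) ≤ η * α := by
    have h1 := hmul (x / 2 * (p + x * p' + σ') - σ)
    have h2 := (abs_le.1 B2).2
    have h3 := mul_le_mul_of_nonneg_left hb hη.le
    have h4 := mul_le_mul_of_nonneg_left hkQ (by positivity : 0 ≤ x / 2)
    linear_combination h1 + h2 + h3 + h4 - x / 2 * ((1 - k) * S - (1 - 3 / 2 * α)) * hgη
  have Cc : ∀ r : ℝ, |r| = 1 → r * (k * h + Y0 + η * e) ≤ η * (α + 2 / 3 * x ^ 2) := by
    intro r hr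
    have h1 := hmul (r * k)
    rw [abs_mul, hr, one_mul, abs_of_nonneg k0] at h1
    have h2 : r * Y0 ≤ η ^ 2 / 12 * T₀ := by
      refine (le_abs_self _).trans ?_
      rw [abs_mul, hr, one_mul]; exact B0
    have h5 : r * e ≤ |e| := by
      refine (le_abs_self _).trans ?_
      rw [abs_mul, hr, one_mul]
    have h3 := mul_le_mul_of_nonneg_left hc hη.le
    have h6 := mul_le_mul_of_nonneg_left h5 hη.le
    linear_combination h1 + h2 + h3 + h6
  have C1 := Cc 1 (by simp)
  have C2 := Cc (-1) (by simp)
  rcases le_total 0 V with hV | hV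
  · rw [abs_of_nonneg hV, abs_of_nonneg (by positivity)]
    have h1 := mul_le_mul_of_nonneg_left Ca hW
    have h2 := mul_le_mul_of_nonneg_left C1 hV
    linear_combination h1 + h2
  · rcases le_total 0 (2 * x * W + x ^ 2 * V) with hZ | hZ
    · rw [abs_of_nonpos hV, abs_of_nonneg hZ]
      have hW' : 0 ≤ W + x / 2 * V := by
        have : 0 ≤ 2 * x * (W + x / 2 * V) := by linarith
        exact nonneg_of_mul_nonneg_right this (by positivity)
      have h1 := mul_le_mul_of_nonneg_left Ca hW'
      have h2 := mul_le_mul_of_nonneg_left Cb (neg_nonneg.2 hV)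
      linear_combination h1 + h2
    · rw [abs_of_nonpos hV, abs_of_nonpos hZ]
      obtain ⟨Z, rfl⟩ : ∃ Z, W = Z * (x / 2) := ⟨2 / x * W, by field_simp⟩
      have hZ0 : 0 ≤ Z := nonneg_of_mul_nonneg_left hW (by positivity)
      have hV' : 0 ≤ -Z - V := by
        have : 0 ≤ x ^ 2 * (-Z - V) := by linarith
        exact nonneg_of_mul_nonneg_right this (by positivity)
      have h1 := mul_le_mul_of_nonneg_left Cb hZ0
      have h2 := mul_le_mul_of_nonneg_left C2 hV'
      linear_combination h1 + h2

/-- The integrand whose integral over an initial segment is bounded below by a boundary term: the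
weighted excess together with the budget. The term `(1 - 3 α / 2) w` is the part of the diagonal
term `w` that is left when the hypothesis `η ‖w'‖₁ ≤ 3 / 2 ∫ w` has paid for `η α |w'|`. -/
noncomputable def PairPotential.integrand (D : PairPotential η) (α : ℝ) (w w' : ℝ → ℝ) (x : ℝ) : ℝ :=
  w x * D.excess x + η * (α * |w' x| + 2 / 3 * |2 * x * w x + x ^ 2 * w' x|)
    + (1 - 3 / 2 * α) * w x

/-- The integral of the weighted excess and the budget over `[0, x]` is at least the boundary term
with multipliers `p`, `σ` and compensator `e`. -/
def PairPotential.Reaches (D : PairPotential η) (α : ℝ) (w w' : ℝ → ℝ) (x p σ e : ℝ) : Prop :=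
  w x * D.boundary x p σ + η * (e * w x) ≤ ∫ y in (0 : ℝ)..x, D.integrand α w w' y

variable {D} {α : ℝ} {w w' : ℝ → ℝ}

theorem PairPotential.continuous_integrand (hw : Continuous w) (hw' : Continuous w') :
    Continuous (D.integrand α w w') := by
  have := D.contA
  have := D.contB
  have := D.contC
  unfold PairPotential.integrand PairPotential.excess
  fun_prop

/-- Integration by parts on one segment. -/
theorem PairPotential.Reaches.step (hη : 0 < η) (hw : ∀ x, HasDerivAt w (w' x) x)
    (hw' : Continuous w') (hw0 : ∀ x, 0 ≤ w x) {x₀ x₁ : ℝ} (hx₀ : 0 ≤ x₀) (hx : x₀ ≤ x₁)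
    {p p' σ σ' e e' : ℝ → ℝ}
    (hp : ContinuousOn p (Set.Icc x₀ x₁)) (hσ : ContinuousOn σ (Set.Icc x₀ x₁))
    (he : ContinuousOn e (Set.Icc x₀ x₁))
    (hp' : ∀ x ∈ Set.Ioo x₀ x₁, HasDerivAt p (p' x) x)
    (hσ' : ∀ x ∈ Set.Ioo x₀ x₁, HasDerivAt σ (σ' x) x)
    (he' : ∀ x ∈ Set.Ioo x₀ x₁, HasDerivAt e (e' x) x)
    (hc : ∀ x ∈ Set.Ioo x₀ x₁, PhaseCond α η⁻¹ η x (p x) (p' x) (σ x) (σ' x) (e x) (e' x))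
    (h : D.Reaches α w w' x₀ (p x₀) (σ x₀) (e x₀)) :
    D.Reaches α w w' x₁ (p x₁) (σ x₁) (e x₁) := by
  have hwc : Continuous w := continuous_iff_continuousAt.2 fun x => (hw x).continuousAt
  have hIc := D.continuous_integrand (α := α) hwc hw'
  have hH11 : Continuous D.H11 := continuous_iff_continuousAt.2 fun x => (D.derivH11 x).continuousAt
  have hH12 : Continuous D.H12 := continuous_iff_continuousAt.2 fun x => (D.derivH12 x).continuousAt
  have hH22 : Continuous D.H22 := continuous_iff_continuousAt.2 fun x => (D.derivH22 x).continuousAt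
  have hP11 : Continuous D.P11 := continuous_iff_continuousAt.2 fun x => (D.derivP11 x).continuousAt
  have hP12 : Continuous D.P12 := continuous_iff_continuousAt.2 fun x => (D.derivP12 x).continuousAt
  have hP22 : Continuous D.P22 := continuous_iff_continuousAt.2 fun x => (D.derivP22 x).continuousAt
  have hsub := intervalIntegral.sub_le_integral_of_hasDeriv_right_of_le
    (g := fun x => w x * D.boundary x (p x) (σ x) + η * (e x * w x)) (φ := D.integrand α w w') hx
    (by
      have := hwc.continuousOn (s := Set.Icc x₀ x₁)
      have := hH11.continuousOn (s := Set.Icc x₀ x₁)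
      have := hH12.continuousOn (s := Set.Icc x₀ x₁)
      have := hH22.continuousOn (s := Set.Icc x₀ x₁)
      have := hP11.continuousOn (s := Set.Icc x₀ x₁)
      have := hP12.continuousOn (s := Set.Icc x₀ x₁)
      have := hP22.continuousOn (s := Set.Icc x₀ x₁)
      unfold PairPotential.boundary
      fun_prop)
    (fun x hxx => by
      refine HasDerivAt.hasDerivWithinAt ?_
      have d1 := hp' x hxx
      have d2 := hσ' x hxx
      have d3 := he' x hxx
      have dx := hasDerivAt_id' x
      have dk := (dx.mul d1).add d2
      have dh := ((D.derivH11 x).add ((dx.mul (D.derivH12 x)).const_mul 2)).add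
        ((dx.pow 2).mul (D.derivH22 x))
      have dP := ((d1.mul (D.derivP11 x)).const_mul 2).add
        (((((dx.mul d1).sub d2).mul (D.derivP12 x)).const_mul 2).add
        (((d2.mul dx).mul (D.derivP22 x)).const_mul (-2)))
      have dd := ((hw x).mul ((dk.mul dh).add dP)).add ((d3.mul (hw x)).const_mul η)
      refine (dd.congr_of_eventuallyEq (Filter.Eventually.of_forall fun y => ?_))
      simp only [PairPotential.boundary, Pi.add_apply, Pi.mul_apply, Pi.sub_apply, Pi.pow_apply]
      ring)
    (hIc.continuousOn.integrableOn_Icc)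
    (fun x hxx => by
      have := D.deriv_boundary_le hη (V := w' x) (lt_of_le_of_lt hx₀ hxx.1) (hw0 x) (hc x hxx)
      refine le_trans (le_of_eq ?_) this
      simp only [PairPotential.excess, Pi.add_apply, Pi.mul_apply, Pi.sub_apply, Pi.pow_apply]
      push_cast
      ring)
  unfold PairPotential.Reaches at *
  rw [← intervalIntegral.integral_add_adjacent_intervals
    (hIc.intervalIntegrable 0 x₀) (hIc.intervalIntegrable x₀ x₁)]
  linarith

/-- The compensator may drop. -/
theorem PairPotential.Reaches.mono (hη : 0 < η) (hw0 : ∀ x, 0 ≤ w x) {x p σ e e' : ℝ}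
    (h : D.Reaches α w w' x p σ e) (he : e' ≤ e) : D.Reaches α w w' x p σ e' := by
  unfold PairPotential.Reaches at *
  have : η * (e' * w x) ≤ η * (e * w x) := by have := hw0 x; gcongr
  linarith

/-- At the origin the boundary term is `2 p P₁₁(0) w(0)`, and the compensator pays for it. -/
theorem PairPotential.reaches_zero (hη : 0 < η) (hw0 : ∀ x, 0 ≤ w x) {p σ e : ℝ}
    (he : e ≤ -(η / 6 * |p|)) : D.Reaches α w w' 0 p σ e := by
  unfold PairPotential.Reaches PairPotential.boundary
  rw [intervalIntegral.integral_same, D.H11_zero, D.P12_zero]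
  have h1 : |D.P11 0| ≤ η ^ 2 / 12 := by simpa using D.boundP 0 1 0
  have h2 : p * D.P11 0 ≤ |p| * (η ^ 2 / 12) :=
    (le_abs_self _).trans (by rw [abs_mul]; gcongr)
  have h3 : 2 * (p * D.P11 0) + η * e ≤ 0 := by nlinarith
  have := mul_nonneg (hw0 0) (neg_nonneg.2 h3)
  nlinarith

/-- A jump of the multipliers that keeps `k` costs the trace norm of the jump of `K`. -/
theorem PairPotential.Reaches.jump (hη : 0 < η) (hw0 : ∀ x, 0 ≤ w x) {x p σ e q τ d T : ℝ}
    (h : D.Reaches α w w' x p σ e) (hk : x * p + σ = x * q + τ)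
    (hT : TraceNormLE (2 * (q - p)) (x * (q - p) - (τ - σ)) (-2 * (τ - σ) * x) T)
    (hd : d + η / 12 * T ≤ e) : D.Reaches α w w' x q τ d := by
  have B := (abs_le.1 (hT.bound (by positivity : 0 < η ^ 2 / 12) (D.boundP x))).2
  unfold PairPotential.Reaches PairPotential.boundary at *
  refine le_trans ?_ h
  rw [← hk]
  have h1 := mul_le_mul_of_nonneg_left B (hw0 x)
  have h2 := mul_le_mul_of_nonneg_left hd (mul_nonneg hη.le (hw0 x))
  linear_combination h1 + h2

/-! ### Rational polynomials on the unit interval -/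

/-- Sum of polynomials given by their lists of coefficients, constant term first. -/
def polyAdd : List ℚ → List ℚ → List ℚ
  | [], b => b
  | a, [] => a
  | a :: l, b :: m => (a + b) :: polyAdd l m

/-- Scalar multiple of a polynomial given by its list of coefficients. -/
def polyScale (c : ℚ) : List ℚ → List ℚ
  | [] => []
  | a :: l => (c * a) :: polyScale c l

/-- Difference of polynomials given by their lists of coefficients. -/
def polySub (a b : List ℚ) : List ℚ := polyAdd a (polyScale (-1) b)

/-- Product of polynomials given by their lists of coefficients. -/
def polyMul : List ℚ → List ℚ → List ℚ
  | [], _ => []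
  | a :: l, m => polyAdd (polyScale a m) (0 :: polyMul l m)

/-- The value at a real number of a polynomial given by its list of coefficients. -/
noncomputable def polyEval (t : ℝ) : List ℚ → ℝ
  | [] => 0
  | a :: l => a + t * polyEval t l

/-- All partial sums of the list, started at `s`, are nonnegative. -/
def partialSumsNonneg : ℚ → List ℚ → Bool
  | _, [] => true
  | s, c :: l => decide (0 ≤ s + c) && partialSumsNonneg (s + c) l

section
variable (t : ℝ)

@[simp] theorem polyEval_nil : polyEval t [] = 0 := rfl

@[simp] theorem polyEval_cons (a : ℚ) (l : List ℚ) :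
    polyEval t (a :: l) = a + t * polyEval t l := rfl

@[simp] theorem polyEval_add (a b : List ℚ) :
    polyEval t (polyAdd a b) = polyEval t a + polyEval t b := by
  induction a generalizing b with
  | nil => simp [polyAdd]
  | cons x l ih =>
    cases b with
    | nil => simp [polyAdd]
    | cons y m => simp only [polyAdd, polyEval_cons, ih]; push_cast; ring

@[simp] theorem polyEval_scale (c : ℚ) (a : List ℚ) :
    polyEval t (polyScale c a) = c * polyEval t a := by
  induction a with
  | nil => simp [polyScale]
  | cons x l ih => simp only [polyScale, polyEval_cons, ih]; push_cast; ring

@[simp] theorem polyEval_sub (a b : List ℚ) :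
    polyEval t (polySub a b) = polyEval t a - polyEval t b := by
  simp [polySub, sub_eq_add_neg]

@[simp] theorem polyEval_mul (a b : List ℚ) :
    polyEval t (polyMul a b) = polyEval t a * polyEval t b := by
  induction a with
  | nil => simp [polyMul]
  | cons x l ih => simp only [polyMul, polyEval_add, polyEval_scale, polyEval_cons, ih]; push_cast; ring

/-- Abel summation: nonnegative partial sums of the coefficients make a polynomial nonnegative on
`[0, 1]`. -/
theorem polyEval_nonneg_of_partialSums {t : ℝ} (h0 : 0 ≤ t) (h1 : t ≤ 1) (l : List ℚ) (s : ℚ)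
    (hs : 0 ≤ s) (h : partialSumsNonneg s l = true) : 0 ≤ (s : ℝ) + polyEval t l := by
  induction l generalizing s with
  | nil => simpa using hs
  | cons c l ih =>
    simp only [partialSumsNonneg, Bool.and_eq_true, decide_eq_true_eq] at h
    have h2 := ih (s + c) h.1 h.2
    have h3 : (0 : ℝ) ≤ ((s + c : ℚ) : ℝ) := by exact_mod_cast h.1
    push_cast at h2 h3
    rw [polyEval_cons]
    nlinarith [mul_nonneg h0 h2, mul_nonneg (sub_nonneg.2 h1) h3]

end

/-! ### Certificates for the multipliers -/

/-- A rational test for `TraceNormLE`, through `traceNormLE_of_sq`. -/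
def traceNormTest (a b c T : ℚ) : Bool :=
  decide (0 ≤ T) && decide (a + c ≤ T) && decide (-T ≤ a + c)
    && decide ((a - c) ^ 2 + 4 * b ^ 2 ≤ T ^ 2)

theorem traceNormLE_of_test {a b c T : ℚ} (h : traceNormTest a b c T = true) :
    TraceNormLE a b c T := by
  simp only [traceNormTest, Bool.and_eq_true, decide_eq_true_eq] at h
  obtain ⟨⟨⟨h1, h2⟩, h3⟩, h4⟩ := h
  refine traceNormLE_of_sq (by exact_mod_cast h1) (abs_le.2 ⟨?_, ?_⟩) ?_
  · exact_mod_cast h3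
  · exact_mod_cast h2
  · exact_mod_cast h4

/-- A segment `[x, x + d]` with multipliers `p`, `σ` that are linear with slopes `p'`, `σ'`, and
bounds for the trace norms in `PhaseCond`: Bernstein coefficients `a₀, a₁, a₂` for `T₀`, and the
values at the end points `b₀, b₁` for `T₁` and `c₀, c₁` for `T₂`. -/
structure Segment where
  (x d p p' σ σ' a₀ a₁ a₂ b₀ b₁ c₀ c₁ : ℚ)

namespace Segment
variable (I : Segment)

/-- The part of the test of a segment that does not depend on the compensator. -/
def testMultipliers : Bool :=
  let y := I.x + I.d
  let q := I.p + I.d * I.p'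
  let τ := I.σ + I.d * I.σ'
  let r := I.p - I.p' * I.x
  let ρ := I.σ - I.σ' * I.x
  decide (0 ≤ I.x) && decide (0 < I.d) && decide (0 ≤ I.p) && decide (0 ≤ q) && decide (0 ≤ I.σ)
    && decide (0 ≤ τ) && decide (I.x * I.p + I.σ ≤ 1) && decide (y * q + τ ≤ 1)
    && decide ((I.x * q + y * I.p + I.σ + τ) / 2 ≤ 1)
    && traceNormTest (2 * I.p) (I.x * I.p - I.σ) (-2 * I.σ * I.x) I.a₀
    && traceNormTest (I.p + q) ((I.x * q + y * I.p - I.σ - τ) / 2) (-(I.σ * y + τ * I.x)) I.a₁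
    && traceNormTest (2 * q) (y * q - τ) (-2 * τ * y) I.a₂
    && traceNormTest (2 * I.p') (I.p + I.x * I.p' - I.σ') (-2 * I.σ - 2 * I.σ' * I.x) I.b₀
    && traceNormTest (2 * I.p') (q + y * I.p' - I.σ') (-2 * τ - 2 * I.σ' * y) I.b₁
    && traceNormTest (-2 * r - I.p' * I.x) (ρ + (I.σ' - r) / 2 * I.x) (ρ * I.x) I.c₀
    && traceNormTest (-2 * r - I.p' * y) (ρ + (I.σ' - r) / 2 * y) (ρ * y) I.c₁

/-- The polynomial `k = x p + σ`. -/
def polyK : List ℚ := polyAdd (polyMul [I.x, I.d] [I.p, I.d * I.p']) [I.σ, I.d * I.σ']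

/-- The polynomial `k'`. -/
def polyK' : List ℚ :=
  polyAdd [I.p, I.d * I.p'] (polyAdd (polyScale I.p' [I.x, I.d]) [I.σ'])

/-- The polynomial `1 + x²`. -/
def polyS : List ℚ := polyAdd [1] (polyMul [I.x, I.d] [I.x, I.d])

/-- The polynomial `g ((1 - k) (1 + x²) - (1 - 3 α / 2)) + e'`. -/
def polyLoss (α g e₁ e₂ : ℚ) : List ℚ :=
  polyAdd (polyScale g (polySub (polyMul (polySub [1] I.polyK) I.polyS) [1 - 3 / 2 * α]))
    [e₁ / I.d, 2 * e₂ / I.d]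

/-- Nonnegativity on `[0, 1]` of `a - b` and `a + b`, by partial sums. -/
def absTest (a b : List ℚ) : Bool :=
  partialSumsNonneg 0 (polySub a b) && partialSumsNonneg 0 (polyAdd a b)

/-- The part of the test of a segment that concerns the compensator `e₀ + e₁ t + e₂ t²`, where
`t ∈ [0, 1]` is the relative position in the segment. -/
def testCompensator (α g e₀ e₁ e₂ : ℚ) : Bool :=
  absTest (polySub (polyScale (4 / 3) [I.x, I.d])
      (polyAdd (I.polyLoss α g e₁ e₂) (polyScale (1 / g / 12) [I.b₀, I.b₁ - I.b₀])))
    (polyScale (1 / 2) (polyMul I.polyS (polyAdd I.polyK' (polyScale 2 [I.p, I.d * I.p']))))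
  && absTest (polySub (polyAdd [α] [e₀, e₁, e₂])
      (polyAdd (polyScale (1 / 2) (polyMul [I.x, I.d] (I.polyLoss α g e₁ e₂)))
        (polyScale (1 / g / 12) [I.c₀, I.c₁ - I.c₀])))
    (polyScale (1 / 2) (polyMul I.polyS
      (polySub (polyScale (1 / 2) (polyMul [I.x, I.d] I.polyK')) [I.σ, I.d * I.σ'])))
  && absTest (polySub (polyAdd [α] (polyScale (2 / 3) (polyMul [I.x, I.d] [I.x, I.d])))
      (polyAdd (polyScale (1 / 2) (polyMul I.polyS I.polyK))
        (polyScale (1 / g / 12) [I.a₀, 2 * (I.a₁ - I.a₀), I.a₀ - 2 * I.a₁ + I.a₂])))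
    [e₀, e₁, e₂]

theorem abs_le_of_absTest {a b : List ℚ} (h : absTest a b = true) {t : ℝ} (h0 : 0 ≤ t)
    (h1 : t ≤ 1) : |polyEval t b| ≤ polyEval t a := by
  simp only [absTest, Bool.and_eq_true] at h
  have P := polyEval_nonneg_of_partialSums h0 h1 _ _ le_rfl h.1
  have Q := polyEval_nonneg_of_partialSums h0 h1 _ _ le_rfl h.2
  rw [polyEval_sub, Rat.cast_zero] at P
  rw [polyEval_add, Rat.cast_zero] at Q
  rw [abs_le]; constructor <;> linarith

variable {I}

theorem polyEval_X (t : ℝ) : polyEval t [I.x, I.d] = I.x + I.d * t := by simp; ring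

theorem polyEval_P (t : ℝ) : polyEval t [I.p, I.d * I.p'] = I.p + I.p' * (I.d * t) := by
  simp; ring

theorem polyEval_Y (t : ℝ) : polyEval t [I.σ, I.d * I.σ'] = I.σ + I.σ' * (I.d * t) := by
  simp; ring

theorem polyEval_K (t : ℝ) : polyEval t I.polyK
    = (I.x + I.d * t) * (I.p + I.p' * (I.d * t)) + (I.σ + I.σ' * (I.d * t)) := by
  rw [polyK, polyEval_add, polyEval_mul, polyEval_X, polyEval_P, polyEval_Y]

theorem polyEval_K' (t : ℝ) : polyEval t I.polyK'
    = I.p + I.p' * (I.d * t) + (I.x + I.d * t) * I.p' + I.σ' := by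
  rw [polyK', polyEval_add, polyEval_add, polyEval_scale, polyEval_X, polyEval_P]
  simp; ring

theorem polyEval_S (t : ℝ) : polyEval t I.polyS = 1 + (I.x + I.d * t) ^ 2 := by
  rw [polyS, polyEval_add, polyEval_mul, polyEval_X]
  simp; ring

theorem polyEval_loss (t : ℝ) (α g e₁ e₂ : ℚ) : polyEval t (I.polyLoss α g e₁ e₂)
    = g * ((1 - polyEval t I.polyK) * (1 + (I.x + I.d * t) ^ 2) - (1 - 3 / 2 * α))
      + (e₁ + 2 * e₂ * t) / I.d := by
  rw [polyLoss, polyEval_add, polyEval_scale, polyEval_sub, polyEval_mul, polyEval_sub, polyEval_S]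
  simp; ring

theorem polyEval_E (t : ℝ) (e₀ e₁ e₂ : ℚ) :
    polyEval t [e₀, e₁, e₂] = e₀ + e₁ * t + e₂ * t ^ 2 := by simp; ring

/-- Both parts of the test give `PhaseCond` on the whole segment. The entries of the matrix for `T₀`
are quadratic in the relative position and those for `T₁` and `T₂` are linear, so that convexity
reduces the trace norms to their Bernstein coefficients. -/
theorem phaseCond (h : I.testMultipliers = true) {α g e₀ e₁ e₂ : ℚ} (hg : 0 < g)
    (h' : I.testCompensator α g e₀ e₁ e₂ = true) {t : ℝ} (ht0 : 0 ≤ t) (ht1 : t ≤ 1) :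
    PhaseCond α g (1 / g) (I.x + I.d * t) (I.p + I.p' * (I.d * t)) I.p' (I.σ + I.σ' * (I.d * t)) I.σ'
      (e₀ + e₁ * t + e₂ * t ^ 2) ((e₁ + 2 * e₂ * t) / I.d) := by
  simp only [testMultipliers, Bool.and_eq_true, decide_eq_true_eq] at h
  obtain ⟨⟨⟨⟨⟨⟨⟨⟨⟨⟨⟨⟨⟨⟨⟨hx, hd⟩, hp⟩, hq⟩, hσ⟩, hτ⟩, k0⟩, k2⟩, k1⟩, A0⟩, A1⟩, A2⟩, B0⟩, B1⟩, C0⟩, C1⟩ := h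
  simp only [testCompensator, Bool.and_eq_true] at h'
  obtain ⟨⟨P1, P2⟩, P3⟩ := h'
  replace P1 := abs_le_of_absTest P1 ht0 ht1
  replace P2 := abs_le_of_absTest P2 ht0 ht1
  replace P3 := abs_le_of_absTest P3 ht0 ht1
  simp only [polyEval_scale, polyEval_mul, polyEval_add, polyEval_sub, polyEval_X, polyEval_P,
    polyEval_Y, polyEval_S, polyEval_K', polyEval_loss, polyEval_E] at P1 P2 P3
  rw [polyEval_K] at P1 P2 P3
  rw [abs_mul, abs_mul] at P1 P2
  set k := ((I.x : ℝ) + I.d * t) * (I.p + I.p' * (I.d * t)) + (I.σ + I.σ' * (I.d * t)) with hk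
  set S := 1 + ((I.x : ℝ) + I.d * t) ^ 2 with hS
  have hSabs : |S| = S := abs_of_nonneg (by rw [hS]; positivity)
  have A0 := traceNormLE_of_test A0
  have A1 := traceNormLE_of_test A1
  have A2 := traceNormLE_of_test A2
  have B0 := traceNormLE_of_test B0
  have B1 := traceNormLE_of_test B1
  have C0 := traceNormLE_of_test C0
  have C1 := traceNormLE_of_test C1
  have hdR : (0 : ℝ) < I.d := by exact_mod_cast hd
  have hgR : (0 : ℝ) < g := by exact_mod_cast hg
  have hs : (0 : ℝ) ≤ 1 - t := by linarith
  have hxR : (0 : ℝ) ≤ I.x := by exact_mod_cast hx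
  have hpR : (0 : ℝ) ≤ I.p := by exact_mod_cast hp
  have hσR : (0 : ℝ) ≤ I.σ := by exact_mod_cast hσ
  have hqR : (0 : ℝ) ≤ I.p + I.d * I.p' := by exact_mod_cast hq
  have hτR : (0 : ℝ) ≤ I.σ + I.d * I.σ' := by exact_mod_cast hτ
  have k0R : (I.x : ℝ) * I.p + I.σ ≤ 1 := by exact_mod_cast k0
  have k1R : ((I.x : ℝ) * (I.p + I.d * I.p') + (I.x + I.d) * I.p + I.σ + (I.σ + I.d * I.σ')) / 2
    ≤ 1 := by exact_mod_cast k1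
  have k2R : ((I.x : ℝ) + I.d) * (I.p + I.d * I.p') + (I.σ + I.d * I.σ') ≤ 1 := by
    exact_mod_cast k2
  refine ⟨?_, ?_, (1 - t) ^ 2 * I.a₀ + 2 * t * (1 - t) * I.a₁ + t ^ 2 * I.a₂,
    (1 - t) * I.b₀ + t * I.b₁, (1 - t) * I.c₀ + t * I.c₁, ?_, ?_, ?_, ?_, ?_, ?_⟩
  · have h1 : (0 : ℝ) ≤ I.p + I.p' * (I.d * t) := by
      linear_combination mul_nonneg hs hpR + mul_nonneg ht0 hqR
    have h2 : (0 : ℝ) ≤ I.σ + I.σ' * (I.d * t) := by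
      linear_combination mul_nonneg hs hσR + mul_nonneg ht0 hτR
    positivity
  · have h1 := mul_le_mul_of_nonneg_left k0R (sq_nonneg (1 - t))
    have h2 := mul_le_mul_of_nonneg_left k1R (mul_nonneg (mul_nonneg zero_le_two ht0) hs)
    have h3 := mul_le_mul_of_nonneg_left k2R (sq_nonneg t)
    linear_combination h1 + h2 + h3
  · have := (A0.comb A1 (sq_nonneg (1 - t)) (mul_nonneg (mul_nonneg zero_le_two ht0) hs)).comb A2
      zero_le_one (sq_nonneg t)
    push_cast at this
    convert this using 1 <;> ring
  · have := B0.comb B1 hs ht0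
    push_cast at this
    convert this using 1 <;> ring
  · have := C0.comb C1 hs ht0
    push_cast at this
    convert this using 1 <;> ring
  · simp only [polyEval_cons, polyEval_nil] at P1
    push_cast at P1
    rw [hSabs, abs_of_pos (by norm_num : (0 : ℝ) < 1 / 2)] at P1
    linear_combination P1
  · simp only [polyEval_cons, polyEval_nil] at P2
    push_cast at P2
    rw [hSabs, abs_of_pos (by norm_num : (0 : ℝ) < 1 / 2)] at P2
    rw [show ((I.x : ℝ) + I.d * t) / 2 * (I.p + I.p' * (I.d * t) + (I.x + I.d * t) * I.p' + I.σ')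
      = 1 / 2 * ((I.x + I.d * t) * (I.p + I.p' * (I.d * t) + (I.x + I.d * t) * I.p' + I.σ')) by
        ring]
    linear_combination P2
  · simp only [polyEval_cons, polyEval_nil] at P3
    push_cast at P3
    linear_combination P3

end Segment

section
variable {η : ℝ} {D : PairPotential η} {α : ℝ} {w w' : ℝ → ℝ}

/-- The multipliers `p = 1 / x`, `σ = 0`, for which `k = 1`, can be kept from a point `c` on to
infinity, with the compensator `e - l (x² - c²)`. -/
theorem PairPotential.Reaches.tail (hη : 0 < η) (hw : ∀ x, HasDerivAt w (w' x) x)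
    (hw' : Continuous w') (hw0 : ∀ x, 0 ≤ w x) {c e l : ℝ} (hc : 0 < c) (hα : α ≤ 2 / 3)
    (hl0 : 0 ≤ l) (hl : l ≤ 1 / 6)
    (h1 : 1 / c + η / 6 * (1 / c ^ 2) ≤ c / 3 + 2 * l * c)
    (h2 : η / 12 * (2 + 9 / 4 * (1 / c ^ 2)) ≤ α + (e + l * c ^ 2))
    (h3 : 1 / 2 + η / 12 * (2 + 1 / c ^ 2) + 1 / 2 * c ^ 2 + |e| ≤ α + 2 / 3 * c ^ 2)
    (h : D.Reaches α w w' c c⁻¹ 0 e) {R : ℝ} (hR : c ≤ R) (hwR : w R = 0) :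
    0 ≤ ∫ y in (0 : ℝ)..R, D.integrand α w w' y := by
  have hgη : 0 < η⁻¹ := inv_pos.2 hη
  have key := PairPotential.Reaches.step (D := D) (α := α) (x₀ := c) (x₁ := R)
    (p := fun x => x⁻¹) (p' := fun x => -(x ^ 2)⁻¹) (σ := fun _ => 0)
    (σ' := fun _ => 0) (e := fun x => e + l * c ^ 2 - l * x ^ 2) (e' := fun x => -(2 * l * x))
    hη hw hw' hw0 hc.le hR
    (ContinuousOn.inv₀ continuousOn_id fun x hx => (hc.trans_le hx.1).ne') continuousOn_const
    (by fun_prop) (fun x hx => hasDerivAt_inv (hc.trans hx.1).ne') (fun x _ => hasDerivAt_const _ _)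
    (fun x _ => by
      have := (((hasDerivAt_id' x).pow 2).const_mul l).const_sub (e + l * c ^ 2)
      refine this.congr_deriv ?_
      simp; ring)
    (fun x hx => by
      have hcx : c ≤ x := hx.1.le
      have hx0 : 0 < x := hc.trans_le hcx
      have hxi : 1 / x ≤ 1 / c := one_div_le_one_div_of_le hc hcx
      have hxi2 : 1 / x ^ 2 ≤ 1 / c ^ 2 := one_div_le_one_div_of_le (by positivity) (by gcongr)
      have hk : x * x⁻¹ + 0 = 1 := by rw [mul_inv_cancel₀ hx0.ne', add_zero]
      have e1 : x⁻¹ + x * -(x ^ 2)⁻¹ = 0 := by field_simp; ring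
      have hsq : c ^ 2 ≤ x ^ 2 := by gcongr
      have hy : x⁻¹ ^ 2 = 1 / x ^ 2 := by field_simp
      have hi : 0 < 1 / x ^ 2 := by positivity
      refine ⟨by rw [hk]; exact zero_le_one, hk.le, 2 + 1 / x ^ 2, 2 * (1 / x ^ 2),
        2 + 9 / 4 * (1 / x ^ 2), ?_, ?_, ?_, ?_, ?_, ?_⟩
      · rw [sub_zero, mul_inv_cancel₀ hx0.ne']
        refine traceNormLE_of_sq (by positivity) ?_ ?_
        · rw [show 2 * x⁻¹ + -2 * 0 * x = 2 * x⁻¹ by ring, abs_of_pos (by positivity), ← hy]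
          nlinarith [sq_nonneg (x⁻¹ - 1)]
        · rw [← hy]; nlinarith [sq_nonneg (x⁻¹ ^ 2)]
      · rw [e1]
        refine traceNormLE_of_sq (by positivity) ?_ ?_
        · rw [abs_le]; constructor <;> simp only [one_div] at * <;> nlinarith
        · refine le_of_eq ?_; simp only [one_div]; ring
      · rw [e1]
        have e2 : x * -(x ^ 2)⁻¹ - 2 * x⁻¹ = -3 * x⁻¹ := by field_simp; ring
        rw [e2, sub_zero, mul_inv_cancel₀ hx0.ne', ← hy]
        refine traceNormLE_of_sq (by positivity) ?_ ?_
        · rw [show -3 * x⁻¹ + (x / 2 * (-2 * 0 - 2 * 0 * x) + 2 * 0 * x) = -(3 * x⁻¹) by ring,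
            abs_neg, abs_of_pos (by positivity)]
          nlinarith [sq_nonneg (3 / 2 * x⁻¹ - 1)]
        · nlinarith [sq_nonneg (x⁻¹ ^ 2)]
      · simp only [hk]
        rw [e1, show (0 : ℝ) + 0 + 2 * x⁻¹ = 2 * x⁻¹ by ring, abs_of_pos (by positivity)]
        have e3 : 1 / 2 * (1 + x ^ 2) * (2 * x⁻¹) = 1 / x + x := by field_simp
        rw [e3]
        have h4 : η / 12 * (2 * (1 / x ^ 2)) ≤ η / 6 * (1 / c ^ 2) := by
          calc η / 12 * (2 * (1 / x ^ 2)) = η / 6 * (1 / x ^ 2) := by ring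
            _ ≤ _ := by gcongr
        have h5 : η⁻¹ * ((1 - 1) * (1 + x ^ 2) - (1 - 3 / 2 * α)) ≤ 0 :=
          mul_nonpos_of_nonneg_of_nonpos hgη.le (by linarith)
        have h6 : l * c ≤ l * x := by gcongr
        linarith
      · simp only [hk]
        rw [e1, show x / 2 * (0 + 0) - 0 = (0 : ℝ) by ring, abs_zero, mul_zero]
        have h5 : x / 2 * (η⁻¹ * ((1 - 1) * (1 + x ^ 2) - (1 - 3 / 2 * α))) ≤ 0 :=
          mul_nonpos_of_nonneg_of_nonpos (by positivity)
            (mul_nonpos_of_nonneg_of_nonpos hgη.le (by linarith))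
        have h4 : η / 12 * (2 + 9 / 4 * (1 / x ^ 2)) ≤ η / 12 * (2 + 9 / 4 * (1 / c ^ 2)) := by
          gcongr
        linarith
      · simp only [hk]
        have h4 : η / 12 * (2 + (1 / x ^ 2)) ≤ η / 12 * (2 + (1 / c ^ 2)) := by gcongr
        have h5 : |e + l * c ^ 2 - l * x ^ 2| ≤ |e| + l * (x ^ 2 - c ^ 2) := by
          rw [show e + l * c ^ 2 - l * x ^ 2 = e + -(l * (x ^ 2 - c ^ 2)) by ring]
          refine (abs_add_le _ _).trans_eq ?_
          rw [abs_neg, abs_of_nonneg (mul_nonneg hl0 (by linarith))]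
        have h6 : l * (x ^ 2 - c ^ 2) ≤ 1 / 6 * (x ^ 2 - c ^ 2) := by
          apply mul_le_mul_of_nonneg_right hl; linarith
        linarith)
    (by simpa using h)
  unfold PairPotential.Reaches at key
  rw [hwR] at key
  simpa using key

end

/-- One row of a certificate: the right end `x` of a segment, the multipliers `p`, `σ` there, bounds
for trace norms as in `Segment`, and the coefficients `e₁, e₂` and `f₁, f₂` of the compensators for
the two ends of an interval of values of `1 / η`. The unit is `10⁻⁴`. -/
structure Row where
  (x p σ a₀ a₁ a₂ b₀ b₁ c₀ c₁ e₁ e₂ f₁ f₂ : ℤ)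

/-- The rational number `n / 10⁴`. -/
def tenThousandth (n : ℤ) : ℚ := n / 10000

/-- The segment of a row that starts at `x` with the multipliers `p` and `σ`. -/
def Row.segment (r : Row) (x p σ : ℚ) : Segment where
  x := x
  d := tenThousandth r.x - x
  p := p
  p' := (tenThousandth r.p - p) / (tenThousandth r.x - x)
  σ := σ
  σ' := (tenThousandth r.σ - σ) / (tenThousandth r.x - x)
  a₀ := tenThousandth r.a₀
  a₁ := tenThousandth r.a₁
  a₂ := tenThousandth r.a₂
  b₀ := tenThousandth r.b₀
  b₁ := tenThousandth r.b₁
  c₀ := tenThousandth r.c₀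
  c₁ := tenThousandth r.c₁

/-- The hypotheses of `PairPotential.Reaches.tail` with `l = 1 / 8`. -/
def tailTest (α g c e : ℚ) : Bool :=
  decide (1 / c + 1 / g / 6 * (1 / c ^ 2) ≤ c / 3 + 2 * (1 / 8) * c)
    && decide (1 / g / 12 * (2 + 9 / 4 * (1 / c ^ 2)) ≤ α + (e + 1 / 8 * c ^ 2))
    && decide (1 / 2 + 1 / g / 12 * (2 + 1 / c ^ 2) + 1 / 2 * c ^ 2 + |e| ≤ α + 2 / 3 * c ^ 2)

/-- The test of a certificate from the point `x` on, with the multipliers `p`, `σ` and the values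
`e`, `f` of the compensators at `x`. -/
def certTest (α g₀ g₁ : ℚ) : List Row → ℚ → ℚ → ℚ → ℚ → ℚ → Bool
  | [], x, p, σ, e, f => decide (0 < x) && decide (p = 1 / x) && decide (σ = 0)
      && tailTest α g₀ x e && tailTest α g₁ x f
  | r :: l, x, p, σ, e, f =>
      let I := r.segment x p σ
      let e₁ := tenThousandth r.e₁
      let e₂ := tenThousandth r.e₂
      let f₁ := tenThousandth r.f₁
      let f₂ := tenThousandth r.f₂
      I.testMultipliers && I.testCompensator α g₀ e e₁ e₂ && I.testCompensator α g₁ f f₁ f₂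
        && certTest α g₀ g₁ l (I.x + I.d) (I.p + I.p' * I.d) (I.σ + I.σ' * I.d) (e + e₁ + e₂)
          (f + f₁ + f₂)

section
variable {η : ℝ} {D : PairPotential η} {w w' : ℝ → ℝ}

/-- A certificate that passes its test carries `Reaches` from its starting point to infinity. For
`1 / η = s g₀ + t g₁` the compensator is the same combination of those for `g₀` and `g₁`. -/
theorem PairPotential.Reaches.of_certTest (hη : 0 < η) (hw : ∀ x, HasDerivAt w (w' x) x)
    (hw' : Continuous w') (hw0 : ∀ x, 0 ≤ w x) {α g₀ g₁ : ℚ} (hα : α ≤ 2 / 3) (hg₀ : 0 < g₀)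
    (hg₁ : 0 < g₁) {s t : ℝ} (hs : 0 ≤ s) (ht : 0 ≤ t) (hst : s + t = 1)
    (hg : η⁻¹ = s * g₀ + t * g₁) (rows : List Row) (x p σ e f : ℚ)
    (htest : certTest α g₀ g₁ rows x p σ e f = true)
    (h : D.Reaches α w w' x p σ (s * e + t * f)) :
    ∃ c : ℝ, ∀ R, c ≤ R → w R = 0 → 0 ≤ ∫ y in (0 : ℝ)..R, D.integrand α w w' y := by
  have hg₀R : (0 : ℝ) < g₀ := by exact_mod_cast hg₀
  have hg₁R : (0 : ℝ) < g₁ := by exact_mod_cast hg₁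
  -- convexity of `g ↦ 1 / g`
  have hη' : η ≤ s * (1 / g₀) + t * (1 / g₁) := by
    have h1 : η = 1 / (s * g₀ + t * g₁) := by rw [← hg]; simp
    have hpos : 0 < s * (g₀ : ℝ) + t * g₁ := by rw [← hg]; positivity
    rw [h1, div_le_iff₀ hpos]
    have : (s * (1 / g₀) + t * (1 / g₁)) * (s * (g₀ : ℝ) + t * g₁)
        = 1 + s * t * ((g₀ - g₁) ^ 2 / (g₀ * g₁)) := by
      obtain rfl : t = 1 - s := by linarith
      field_simp
      ring
    rw [this]
    have : 0 ≤ s * t * (((g₀ : ℝ) - g₁) ^ 2 / (g₀ * g₁)) := by positivity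
    linarith
  induction rows generalizing x p σ e f with
  | nil =>
    simp only [certTest, tailTest, Bool.and_eq_true, decide_eq_true_eq] at htest
    obtain ⟨⟨⟨⟨hx, rfl⟩, rfl⟩, ⟨A1, A2⟩, A3⟩, ⟨B1, B2⟩, B3⟩ := htest
    have hxR : (0 : ℝ) < x := by exact_mod_cast hx
    have A1 := (Rat.cast_le (K := ℝ)).2 A1
    have A2 := (Rat.cast_le (K := ℝ)).2 A2
    have A3 := (Rat.cast_le (K := ℝ)).2 A3
    have B1 := (Rat.cast_le (K := ℝ)).2 B1
    have B2 := (Rat.cast_le (K := ℝ)).2 B2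
    have B3 := (Rat.cast_le (K := ℝ)).2 B3
    push_cast at A1 A2 A3 B1 B2 B3
    have hmul : ∀ {v : ℝ}, 0 ≤ v → η * v ≤ s * (1 / g₀ * v) + t * (1 / g₁ * v) := fun hv => by
      have := mul_le_mul_of_nonneg_right hη' hv
      linarith
    obtain rfl : t = 1 - s := by linarith
    refine ⟨x, fun R hR hwR => PairPotential.Reaches.tail hη hw hw' hw0 (c := x)
      (e := s * e + (1 - s) * f) (l := 1 / 8) hxR
      (by have := (Rat.cast_le (K := ℝ)).2 hα; push_cast at this; exact this) (by norm_num) (by norm_num)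
      ?_ ?_ ?_ (by simpa using h) hR hwR⟩
    · have := hmul (v := 1 / 6 * (1 / (x : ℝ) ^ 2)) (by positivity)
      linear_combination this + s * A1 + (1 - s) * B1
    · have := hmul (v := 1 / 12 * (2 + 9 / 4 * (1 / (x : ℝ) ^ 2))) (by positivity)
      linear_combination this + s * A2 + (1 - s) * B2
    · have := hmul (v := 1 / 12 * (2 + 1 / (x : ℝ) ^ 2)) (by positivity)
      have hab : |s * (e : ℝ) + (1 - s) * f| ≤ s * |(e : ℝ)| + (1 - s) * |(f : ℝ)| :=
        (abs_add_le _ _).trans_eq (by rw [abs_mul, abs_mul, abs_of_nonneg hs, abs_of_nonneg ht])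
      linear_combination this + s * A3 + (1 - s) * B3 + hab
  | cons r l ih =>
    simp only [certTest, Bool.and_eq_true] at htest
    obtain ⟨⟨⟨M, C₀⟩, C₁⟩, hl⟩ := htest
    refine ih _ _ _ _ _ hl ?_
    set I := r.segment x p σ with hI
    have hIx : I.x = x := rfl
    have hIp : I.p = p := rfl
    have hIσ : I.σ = σ := rfl
    have hd : (0 : ℝ) < I.d := by
      simp only [Segment.testMultipliers, Bool.and_eq_true, decide_eq_true_eq] at M
      exact_mod_cast M.1.1.1.1.1.1.1.1.1.1.1.1.1.1.2
    have hx0 : (0 : ℝ) ≤ I.x := by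
      simp only [Segment.testMultipliers, Bool.and_eq_true, decide_eq_true_eq] at M
      exact_mod_cast M.1.1.1.1.1.1.1.1.1.1.1.1.1.1.1
    set e₁ := tenThousandth r.e₁
    set e₂ := tenThousandth r.e₂
    set f₁ := tenThousandth r.f₁
    set f₂ := tenThousandth r.f₂
    have hlin : ∀ (a b y : ℝ), HasDerivAt (fun z : ℝ => a + b * (z - I.x)) b y := fun a b y => by
      have := (((hasDerivAt_id' y).sub_const (I.x : ℝ)).const_mul b).const_add a
      simpa using this
    have hquad : ∀ (a b c y : ℝ), HasDerivAt
        (fun z : ℝ => a + b * ((z - I.x) / I.d) + c * ((z - I.x) / I.d) ^ 2)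
        ((b + 2 * c * ((y - I.x) / I.d)) / I.d) y := fun a b c y => by
      have h0 := ((hasDerivAt_id' y).sub_const (I.x : ℝ)).div_const (I.d : ℝ)
      have := ((h0.const_mul b).const_add a).add ((h0.pow 2).const_mul c)
      refine this.congr_deriv ?_
      simp; ring
    have hstep := PairPotential.Reaches.step (D := D) (α := α) hη hw hw' hw0
      (x₀ := I.x) (x₁ := I.x + I.d) hx0 (by linarith)
      (p := fun z => I.p + I.p' * (z - I.x)) (p' := fun _ => I.p')
      (σ := fun z => I.σ + I.σ' * (z - I.x)) (σ' := fun _ => I.σ')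
      (e := fun z => s * (e + e₁ * ((z - I.x) / I.d) + e₂ * ((z - I.x) / I.d) ^ 2)
        + t * (f + f₁ * ((z - I.x) / I.d) + f₂ * ((z - I.x) / I.d) ^ 2))
      (e' := fun z => s * ((e₁ + 2 * e₂ * ((z - I.x) / I.d)) / I.d)
        + t * ((f₁ + 2 * f₂ * ((z - I.x) / I.d)) / I.d))
      (by fun_prop) (by fun_prop) (by fun_prop) (fun y _ => hlin _ _ y) (fun y _ => hlin _ _ y)
      (fun y _ => ((hquad _ _ _ y).const_mul s).add ((hquad _ _ _ y).const_mul t))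
      (fun y hy => by
        have ht0 : 0 ≤ (y - I.x) / I.d := div_nonneg (by linarith [hy.1]) hd.le
        have ht1 : (y - I.x) / I.d ≤ 1 := by rw [div_le_one hd]; linarith [hy.2]
        have c0 := Segment.phaseCond M hg₀ C₀ ht0 ht1
        have c1 := Segment.phaseCond M hg₁ C₁ ht0 ht1
        rw [mul_div_cancel₀ _ hd.ne'] at c0 c1
        have := c0.comb (η := η) c1 (by positivity) (by positivity) hs ht hst hη'
        rw [← hg] at this
        simpa using this)
      (by simpa [hIx, hIp, hIσ] using h)
    have hdd : ((I.x : ℝ) + I.d - I.x) = I.d := by ring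
    rw [hdd, div_self hd.ne'] at hstep
    push_cast
    convert hstep using 1
    ring

end

/-! ### Multipliers for every `η`

The certificates are rounded numerical solutions of the inequalities in `PhaseCond`. They start at
`x = 0` with `p = 0` and a constant `σ`, raise `k = x p + σ` towards `1`, and then lower `σ` to `0`
with `p = 1 / x` at the end, where `PairPotential.Reaches.tail` takes over. -/

/-- The certificate for `1 / η` in `[1/8, 1/4]`. -/
def certEighth : List Row := [
  ⟨3290, 0, 1940, 3880, 3940, 4090, 3880, 3880, 3880, 3940, -1184, 704, -1090, 686⟩,
  ⟨6590, 0, 1940, 4090, 4330, 4650, 3880, 3880, 3940, 4090, 224, 672, 282, 618⟩,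
  ⟨9880, 0, 1940, 4650, 5030, 5460, 3880, 3880, 4090, 4330, 1563, 253, 1513, 535⟩,
  ⟨13560, 478, 2147, 5460, 6360, 7420, 7730, 9070, 4600, 5380, 1545, -11, 1760, -33⟩,
  ⟨17240, 751, 2353, 7420, 8550, 9850, 7530, 8640, 4630, 5340, 2297, -55, 2279, -97⟩,
  ⟨20920, 929, 2560, 9850, 11160, 12630, 7890, 8880, 4940, 5570, 2417, -3, 2101, -134⟩,
  ⟨24600, 1053, 2767, 12630, 14100, 15730, 8430, 9360, 5340, 5910, 2446, -82, 1703, -319⟩,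
  ⟨28280, 1145, 2973, 15730, 17340, 19120, 9070, 9960, 5800, 6340, 2529, -293, 1289, -506⟩,
  ⟨31960, 1216, 3180, 19120, 20880, 22810, 9780, 10650, 6250, 6780, 2218, -320, 525, -473⟩,
  ⟨35640, 1272, 3387, 22810, 24720, 26790, 10520, 11370, 6750, 7260, 1852, -437, -250, -345⟩,
  ⟨39320, 1318, 3593, 26790, 28850, 31060, 11260, 12100, 7300, 7820, 1257, -790, -925, -142⟩,
  ⟨43000, 1356, 3800, 31060, 33270, 35630, 12050, 12890, 7790, 8310, -4479, 0, -1353, 149⟩,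
  ⟨46500, 1702, 1900, 35630, 29970, 24270, 43180, 50490, 123080, 132050, -17742, 1911, -12728, 2580⟩,
  ⟨50000, 2000, 0, 24270, 20680, 20400, 50160, 57550, 131740, 140810, -15247, -1806, -8655, -1237⟩]

theorem certEighth_valid : certTest (2 / 3) (1 / 8) (1 / 4) certEighth 0 0 (97 / 500) 0 0
    = true := by
  decide +kernel

/-- The certificate for `1 / η` in `[1/4, 1/2]`. -/
def certQuarter : List Row := [
  ⟨1780, 0, 2310, 4620, 4640, 4700, 4620, 4620, 4620, 4640, -469, 206, -526, 200⟩,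
  ⟨3570, 0, 2310, 4700, 4790, 4910, 4620, 4620, 4640, 4700, -58, 197, -127, 181⟩,
  ⟨5360, 0, 2310, 4910, 5060, 5250, 4620, 4620, 4700, 4790, 336, 186, 235, 159⟩,
  ⟨7140, 0, 2310, 5250, 5450, 5680, 4620, 4620, 4790, 4910, 705, 5, 549, -9⟩,
  ⟨8860, 552, 2458, 5680, 6180, 6740, 12600, 13830, 5750, 6190, 149, -66, 153, -69⟩,
  ⟨10580, 924, 2606, 6740, 7370, 8060, 11240, 12300, 5410, 5910, 308, -54, 232, -61⟩,
  ⟨12300, 1192, 2754, 8060, 8760, 9520, 10720, 11650, 5450, 5920, 407, -55, 272, -61⟩,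
  ⟨14020, 1395, 2902, 9520, 10280, 11090, 10610, 11450, 5650, 6080, 458, -61, 92, -45⟩,
  ⟨15740, 1553, 3051, 11090, 11900, 12770, 10710, 11490, 5890, 6290, 471, -68, -79, -32⟩,
  ⟨17470, 1681, 3199, 12770, 13630, 14550, 10930, 11670, 6210, 6590, 456, -77, -177, -62⟩,
  ⟨19190, 1785, 3348, 14550, 15460, 16430, 11280, 11980, 6480, 6830, 401, -84, -262, -106⟩,
  ⟨20910, 1872, 3496, 16430, 17380, 18390, 11650, 12320, 6820, 7150, 332, -90, -406, -100⟩,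
  ⟨22630, 1945, 3644, 18390, 19390, 20440, 12060, 12710, 7140, 7460, 246, -94, -541, -64⟩,
  ⟨24350, 2009, 3792, 20440, 21490, 22600, 12540, 13180, 7460, 7770, 130, -98, -637, -21⟩,
  ⟨26070, 2064, 3940, 22600, 23690, 24840, 13000, 13630, 7790, 8100, 20, -98, -634, 34⟩,
  ⟨28050, 2468, 2624, 24840, 23130, 21460, 36090, 40780, 63870, 67500, -4267, 551, -3731, 664⟩,
  ⟨30020, 2817, 1316, 21460, 20340, 19680, 40040, 44820, 67100, 70810, -3500, -23, -2654, 95⟩,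
  ⟨32000, 3125, 0, 19680, 19870, 20960, 44350, 49250, 70670, 74480, -2980, -966, -1898, -826⟩]

theorem certQuarter_valid : certTest (89 / 200) (1 / 4) (1 / 2) certQuarter 0 0 (231 / 1000) 0 0
    = true := by
  decide +kernel

/-- The certificate for `1 / η` in `[1/2, 9/10]`. -/
def certHalf : List Row := [
  ⟨1030, 0, 2900, 5800, 5810, 5840, 5800, 5800, 5800, 5810, -207, 69, -247, 67⟩,
  ⟨2060, 0, 2900, 5840, 5870, 5930, 5800, 5800, 5810, 5840, -69, 65, -113, 60⟩,
  ⟨3080, 0, 2900, 5930, 5990, 6070, 5800, 5800, 5840, 5870, 60, 60, 8, 52⟩,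
  ⟨4110, 0, 2900, 6070, 6170, 6280, 5800, 5800, 5870, 5930, 182, 28, 113, 46⟩,
  ⟨5140, 0, 2900, 6280, 6400, 6530, 5800, 5800, 5930, 5990, 240, -51, 206, -79⟩,
  ⟨6180, 721, 2935, 6530, 6790, 7110, 21030, 22210, 7770, 7950, -114, -58, -116, -57⟩,
  ⟨7210, 1231, 2969, 7110, 7500, 7930, 17600, 18610, 7120, 7440, -62, -42, -97, -42⟩,
  ⟨8250, 1616, 3004, 7930, 8380, 8850, 15560, 16440, 6960, 7340, -25, -35, -83, -36⟩,
  ⟨9280, 1912, 3038, 8850, 9310, 9800, 14320, 15070, 7090, 7450, 2, -31, -89, -23⟩,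
  ⟨10320, 2152, 3073, 9800, 10280, 10790, 13540, 14210, 7320, 7680, 16, -30, -158, -7⟩,
  ⟨11350, 2345, 3108, 10790, 11270, 11780, 12980, 13550, 7610, 7950, 3, -18, -210, -2⟩,
  ⟨12390, 2508, 3142, 11780, 12290, 12810, 12640, 13140, 7960, 8290, -4, -15, -247, 9⟩,
  ⟨13420, 2645, 3177, 12810, 13310, 13840, 12420, 12870, 8280, 8590, 9, -26, -251, 19⟩,
  ⟨14460, 2763, 3212, 13840, 14360, 14900, 12230, 12640, 8630, 8940, 6, -29, -235, -10⟩,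
  ⟨15490, 2864, 3246, 14900, 15430, 15970, 12110, 12470, 9010, 9310, -6, -28, -216, -29⟩,
  ⟨16530, 2954, 3281, 15970, 16510, 17060, 12080, 12410, 9340, 9640, -25, -28, -247, -16⟩,
  ⟨17560, 3032, 3315, 17060, 17600, 18160, 12010, 12320, 9730, 10020, -38, -26, -244, 0⟩,
  ⟨18600, 3102, 3350, 18160, 18720, 19290, 12010, 12290, 10070, 10360, -55, -24, -220, 19⟩,
  ⟨19670, 3293, 2790, 19290, 19170, 19050, 25070, 26660, 32010, 33110, -820, 90, -762, 105⟩,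
  ⟨20730, 3463, 2235, 19050, 19010, 18980, 26190, 27850, 33090, 34220, -726, 105, -638, 124⟩,
  ⟨21800, 3617, 1675, 18980, 19030, 19130, 27420, 29160, 34220, 35390, -630, 124, -492, 148⟩,
  ⟨22870, 3757, 1115, 19130, 19310, 19570, 28850, 30650, 35420, 36630, -427, -45, -241, -18⟩,
  ⟨23930, 3883, 560, 19570, 19920, 20350, 30380, 32210, 36700, 37930, -422, -140, -185, -108⟩,
  ⟨25000, 4000, 0, 20350, 20900, 21550, 32000, 33890, 37980, 39260, -628, -151, -324, -114⟩]

theorem certHalf_valid : certTest (331 / 1000) (1 / 2) (9 / 10) certHalf 0 0 (29 / 100) 0 0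
    = true := by
  decide +kernel

/-- The certificate for `1 / η` in `[9/10, 7/4]`. -/
def certOne : List Row := [
  ⟨1840, 0, 3210, 6420, 6450, 6530, 6420, 6420, 6420, 6450, -227, 207, -284, 189⟩,
  ⟨3670, 0, 3210, 6530, 6660, 6840, 6420, 6420, 6450, 6530, 185, -108, 93, -142⟩,
  ⟨5170, 1504, 3163, 6840, 7260, 7890, 27440, 29580, 8270, 8410, -153, -166, -175, -157⟩,
  ⟨6680, 2336, 3116, 7890, 8590, 9370, 19420, 21070, 7430, 8020, -123, -90, -199, -86⟩,
  ⟨8180, 2859, 3069, 9370, 10080, 10840, 16210, 17440, 7900, 8490, -128, -42, -339, -15⟩,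
  ⟨9690, 3221, 3021, 10840, 11550, 12300, 14630, 15560, 8610, 9170, -164, -1, -446, 10⟩,
  ⟨11190, 3485, 2974, 12300, 13010, 13760, 13790, 14490, 9340, 9870, -137, -2, -480, 62⟩,
  ⟨12700, 3687, 2927, 13760, 14470, 15220, 13230, 13780, 10060, 10580, -46, -35, -356, 63⟩,
  ⟨14200, 3845, 2880, 15220, 15950, 16690, 12860, 13290, 10770, 11290, -31, -24, -169, 34⟩,
  ⟨15740, 3880, 2469, 16690, 16950, 17160, 13750, 14140, 17450, 18260, -493, 36, -476, 51⟩,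
  ⟨17290, 3909, 2056, 17160, 17420, 17650, 14020, 14590, 18290, 19190, -442, 71, -396, 99⟩,
  ⟨18830, 3933, 1645, 17650, 17930, 18180, 14520, 15230, 19240, 20190, -323, 111, -225, 155⟩,
  ⟨20370, 3954, 1235, 18180, 18500, 18800, 15160, 16000, 20200, 21200, -60, 11, 120, 77⟩,
  ⟨21910, 3971, 824, 18800, 19170, 19540, 15960, 16920, 21280, 22330, -16, -59, 287, 32⟩,
  ⟨23460, 3987, 411, 19540, 19990, 20450, 16880, 17940, 22330, 23430, -135, -56, 340, 68⟩,
  ⟨25000, 4000, 0, 20450, 20980, 21550, 17920, 19060, 23500, 24630, -228, -46, 472, 110⟩]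

theorem certOne_valid : certTest (261 / 1000) (9 / 10) (7 / 4) certOne 0 0 (321 / 1000) 0 0
    = true := by
  decide +kernel

section
variable {η : ℝ} {D : PairPotential η} {w w' : ℝ → ℝ}

/-- The multipliers `p = x / (1 + x²)`, `σ = 1 / (1 + x²)`, for which `k = 1`, suit small `η`. -/
theorem PairPotential.exists_integral_nonneg_of_small (hη : 0 < η) (hη' : η ≤ 4 / 7)
    (hw : ∀ x, HasDerivAt w (w' x) x) (hw' : Continuous w') (hw0 : ∀ x, 0 ≤ w x) :
    ∃ c : ℝ, ∀ R, c ≤ R → w R = 0 → 0 ≤ ∫ y in (0 : ℝ)..R, D.integrand (2 / 3) w w' y := by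
  have hS : ∀ x : ℝ, 1 + x ^ 2 ≠ 0 := fun x => by positivity
  have hSd : ∀ x : ℝ, HasDerivAt (fun y : ℝ => 1 + y ^ 2) (2 * x) x := fun x => by
    simpa using ((hasDerivAt_id' x).pow 2).const_add 1
  have hpd : ∀ x : ℝ, HasDerivAt (fun y : ℝ => y / (1 + y ^ 2)) ((1 - x ^ 2) / (1 + x ^ 2) ^ 2) x :=
    fun x => by
      refine ((hasDerivAt_id' x).div (hSd x) (hS x)).congr_deriv ?_
      have := hS x
      field_simp; ring
  have hσd : ∀ x : ℝ, HasDerivAt (fun y : ℝ => 1 / (1 + y ^ 2)) (-(2 * x) / (1 + x ^ 2) ^ 2) x :=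
    fun x => by
      refine ((hasDerivAt_const x (1 : ℝ)).div (hSd x) (hS x)).congr_deriv ?_
      have := hS x
      field_simp; ring
  -- everything but the compensator
  have hphase : ∀ x e e' : ℝ, e' ≤ x / 3 - η / 3 * (1 / (1 + x ^ 2)) →
      η / 12 * (2 + x ^ 2 / (1 + x ^ 2) ^ 2) + x / 2 * e' - e ≤ 1 / 6 →
      η / 6 + |e| ≤ (1 + x ^ 2) / 6 → 0 < x →
      PhaseCond (2 / 3) η⁻¹ η x (x / (1 + x ^ 2)) ((1 - x ^ 2) / (1 + x ^ 2) ^ 2) (1 / (1 + x ^ 2))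
        (-(2 * x) / (1 + x ^ 2) ^ 2) e e' := by
    intro x e e' h1 h2 h3 hx
    have hSx : 0 < 1 + x ^ 2 := by positivity
    have hS0 := hSx.ne'
    have hk : x * (x / (1 + x ^ 2)) + 1 / (1 + x ^ 2) = 1 := by field_simp; ring
    have hk' : x / (1 + x ^ 2) + x * ((1 - x ^ 2) / (1 + x ^ 2) ^ 2) + -(2 * x) / (1 + x ^ 2) ^ 2
        = 0 := by field_simp; ring
    refine ⟨by rw [hk]; exact zero_le_one, hk.le, 2, 4 * (1 / (1 + x ^ 2)),
      2 + x ^ 2 / (1 + x ^ 2) ^ 2, ?_, ?_, ?_, ?_, ?_, ?_⟩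
    · refine traceNormLE_of_sq (by norm_num) ?_ (le_of_eq ?_)
      · rw [show 2 * (x / (1 + x ^ 2)) + -2 * (1 / (1 + x ^ 2)) * x = 0 by ring]; simp
      · field_simp; ring
    · refine traceNormLE_of_sq (by positivity) ?_ (le_of_eq ?_)
      · rw [show 2 * ((1 - x ^ 2) / (1 + x ^ 2) ^ 2)
          + (-2 * (1 / (1 + x ^ 2)) - 2 * (-(2 * x) / (1 + x ^ 2) ^ 2) * x) = 0 by
            field_simp; ring, abs_zero]
        positivity
      · field_simp; ring
    · refine traceNormLE_of_sq (by positivity) ?_ ?_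
      · rw [show x * ((1 - x ^ 2) / (1 + x ^ 2) ^ 2) - 2 * (x / (1 + x ^ 2))
          + (x / 2 * (-2 * (1 / (1 + x ^ 2)) - 2 * (-(2 * x) / (1 + x ^ 2) ^ 2) * x)
          + 2 * (1 / (1 + x ^ 2)) * x) = 0 by field_simp; ring, abs_zero]
        positivity
      · rw [show (x * ((1 - x ^ 2) / (1 + x ^ 2) ^ 2) - 2 * (x / (1 + x ^ 2))
            - (x / 2 * (-2 * (1 / (1 + x ^ 2)) - 2 * (-(2 * x) / (1 + x ^ 2) ^ 2) * x)
              + 2 * (1 / (1 + x ^ 2)) * x)) ^ 2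
            + 4 * (x / 2 * (x / (1 + x ^ 2) + x * ((1 - x ^ 2) / (1 + x ^ 2) ^ 2)
              - -(2 * x) / (1 + x ^ 2) ^ 2) - (x * (x / (1 + x ^ 2)) - 1 / (1 + x ^ 2))) ^ 2
            = 4 + 4 * (x ^ 2 / (1 + x ^ 2) ^ 2) by field_simp; ring]
        nlinarith [sq_nonneg (x ^ 2 / (1 + x ^ 2) ^ 2)]
    · rw [hk, hk', zero_add, abs_of_pos (by positivity)]
      have : 1 / 2 * (1 + x ^ 2) * (2 * (x / (1 + x ^ 2))) = x := by field_simp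
      rw [this]
      linarith
    · rw [hk, hk', mul_zero, zero_sub, abs_neg, abs_of_pos (by positivity)]
      have : 1 / 2 * (1 + x ^ 2) * (1 / (1 + x ^ 2)) = 1 / 2 := by field_simp
      rw [this]
      linarith
    · rw [hk]; linarith
  have hy : ∀ x : ℝ, x ^ 2 / (1 + x ^ 2) ^ 2 ≤ x ^ 2 := fun x =>
    div_le_self (sq_nonneg x) (by nlinarith [sq_nonneg x])
  have hy' : ∀ x : ℝ, x ^ 2 / (1 + x ^ 2) ^ 2 ≤ 1 / 4 := fun x => by
    rw [div_le_iff₀ (by positivity)]; nlinarith [sq_nonneg (1 - x ^ 2)]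
  have hcp : Continuous fun y : ℝ => y / (1 + y ^ 2) :=
    continuous_iff_continuousAt.2 fun x => (hpd x).continuousAt
  have hcσ : Continuous fun y : ℝ => 1 / (1 + y ^ 2) :=
    continuous_iff_continuousAt.2 fun x => (hσd x).continuousAt
  have h0 : D.Reaches (2 / 3) w w' 0 (0 / (1 + (0 : ℝ) ^ 2)) (1 / (1 + (0 : ℝ) ^ 2))
      (-(η / 3 * 0) + 0 ^ 2 / 6) := PairPotential.reaches_zero hη hw0 (by simp)
  have h1 := PairPotential.Reaches.step (x₁ := 1 / 2)
    (p := fun y : ℝ => y / (1 + y ^ 2)) (σ := fun y : ℝ => 1 / (1 + y ^ 2))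
    (e := fun y => -(η / 3 * y) + y ^ 2 / 6) (e' := fun y => -(η / 3) + y / 3)
    hη hw hw' hw0 le_rfl (by norm_num) hcp.continuousOn hcσ.continuousOn (by fun_prop)
    (fun x _ => hpd x) (fun x _ => hσd x)
    (fun x _ => by
      refine (((hasDerivAt_id' x).const_mul (η / 3)).neg.add
        (((hasDerivAt_id' x).pow 2).div_const 6)).congr_deriv ?_
      simp; ring)
    (fun x hx => by
      have hx0 := hx.1
      have hx1 := hx.2
      have hle : 1 / (1 + x ^ 2) ≤ 1 := by rw [div_le_one (by positivity)]; nlinarith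
      apply hphase x _ _ _ _ _ hx0
      · nlinarith
      · have h2 := hy x
        have h3 : η * (2 + x ^ 2 / (1 + x ^ 2) ^ 2 + 2 * x) ≤ 2 := by
          have : 2 + x ^ 2 / (1 + x ^ 2) ^ 2 + 2 * x ≤ 7 / 2 := by nlinarith
          nlinarith
        nlinarith
      · rcases abs_cases (-(η / 3 * x) + x ^ 2 / 6) with ⟨h, -⟩ | ⟨h, -⟩ <;> rw [h]
        · nlinarith
        · nlinarith [sq_nonneg (x - 2 / 7), mul_nonneg hx0.le (sub_nonneg.2 hη')])
    h0
  refine ⟨1 / 2, fun R hR hwR => ?_⟩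
  have h2 := PairPotential.Reaches.step (x₁ := R)
    (p := fun y : ℝ => y / (1 + y ^ 2)) (σ := fun y : ℝ => 1 / (1 + y ^ 2))
    (e := fun _ => -(η / 3 * (1 / 2)) + (1 / 2) ^ 2 / 6) (e' := fun _ => 0)
    hη hw hw' hw0 (by norm_num) hR hcp.continuousOn hcσ.continuousOn (by fun_prop)
    (fun x _ => hpd x) (fun x _ => hσd x) (fun x _ => hasDerivAt_const _ _)
    (fun x hx => by
      have hx0 : 1 / 2 < x := hx.1
      have hle : 1 / (1 + x ^ 2) ≤ 4 / 5 := by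
        rw [div_le_iff₀ (by positivity)]; nlinarith
      apply hphase x _ _ _ _ _ (by linarith)
      · nlinarith
      · have := hy' x
        nlinarith
      · rcases abs_cases (-(η / 3 * (1 / 2)) + (1 / 2 : ℝ) ^ 2 / 6) with ⟨h, -⟩ | ⟨h, -⟩ <;> rw [h]
        · nlinarith
        · nlinarith)
    h1
  unfold PairPotential.Reaches at h2
  rw [hwR] at h2
  simpa using h2

/-- `PhaseCond` for `p = 1 / (2 c)`, `σ = x / (2 c)` with `c = 5 η / 4` and the compensator
`E (γ x) / γ²`, multiplied by powers of `γ = 1 / η`. -/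
theorem phaseCond_linear {γ : ℝ} (hγ0 : 0 < γ) (hγ : γ = η⁻¹) (hγη : γ * η = 1) {x E E' : ℝ}
    (hx : 0 < x) (hx1 : γ * x ≤ 5 / 4)
    (h1 : (γ ^ 2 + (γ * x) ^ 2) * (9 / 5 - 4 / 5 * (γ * x)) + E' ≤ 6 / 5 * (γ * x))
    (h2 : γ * x / 2 * (1 - 4 / 5 * (γ * x)) * (γ ^ 2 + (γ * x) ^ 2) + γ * x / 2 * E' - E
      ≤ 3 / 5 * γ ^ 2)
    (h3 : |E| ≤ (γ ^ 2 + (γ * x) ^ 2) * (3 / 5 - 2 / 5 * (γ * x))) :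
    PhaseCond (2 / 3) η⁻¹ η x (2 / 5 * γ) 0 (2 / 5 * γ * x) (2 / 5 * γ) (E / γ ^ 2) (E' / γ) := by
  have hk : x * (2 / 5 * γ) + 2 / 5 * γ * x = 4 / 5 * (γ * x) := by ring
  refine ⟨by positivity, by linarith, 4 / 5 * γ * (1 + x ^ 2), 8 / 5 * (γ * x), 4 / 5 * γ,
    ?_, ?_, ?_, ?_, ?_, ?_⟩
  · refine traceNormLE_of_sq (by positivity) ?_ (le_of_eq (by ring))
    rw [abs_le]; constructor <;> nlinarith [mul_nonneg hγ0.le (sq_nonneg x)]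
  · refine traceNormLE_of_sq (by positivity) ?_ (le_of_eq (by ring))
    rw [abs_le]; constructor <;> nlinarith [mul_nonneg hγ0.le hx.le]
  · refine traceNormLE_of_sq (by positivity) ?_ (le_of_eq (by ring))
    rw [abs_le]; constructor <;> nlinarith [mul_nonneg hγ0.le (sq_nonneg x)]
  · rw [hk, ← hγ, abs_of_pos (by positivity)]
    refine le_of_mul_le_mul_left ?_ hγ0
    have e1 : γ * (E' / γ) = E' := by field_simp
    have e2 : γ * (η / 12 * (8 / 5 * (γ * x))) = 2 / 15 * (γ * x) := by
      linear_combination (2 / 15 * γ * x) * hγη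
    linear_combination h1 + e1 + e2
  · rw [hk, ← hγ, show x / 2 * (2 / 5 * γ + x * 0 + 2 / 5 * γ) - 2 / 5 * γ * x = 0 by ring,
      abs_zero, mul_zero]
    refine le_of_mul_le_mul_left ?_ (by positivity : 0 < γ ^ 2)
    have e1 : γ ^ 2 * (x / 2 * (E' / γ)) = γ * x / 2 * E' := by field_simp
    have e3 : γ ^ 2 * (E / γ ^ 2) = E := by field_simp
    have e2 : γ ^ 2 * (η / 12 * (4 / 5 * γ)) = γ ^ 2 / 15 := by
      linear_combination (γ ^ 2 / 15) * hγη
    linear_combination h2 + e1 + e2 - e3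
  · rw [hk]
    refine le_of_mul_le_mul_left ?_ (by positivity : 0 < γ ^ 2)
    have e1 : γ ^ 2 * |E / γ ^ 2| = |E| := by
      rw [abs_div, abs_of_pos (by positivity : 0 < γ ^ 2)]; field_simp
    have e2 : γ ^ 2 * (η / 12 * (4 / 5 * γ * (1 + x ^ 2))) = (γ ^ 2 + (γ * x) ^ 2) / 15 := by
      linear_combination (γ ^ 2 * (1 + x ^ 2) / 15) * hγη
    linear_combination h3 + e1 + e2

/-- The compensator on `f ≤ 3 / 10`, with `G = γ²`. -/
noncomputable def compensatorLow (G f : ℝ) : ℝ :=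
  3 / 5 * f ^ 2 - f ^ 3 + 2 / 5 * f ^ 4
    + G * (-(1 / 15) - 9 / 5 * f + 2 / 5 * f ^ 2 + 201 / 20 * f ^ 3)

/-- The compensator on `3 / 10 ≤ f ≤ 5 / 4`, with `G = γ²`. -/
noncomputable def compensatorHigh (G f : ℝ) : ℝ :=
  3 / 5 * f ^ 2 - f ^ 3 + 2 / 5 * f ^ 4 + G * (-(3 / 5) + f)

/-- The hypotheses of `phaseCond_linear` for `compensatorLow`, with its derivative written out. -/
theorem compensatorLow_spec {G f : ℝ} (hG0 : 0 < G) (hG : G ≤ 1 / 64) (hf0 : 0 < f)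
    (hf1 : f < 3 / 10) :
    (G + f ^ 2) * (9 / 5 - 4 / 5 * f) + (6 / 5 * f - 3 * f ^ 2 + 8 / 5 * f ^ 3
      + G * (-(9 / 5) + 4 / 5 * f + 603 / 20 * f ^ 2)) ≤ 6 / 5 * f ∧
    f / 2 * (1 - 4 / 5 * f) * (G + f ^ 2) + f / 2 * (6 / 5 * f - 3 * f ^ 2 + 8 / 5 * f ^ 3
      + G * (-(9 / 5) + 4 / 5 * f + 603 / 20 * f ^ 2)) - compensatorLow G f
      ≤ 3 / 5 * G ∧
    |compensatorLow G f| ≤ (G + f ^ 2) * (3 / 5 - 2 / 5 * f) := by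
  have hff : f ^ 2 ≤ 9 / 100 := by nlinarith
  refine ⟨?_, ?_, ?_⟩
  · have : f ^ 2 * (-(6 / 5) + 4 / 5 * f + 603 / 20 * G) ≤ 0 :=
      mul_nonpos_of_nonneg_of_nonpos (sq_nonneg f) (by linarith)
    linear_combination this
  · have : G * (f * (7 / 5 - 2 / 5 * f + 201 / 40 * f ^ 2)) ≤ G * (8 / 15) := by
      apply mul_le_mul_of_nonneg_left _ hG0.le
      nlinarith
    simp only [compensatorLow]
    linear_combination this
  · have hD : -(9 / 5) * f + 2 / 5 * f ^ 2 + 201 / 20 * f ^ 3 ≤ 0 := by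
      have : f * (-(9 / 5) + 2 / 5 * f + 201 / 20 * f ^ 2) ≤ 0 :=
        mul_nonpos_of_nonneg_of_nonpos hf0.le (by nlinarith)
      linear_combination this
    have hD' : 0 ≤ 8 / 15 - 11 / 5 * f + 2 / 5 * f ^ 2 + 201 / 20 * f ^ 3 := by
      nlinarith [mul_nonneg hf0.le (sq_nonneg (f - 1 / 4)), sq_nonneg (f - 1 / 4)]
    rw [abs_le]
    simp only [compensatorLow]
    constructor
    · have h5 := mul_nonneg hG0.le hD'
      have h6 : 0 ≤ f ^ 2 * ((3 / 5 - 2 / 5 * f) * (2 - f)) :=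
        mul_nonneg (sq_nonneg f) (mul_nonneg (by linarith) (by linarith))
      linear_combination h5 + h6
    · have h5 := mul_nonneg hG0.le (neg_nonneg.2 hD)
      have h6 : 0 ≤ f ^ 2 * ((3 / 5 - 2 / 5 * f) * f) :=
        mul_nonneg (sq_nonneg f) (mul_nonneg (by linarith) hf0.le)
      have h7 : 0 ≤ G * (3 / 5 - 2 / 5 * f + 1 / 15) := mul_nonneg hG0.le (by linarith)
      linear_combination h5 + h6 + h7

/-- The hypotheses of `phaseCond_linear` for `compensatorHigh`, with its derivative written out. -/
theorem compensatorHigh_spec {G f : ℝ} (hG0 : 0 < G) (hG : G ≤ 1 / 64) (hf0 : 3 / 10 < f)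
    (hf1 : f < 5 / 4) :
    (G + f ^ 2) * (9 / 5 - 4 / 5 * f) + (6 / 5 * f - 3 * f ^ 2 + 8 / 5 * f ^ 3 + G * 1)
      ≤ 6 / 5 * f ∧
    f / 2 * (1 - 4 / 5 * f) * (G + f ^ 2) + f / 2 * (6 / 5 * f - 3 * f ^ 2 + 8 / 5 * f ^ 3
      + G * 1) - compensatorHigh G f
      ≤ 3 / 5 * G ∧
    |compensatorHigh G f| ≤ (G + f ^ 2) * (3 / 5 - 2 / 5 * f) := by
  have hff : 9 / 100 ≤ f ^ 2 := by nlinarith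
  refine ⟨?_, ?_, ?_⟩
  · have : G * (14 / 5 - 4 / 5 * f) ≤ f ^ 2 * (6 / 5 - 4 / 5 * f) := by nlinarith
    linear_combination this
  · have : 0 ≤ G * f ^ 2 := by positivity
    simp only [compensatorHigh]
    linear_combination (2 / 5) * this
  · have hff' : 0 ≤ 3 / 5 - 2 / 5 * f := by linarith
    rw [abs_le]
    simp only [compensatorHigh]
    constructor
    · have h5 : 0 ≤ G * f := by positivity
      rcases le_total f 2 with h | h
      · have h6 : 0 ≤ f ^ 2 * ((3 / 5 - 2 / 5 * f) * (2 - f)) :=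
          mul_nonneg (sq_nonneg f) (mul_nonneg (by linarith) (by linarith))
        linear_combination (3 / 5) * h5 + h6
      · linarith
    · have h6 : G * (7 / 5 * f - 6 / 5) ≤ f ^ 3 * (3 / 5 - 2 / 5 * f) := by
        rcases le_total f (6 / 7) with h | h
        · have h7 : 0 ≤ f ^ 3 * (3 / 5 - 2 / 5 * f) := by positivity
          have h8 : G * (7 / 5 * f - 6 / 5) ≤ 0 :=
            mul_nonpos_of_nonneg_of_nonpos hG0.le (by linarith)
          linarith
        · have h7 : f ^ 3 * (1 / 10) ≤ f ^ 3 * (3 / 5 - 2 / 5 * f) := by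
            apply mul_le_mul_of_nonneg_left (by linarith) (by positivity)
          have h8 : G * (7 / 5 * f - 6 / 5) ≤ 1 / 64 * (11 / 20) := by
            apply mul_le_mul hG (by linarith) (by linarith) (by norm_num)
          have h9 : (6 / 7 : ℝ) ^ 3 ≤ f ^ 3 := by gcongr
          norm_num at h9
          linarith
      linear_combination h6

/-- The multipliers `p = 1 / (2 c)`, `σ = x / (2 c)` on `[0, c]`, followed by `p = 1 / x`, `σ = 0`,
suit large `η`. In the variable `f = x / η`, the jump is at `f = 5 / 4`. -/
theorem PairPotential.exists_integral_nonneg_of_large (hη : 8 ≤ η)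
    (hw : ∀ x, HasDerivAt w (w' x) x) (hw' : Continuous w') (hw0 : ∀ x, 0 ≤ w x) :
    ∃ c : ℝ, ∀ R, c ≤ R → w R = 0 → 0 ≤ ∫ y in (0 : ℝ)..R, D.integrand (2 / 3) w w' y := by
  have hη0 : 0 < η := by linarith
  obtain ⟨γ, hγ⟩ : ∃ γ, γ = η⁻¹ := ⟨_, rfl⟩
  have hγ0 : 0 < γ := by rw [hγ]; positivity
  have hγη : γ * η = 1 := by rw [hγ]; exact inv_mul_cancel₀ hη0.ne'
  have hγ8 : γ ≤ 1 / 8 := by rw [hγ, one_div]; exact inv_anti₀ (by norm_num) hη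
  have hG : γ ^ 2 ≤ 1 / 64 := by nlinarith
  have hσd : ∀ x : ℝ, HasDerivAt (fun y : ℝ => 2 / 5 * γ * y) (2 / 5 * γ) x := fun x => by
    simpa using (hasDerivAt_id' x).const_mul (2 / 5 * γ)
  have hf : ∀ x : ℝ, HasDerivAt (fun y : ℝ => γ * y) γ x := fun x => by
    simpa using (hasDerivAt_id' x).const_mul γ
  set E₁ := compensatorLow (γ ^ 2) with hE₁
  set E₂ := compensatorHigh (γ ^ 2) with hE₂
  have hbase : ∀ f : ℝ, HasDerivAt (fun f : ℝ => 3 / 5 * f ^ 2 - f ^ 3 + 2 / 5 * f ^ 4)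
      (6 / 5 * f - 3 * f ^ 2 + 8 / 5 * f ^ 3) f := fun f => by
    have := ((((hasDerivAt_id' f).pow 2).const_mul (3 / 5)).sub ((hasDerivAt_id' f).pow 3)).add
      (((hasDerivAt_id' f).pow 4).const_mul (2 / 5))
    refine this.congr_deriv ?_
    simp; ring
  have hE₁d : ∀ f : ℝ, HasDerivAt E₁ (6 / 5 * f - 3 * f ^ 2 + 8 / 5 * f ^ 3
      + γ ^ 2 * (-(9 / 5) + 4 / 5 * f + 603 / 20 * f ^ 2)) f := fun f => by
    have := (hbase f).add ((((((hasDerivAt_id' f).const_mul (9 / 5)).const_sub (-(1 / 15))).add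
      (((hasDerivAt_id' f).pow 2).const_mul (2 / 5))).add
      (((hasDerivAt_id' f).pow 3).const_mul (201 / 20))).const_mul (γ ^ 2))
    refine this.congr_deriv ?_
    push_cast; ring
  have hE₂d : ∀ f : ℝ, HasDerivAt E₂ (6 / 5 * f - 3 * f ^ 2 + 8 / 5 * f ^ 3
      + γ ^ 2 * 1) f := fun f => by
    have := (hbase f).add (((hasDerivAt_id' f).const_add (-(3 / 5))).const_mul (γ ^ 2))
    exact this
  have hscale : ∀ {E : ℝ → ℝ} {E' : ℝ} {x : ℝ}, HasDerivAt E E' (γ * x) →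
      HasDerivAt (fun y => E (γ * y) / γ ^ 2) (E' / γ) x := fun {E E' x} h => by
    refine ((h.comp x (hf x)).div_const (γ ^ 2)).congr_deriv ?_
    field_simp
  have hcont : ∀ {E : ℝ → ℝ} {E' : ℝ → ℝ}, (∀ f, HasDerivAt E (E' f) f) →
      Continuous fun y => E (γ * y) / γ ^ 2 := fun h =>
    continuous_iff_continuousAt.2 fun x => (hscale (h (γ * x))).continuousAt
  have h0 : D.Reaches (2 / 3) w w' 0 (2 / 5 * γ) (2 / 5 * γ * 0) (E₁ (γ * 0) / γ ^ 2) := by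
    refine PairPotential.reaches_zero hη0 hw0 ?_
    rw [abs_of_pos (by positivity)]
    have : η / 6 * (2 / 5 * γ) = 1 / 15 := by linear_combination (1 / 15) * hγη
    rw [this, hE₁, compensatorLow]
    refine le_of_eq ?_
    field_simp; ring
  have hx₁ : γ * (3 / 10 * η) = 3 / 10 := by linear_combination (3 / 10) * hγη
  have hx₂ : γ * (5 / 4 * η) = 5 / 4 := by linear_combination (5 / 4) * hγη
  have h1 := PairPotential.Reaches.step (x₁ := 3 / 10 * η) (p := fun _ => 2 / 5 * γ)
    (p' := fun _ => 0) (σ := fun y => 2 / 5 * γ * y) (σ' := fun _ => 2 / 5 * γ)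
    (e := fun y => E₁ (γ * y) / γ ^ 2) hη0 hw hw' hw0 le_rfl (by positivity) (by fun_prop)
    (by fun_prop) (hcont hE₁d).continuousOn (fun x _ => hasDerivAt_const _ _) (fun x _ => hσd x)
    (fun x _ => hscale (hE₁d (γ * x)))
    (fun x hx => by
      have hx0 : 0 < x := hx.1
      have hf0 : 0 < γ * x := by positivity
      have hf1 : γ * x < 3 / 10 := by rw [← hx₁]; exact mul_lt_mul_of_pos_left hx.2 hγ0
      obtain ⟨h2, h3, h4⟩ := compensatorLow_spec (by positivity) hG hf0 hf1
      exact phaseCond_linear hγ0 hγ hγη hx0 (by linarith) h2 h3 h4)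
    h0
  have h1' : D.Reaches (2 / 3) w w' (3 / 10 * η) (2 / 5 * γ) (2 / 5 * γ * (3 / 10 * η))
      (E₂ (γ * (3 / 10 * η)) / γ ^ 2) := by
    refine h1.mono hη0 hw0 ?_
    rw [hx₁]
    apply div_le_div_of_nonneg_right _ (by positivity)
    simp only [hE₁, hE₂, compensatorLow, compensatorHigh]
    nlinarith [sq_nonneg γ]
  have h2 := PairPotential.Reaches.step (x₁ := 5 / 4 * η) (p := fun _ => 2 / 5 * γ)
    (p' := fun _ => 0) (σ := fun y => 2 / 5 * γ * y) (σ' := fun _ => 2 / 5 * γ)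
    (e := fun y => E₂ (γ * y) / γ ^ 2) hη0 hw hw' hw0 (by positivity) (by linarith) (by fun_prop)
    (by fun_prop) (hcont hE₂d).continuousOn (fun x _ => hasDerivAt_const _ _) (fun x _ => hσd x)
    (fun x _ => hscale (hE₂d (γ * x)))
    (fun x hx => by
      have hx0 : 0 < x := lt_trans (by positivity) hx.1
      have hf0 : 3 / 10 < γ * x := by rw [← hx₁]; exact mul_lt_mul_of_pos_left hx.1 hγ0
      have hf1 : γ * x < 5 / 4 := by rw [← hx₂]; exact mul_lt_mul_of_pos_left hx.2 hγ0
      obtain ⟨h2, h3, h4⟩ := compensatorHigh_spec (by positivity) hG hf0 hf1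
      exact phaseCond_linear hγ0 hγ hγη hx0 (by linarith) h2 h3 h4)
    h1'
  have hc0 : 0 < 5 / 4 * η := by positivity
  have hci : (5 / 4 * η)⁻¹ = 4 / 5 * γ := by
    rw [hγ, mul_inv]; norm_num
  have h3 := h2.jump hη0 hw0 (q := 4 / 5 * γ) (τ := 0) (T := 4 / 5 * γ + 5 / 4 * η)
    (d := (-(55 / 384) + 7 / 12 * γ ^ 2) / γ ^ 2) (by ring)
    (by
      refine traceNormLE_of_sq (by positivity) ?_ (le_of_eq ?_)
      · rw [abs_le]; constructor <;> nlinarith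
      · linear_combination (2 * γ * η + 25 / 16 * η ^ 2 * (γ * η + 1)) * hγη)
    (by
      rw [hx₂, hE₂, compensatorHigh, div_add' _ _ _ (by positivity)]
      apply div_le_div_of_nonneg_right _ (by positivity)
      nlinarith)
  have he : (-(55 / 384) + 7 / 12 * γ ^ 2) / γ ^ 2 = 7 / 12 - 55 / 384 * η ^ 2 := by
    rw [div_eq_iff (by positivity)]
    linear_combination (55 / 384 * (γ * η + 1)) * hγη
  have hci2 : 1 / (5 / 4 * η) ^ 2 = 16 / 25 * γ ^ 2 := by
    rw [one_div, ← inv_pow, hci]; ring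
  have hηγ2 : η * γ ^ 2 = γ := by linear_combination γ * hγη
  rw [← hci, he] at h3
  refine ⟨5 / 4 * η, fun R hR hwR => PairPotential.Reaches.tail hη0 hw hw' hw0 (l := 1 / 6)
    hc0 le_rfl (by norm_num) le_rfl ?_ ?_ ?_ h3 hR hwR⟩
  · rw [hci2, one_div, hci]
    nlinarith
  · rw [hci2]
    nlinarith
  · rw [hci2]
    have : |7 / 12 - 55 / 384 * η ^ 2| ≤ 7 / 12 + 55 / 384 * η ^ 2 := by
      rw [abs_le]; constructor <;> nlinarith [sq_nonneg η]
    nlinarith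

/-- A certificate from the origin covers all `η` with `1 / η` between `g₀` and `g₁`. -/
theorem PairPotential.exists_integral_nonneg_of_certTest (hη : 0 < η)
    (hw : ∀ x, HasDerivAt w (w' x) x) (hw' : Continuous w') (hw0 : ∀ x, 0 ≤ w x) {α g₀ g₁ σ : ℚ}
    (hα : α ≤ 2 / 3) (hg₀ : 0 < g₀) (hg : g₀ < g₁) (h₀ : (g₀ : ℝ) ≤ η⁻¹) (h₁ : η⁻¹ ≤ g₁)
    {rows : List Row} (h : certTest α g₀ g₁ rows 0 0 σ 0 0 = true) :
    ∃ c : ℝ, ∀ R, c ≤ R → w R = 0 → 0 ≤ ∫ y in (0 : ℝ)..R, D.integrand α w w' y := by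
  have hgR : (0 : ℝ) < g₁ - g₀ := by rw [sub_pos]; exact_mod_cast hg
  refine PairPotential.Reaches.of_certTest hη hw hw' hw0 hα hg₀ (hg₀.trans hg)
    (s := (g₁ - η⁻¹) / (g₁ - g₀)) (t := (η⁻¹ - g₀) / (g₁ - g₀))
    (div_nonneg (by linarith) hgR.le) (div_nonneg (by linarith) hgR.le)
    (by rw [← add_div, div_eq_one_iff_eq hgR.ne']; ring)
    (by field_simp; ring) rows 0 0 σ 0 0 h ?_
  simpa using PairPotential.reaches_zero (D := D) (p := 0) (σ := (σ : ℝ)) (e := 0) hη hw0 (by simp)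

/-- For every `η` there are multipliers that keep the loss within the budget. The share `α` of the
budget depends on the range of `η`; it is read off from the certificates. -/
theorem PairPotential.exists_integral_nonneg (hη : 0 < η)
    (hw : ∀ x, HasDerivAt w (w' x) x) (hw' : Continuous w') (hw0 : ∀ x, 0 ≤ w x) :
    ∃ α : ℝ, 0 ≤ α ∧ ∃ c : ℝ, ∀ R, c ≤ R → w R = 0 →
      0 ≤ ∫ y in (0 : ℝ)..R, D.integrand α w w' y := by
  rcases le_total η⁻¹ (1 / 8) with h1 | h1
  · refine ⟨2 / 3, by norm_num, PairPotential.exists_integral_nonneg_of_large ?_ hw hw' hw0⟩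
    rw [one_div] at h1
    exact (inv_le_inv₀ hη (by norm_num)).1 h1
  rcases le_total η⁻¹ (1 / 4) with h2 | h2
  · exact ⟨_, by norm_num, PairPotential.exists_integral_nonneg_of_certTest hη hw hw' hw0
      (by norm_num) (by norm_num) (by norm_num) (by simpa using h1) (by simpa using h2)
      certEighth_valid⟩
  rcases le_total η⁻¹ (1 / 2) with h3 | h3
  · exact ⟨_, by norm_num, PairPotential.exists_integral_nonneg_of_certTest hη hw hw' hw0
      (by norm_num) (by norm_num) (by norm_num) (by simpa using h2) (by simpa using h3)
      certQuarter_valid⟩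
  rcases le_total η⁻¹ (9 / 10) with h4 | h4
  · exact ⟨_, by norm_num, PairPotential.exists_integral_nonneg_of_certTest hη hw hw' hw0
      (by norm_num) (by norm_num) (by norm_num) (by simpa using h3) (by simpa using h4)
      certHalf_valid⟩
  rcases le_total η⁻¹ (7 / 4) with h5 | h5
  · exact ⟨_, by norm_num, PairPotential.exists_integral_nonneg_of_certTest hη hw hw' hw0
      (by norm_num) (by norm_num) (by norm_num) (by simpa using h4) (by simpa using h5)
      certOne_valid⟩
  · refine ⟨2 / 3, by norm_num, PairPotential.exists_integral_nonneg_of_small hη ?_ hw hw' hw0⟩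
    have : (η⁻¹)⁻¹ ≤ (7 / 4 : ℝ)⁻¹ := inv_anti₀ (by norm_num) h5
    rw [inv_inv] at this
    linarith

end

/-! ### Exponential sums with well-spaced frequencies -/

section
variable {ι : Type*} (lam : ι → ℝ)

open Classical in
/-- The coefficients of the off-diagonal part of a product of two exponential sums. -/
noncomputable def offDiag (k l : ι) : ℂ := if k = l then 0 else 1

/-- The coefficients of the primitive of the off-diagonal part. -/
noncomputable def offDiagPrim (k l : ι) : ℂ := Complex.I * ((invDiff lam k l / (2 * Real.pi) : ℝ) : ℂ)

/-- The coefficients of the second primitive of the off-diagonal part. -/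
noncomputable def offDiagPrim₂ (k l : ι) : ℂ :=
  ((-(invDiff lam k l / (2 * Real.pi)) ^ 2 : ℝ) : ℂ)

theorem offDiagPrim_swap (k l : ι) :
    offDiagPrim lam l k = (starRingEnd ℂ) (offDiagPrim lam k l) := by
  unfold offDiagPrim
  rw [invDiff_swap lam k l]
  simp only [map_mul, Complex.conj_I, Complex.conj_ofReal]
  push_cast; ring

theorem offDiagPrim₂_swap (k l : ι) :
    offDiagPrim₂ lam l k = (starRingEnd ℂ) (offDiagPrim₂ lam k l) := by
  unfold offDiagPrim₂
  rw [invDiff_swap lam k l, Complex.conj_ofReal]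
  congr 1; ring

variable [Fintype ι]

/-- The exponential sum `∑ₖ uₖ exp(-2 π i λₖ x)`. -/
noncomputable def expSum (u : ι → ℂ) (x : ℝ) : ℂ :=
  ∑ k, u k * Complex.exp (((-(2 * Real.pi * lam k * x) : ℝ) : ℂ) * Complex.I)

/-- The real part of `∑ₖ ∑ₗ cₖₗ uₖ v̄ₗ exp(-2 π i (λₖ - λₗ) x)`. -/
noncomputable def corr (c : ι → ι → ℂ) (u v : ι → ℂ) (x : ℝ) : ℝ :=
  (∑ k, ∑ l, c k l * (u k * Complex.exp (((-(2 * Real.pi * lam k * x) : ℝ) : ℂ) * Complex.I))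
    * (starRingEnd ℂ) (v l * Complex.exp (((-(2 * Real.pi * lam l * x) : ℝ) : ℂ) * Complex.I))).re

variable {lam}

theorem hasDerivAt_corr {c c' : ι → ι → ℂ}
    (h : ∀ k l, c' k l = c k l * (((-(2 * Real.pi * (lam k - lam l)) : ℝ) : ℂ) * Complex.I))
    (u v : ι → ℂ) (x : ℝ) : HasDerivAt (corr lam c u v) (corr lam c' u v x) x := by
  have hexp : ∀ k, HasDerivAt (fun y : ℝ =>
      Complex.exp (((-(2 * Real.pi * lam k * y) : ℝ) : ℂ) * Complex.I))
      ((((-(2 * Real.pi * lam k) : ℝ) : ℂ) * Complex.I) *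
        Complex.exp (((-(2 * Real.pi * lam k * x) : ℝ) : ℂ) * Complex.I)) x := by
    intro k
    have h1 : HasDerivAt (fun y : ℝ => ((-(2 * Real.pi * lam k * y) : ℝ) : ℂ) * Complex.I)
        (((-(2 * Real.pi * lam k) : ℝ) : ℂ) * Complex.I) x := by
      have := (((hasDerivAt_id' x).const_mul (2 * Real.pi * lam k)).neg).ofReal_comp
      simpa using this.mul_const Complex.I
    exact h1.cexp.congr_deriv (mul_comm _ _)
  have hterm : ∀ k l, HasDerivAt (fun y : ℝ =>
      c k l * (u k * Complex.exp (((-(2 * Real.pi * lam k * y) : ℝ) : ℂ) * Complex.I))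
        * (starRingEnd ℂ) (v l * Complex.exp (((-(2 * Real.pi * lam l * y) : ℝ) : ℂ) * Complex.I)))
      (c' k l * (u k * Complex.exp (((-(2 * Real.pi * lam k * x) : ℝ) : ℂ) * Complex.I))
        * (starRingEnd ℂ) (v l * Complex.exp (((-(2 * Real.pi * lam l * x) : ℝ) : ℂ) * Complex.I)))
      x := by
    intro k l
    have h1 := ((hexp k).const_mul (u k)).const_mul (c k l)
    have h2 : HasDerivAt (fun y : ℝ => (starRingEnd ℂ)
        (v l * Complex.exp (((-(2 * Real.pi * lam l * y) : ℝ) : ℂ) * Complex.I))) _ x :=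
      ((hexp l).const_mul (v l)).star
    refine (h1.mul h2).congr_deriv ?_
    rw [h k l]
    simp only [RCLike.star_def, map_mul, Complex.conj_I, Complex.conj_ofReal]
    push_cast
    ring
  have hsum := HasDerivAt.fun_sum fun k (_ : k ∈ Finset.univ) =>
    HasDerivAt.fun_sum fun l (_ : l ∈ Finset.univ) => hterm k l
  exact (Complex.reCLM.hasFDerivAt.comp_hasDerivAt x hsum)

theorem continuous_corr (c : ι → ι → ℂ) (u v : ι → ℂ) : Continuous (corr lam c u v) :=
  continuous_iff_continuousAt.2 fun x =>
    (hasDerivAt_corr (c := c) (fun _ _ => rfl) u v x).continuousAt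

theorem corr_swap {c : ι → ι → ℂ} (hc : ∀ k l, c l k = (starRingEnd ℂ) (c k l)) (u v : ι → ℂ)
    (x : ℝ) : corr lam c v u x = corr lam c u v x := by
  unfold corr
  rw [← Complex.conj_re, map_sum, Finset.sum_congr rfl fun k _ => map_sum _ _ _, Finset.sum_comm]
  congr 1
  refine Finset.sum_congr rfl fun k _ => Finset.sum_congr rfl fun l _ => ?_
  simp only [map_mul, Complex.conj_conj, hc k l]
  ring

theorem corr_combination {c : ι → ι → ℂ} (hc : ∀ k l, c l k = (starRingEnd ℂ) (c k l))
    (u v : ι → ℂ) (s t x : ℝ) :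
    corr lam c (fun k => s * u k + t * v k) (fun k => s * u k + t * v k) x
      = s ^ 2 * corr lam c u u x + 2 * s * t * corr lam c u v x + t ^ 2 * corr lam c v v x := by
  have h : corr lam c (fun k => s * u k + t * v k) (fun k => s * u k + t * v k) x
      = s ^ 2 * corr lam c u u x + s * t * corr lam c u v x + s * t * corr lam c v u x
        + t ^ 2 * corr lam c v v x := by
    unfold corr
    simp only [← Complex.re_ofReal_mul, ← Complex.add_re, Finset.mul_sum,
      ← Finset.sum_add_distrib]
    congr 1
    refine Finset.sum_congr rfl fun k _ => Finset.sum_congr rfl fun l _ => ?_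
    simp only [map_mul, map_add, Complex.conj_ofReal]
    push_cast
    ring
  rw [h, corr_swap hc u v]
  ring

theorem re_expSum_mul_conj (u v : ι → ℂ) (x : ℝ) :
    (expSum lam u x * (starRingEnd ℂ) (expSum lam v x)).re
      = (∑ k, u k * (starRingEnd ℂ) (v k)).re + corr lam offDiag u v x := by
  classical
  unfold expSum corr
  rw [map_sum, Finset.sum_mul_sum, ← Complex.add_re, ← Finset.sum_add_distrib]
  congr 1
  refine Finset.sum_congr rfl fun k _ => ?_
  rw [← Finset.sum_erase_add _ _ (Finset.mem_univ k), ← Finset.sum_erase_add (a := k) _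
    (fun l => offDiag k l * _ * _) (Finset.mem_univ k)]
  rw [add_comm]
  congr 1
  · rw [map_mul, mul_mul_mul_comm, Complex.mul_conj (Complex.exp _), Complex.normSq_eq_norm_sq,
      Complex.norm_exp_ofReal_mul_I]
    simp
  · rw [offDiag, if_pos rfl, zero_mul, zero_mul, add_zero]
    refine Finset.sum_congr rfl fun l hl => ?_
    rw [offDiag, if_neg (Finset.ne_of_mem_erase hl).symm, one_mul]

theorem norm_sq_expSum (u : ι → ℂ) (x : ℝ) :
    ‖expSum lam u x‖ ^ 2 = ∑ k, ‖u k‖ ^ 2 + corr lam offDiag u u x := by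
  have h := re_expSum_mul_conj (lam := lam) u u x
  rw [Complex.mul_conj, Complex.normSq_eq_norm_sq, Complex.ofReal_re] at h
  rw [h]
  congr 1
  rw [Complex.re_sum]
  refine Finset.sum_congr rfl fun k _ => ?_
  rw [Complex.mul_conj, Complex.normSq_eq_norm_sq, Complex.ofReal_re]

theorem hasDerivAt_corr_prim (hinj : Function.Injective lam) (u v : ι → ℂ) (x : ℝ) :
    HasDerivAt (corr lam (offDiagPrim lam) u v) (corr lam offDiag u v x) x := by
  refine hasDerivAt_corr (fun k l => ?_) u v x
  unfold offDiag offDiagPrim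
  by_cases h : k = l
  · simp [h]
  · have hd : lam k - lam l ≠ 0 := sub_ne_zero.2 fun h' => h (hinj h')
    have hr : invDiff lam k l / (2 * Real.pi) * -(2 * Real.pi * (lam k - lam l)) = -1 := by
      unfold invDiff
      have := Real.pi_ne_zero
      field_simp
    have hc : ((invDiff lam k l / (2 * Real.pi) : ℝ) : ℂ)
        * ((-(2 * Real.pi * (lam k - lam l)) : ℝ) : ℂ) = -1 := by
      rw [← Complex.ofReal_mul, hr]; simp
    rw [if_neg h]
    linear_combination (-(Complex.I ^ 2)) * hc + Complex.I_sq

theorem hasDerivAt_corr_prim₂ (u v : ι → ℂ) (x : ℝ) :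
    HasDerivAt (corr lam (offDiagPrim₂ lam) u v) (corr lam (offDiagPrim lam) u v x) x := by
  refine hasDerivAt_corr (fun k l => ?_) u v x
  unfold offDiagPrim₂ offDiagPrim invDiff
  by_cases h : lam k - lam l = 0
  · simp [h]
  · have := Real.pi_ne_zero
    rw [← mul_assoc, ← Complex.ofReal_mul, mul_comm]
    congr 2
    field_simp

/-- Hilbert's inequality, with the exponentials absorbed into the coefficients. -/
theorem abs_corr_prim_le {δ : ℝ} (hδ : 0 < δ) (hsep : ∀ k l, k ≠ l → δ ≤ |lam k - lam l|)
    (u : ι → ℂ) (x : ℝ) :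
    |corr lam (offDiagPrim lam) u u x| ≤ δ⁻¹ / 2 * ∑ k, ‖u k‖ ^ 2 := by
  set v : ι → ℂ := fun k =>
    u k * Complex.exp (((-(2 * Real.pi * lam k * x) : ℝ) : ℂ) * Complex.I) with hv
  have hn : ∀ k, ‖v k‖ = ‖u k‖ := fun k => by
    rw [hv, norm_mul, Complex.norm_exp_ofReal_mul_I, mul_one]
  have h := hilbert_inequality lam hδ hsep v
  simp only [hn] at h
  have h1 : corr lam (offDiagPrim lam) u u x = -(1 / (2 * Real.pi)) *
      (∑ k, ∑ l, Complex.I * (invDiff lam k l : ℂ) * (v l * (starRingEnd ℂ) (v k))).re := by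
    unfold corr
    rw [Finset.sum_comm, ← Complex.re_ofReal_mul]
    congr 1
    rw [Finset.mul_sum]
    refine Finset.sum_congr rfl fun k _ => ?_
    rw [Finset.mul_sum]
    refine Finset.sum_congr rfl fun l _ => ?_
    change offDiagPrim lam l k * v l * (starRingEnd ℂ) (v k) = _
    rw [offDiagPrim, invDiff_swap lam k l]
    push_cast
    ring
  rw [h1, abs_mul, abs_neg, abs_of_pos (by positivity)]
  calc _ ≤ 1 / (2 * Real.pi) * (Real.pi / δ * ∑ k, ‖u k‖ ^ 2) := by gcongr
    _ = _ := by field_simp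

/-- Schur's test for the matrix of the squares of the reciprocal differences. -/
theorem abs_corr_prim₂_le {δ : ℝ} (hδ : 0 < δ) (hsep : ∀ k l, k ≠ l → δ ≤ |lam k - lam l|)
    (u : ι → ℂ) (x : ℝ) :
    |corr lam (offDiagPrim₂ lam) u u x| ≤ δ⁻¹ ^ 2 / 12 * ∑ k, ‖u k‖ ^ 2 := by
  have h1 : |corr lam (offDiagPrim₂ lam) u u x|
      ≤ ∑ k, ∑ l, (invDiff lam k l / (2 * Real.pi)) ^ 2 * (‖u k‖ * ‖u l‖) := by
    refine (Complex.abs_re_le_norm _).trans ((norm_sum_le _ _).trans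
      (Finset.sum_le_sum fun k _ => (norm_sum_le _ _).trans (Finset.sum_le_sum fun l _ => ?_)))
    rw [norm_mul, norm_mul, RCLike.norm_conj, norm_mul, norm_mul, Complex.norm_exp_ofReal_mul_I,
      Complex.norm_exp_ofReal_mul_I, offDiagPrim₂, Complex.norm_real, norm_neg, norm_pow,
      Real.norm_eq_abs, sq_abs]
    apply le_of_eq; ring
  have h2 : ∀ k l, (invDiff lam k l / (2 * Real.pi)) ^ 2 * (‖u k‖ * ‖u l‖)
      ≤ 1 / (8 * Real.pi ^ 2) * (invDiff lam l k ^ 2 * ‖u k‖ ^ 2)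
        + 1 / (8 * Real.pi ^ 2) * (invDiff lam k l ^ 2 * ‖u l‖ ^ 2) := by
    intro k l
    rw [invDiff_swap lam k l, neg_sq]
    have h3 : ‖u k‖ * ‖u l‖ ≤ (‖u k‖ ^ 2 + ‖u l‖ ^ 2) / 2 := by
      nlinarith [sq_nonneg (‖u k‖ - ‖u l‖)]
    calc _ ≤ (invDiff lam k l / (2 * Real.pi)) ^ 2 * ((‖u k‖ ^ 2 + ‖u l‖ ^ 2) / 2) := by gcongr
      _ = _ := by field_simp; ring
  have h4 : ∑ k, ∑ l, (1 / (8 * Real.pi ^ 2) * (invDiff lam l k ^ 2 * ‖u k‖ ^ 2)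
        + 1 / (8 * Real.pi ^ 2) * (invDiff lam k l ^ 2 * ‖u l‖ ^ 2))
      = 1 / (4 * Real.pi ^ 2) * ∑ k, (∑ l, invDiff lam l k ^ 2) * ‖u k‖ ^ 2 := by
    simp only [Finset.sum_add_distrib]
    rw [Finset.sum_comm (f := fun k l => 1 / (8 * Real.pi ^ 2) * (invDiff lam k l ^ 2 * ‖u l‖ ^ 2)),
      ← two_mul]
    simp only [← Finset.mul_sum, ← Finset.sum_mul]
    ring
  calc _ ≤ _ := h1
    _ ≤ _ := Finset.sum_le_sum fun k _ => Finset.sum_le_sum fun l _ => h2 k l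
    _ = _ := h4
    _ ≤ 1 / (4 * Real.pi ^ 2) * ∑ k, Real.pi ^ 2 / (3 * δ ^ 2) * ‖u k‖ ^ 2 := by
      gcongr with k _
      exact sum_invDiff_sq_le lam hδ hsep k
    _ = _ := by
      rw [← Finset.mul_sum]
      have := Real.pi_ne_zero
      field_simp; ring

end

/-! ### Integrals of a pair of exponential sums against an even weight -/

theorem hasDerivAt_symm {f f' : ℝ → ℝ} (h : ∀ x, HasDerivAt f (f' x) x) (x : ℝ) :
    HasDerivAt (fun y => (f y + f (-y)) / 2) ((f' x - f' (-x)) / 2) x := by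
  have := ((h x).add ((h (-x)).comp x (hasDerivAt_neg x))).div_const 2
  refine this.congr_deriv (by ring)

theorem hasDerivAt_antisymm {f f' : ℝ → ℝ} (h : ∀ x, HasDerivAt f (f' x) x) (x : ℝ) :
    HasDerivAt (fun y => (f y - f (-y)) / 2) ((f' x + f' (-x)) / 2) x := by
  have := ((h x).sub ((h (-x)).comp x (hasDerivAt_neg x))).div_const 2
  refine this.congr_deriv (by ring)

theorem injective_of_separated {ι : Type*} {lam : ι → ℝ} {δ : ℝ} (hδ : 0 < δ)
    (hsep : ∀ k l, k ≠ l → δ ≤ |lam k - lam l|) :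
    Function.Injective lam := by
  intro k l hkl
  by_contra hne
  have := hsep k l hne
  rw [hkl, sub_self, abs_zero] at this
  linarith

section
variable {ι : Type*} [Fintype ι] {lam : ι → ℝ}

theorem continuous_expSum (u : ι → ℂ) : Continuous (expSum lam u) := by
  unfold expSum; fun_prop

theorem norm_sq_expSum_add (a b : ι → ℂ) (x : ℝ) :
    ‖expSum lam a x + x * expSum lam b x‖ ^ 2
      = ∑ k, ‖a k‖ ^ 2 + corr lam offDiag a a x
        + 2 * x * ((∑ k, a k * (starRingEnd ℂ) (b k)).re + corr lam offDiag a b x)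
        + x ^ 2 * (∑ k, ‖b k‖ ^ 2 + corr lam offDiag b b x) := by
  rw [← norm_sq_expSum, ← norm_sq_expSum, ← re_expSum_mul_conj]
  simp only [← Complex.normSq_eq_norm_sq]
  rw [Complex.normSq_add]
  simp only [map_mul, Complex.conj_ofReal, Complex.normSq_ofReal]
  rw [mul_left_comm, Complex.re_ofReal_mul]
  ring

theorem sum_norm_sq_add_sub (a b : ι → ℂ) (s t : ℝ) :
    ∑ k, ‖(s : ℂ) * a k + (t : ℂ) * b k‖ ^ 2 + ∑ k, ‖(s : ℂ) * a k + ((-t : ℝ) : ℂ) * b k‖ ^ 2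
      = 2 * (s ^ 2 * ∑ k, ‖a k‖ ^ 2 + t ^ 2 * ∑ k, ‖b k‖ ^ 2) := by
  rw [Finset.mul_sum, Finset.mul_sum, ← Finset.sum_add_distrib, ← Finset.sum_add_distrib,
    Finset.mul_sum]
  refine Finset.sum_congr rfl fun k _ => ?_
  have h := parallelogram_law_with_norm ℝ ((s : ℂ) * a k) ((t : ℂ) * b k)
  simp only [norm_mul, Complex.norm_real, Real.norm_eq_abs] at h
  push_cast
  rw [neg_mul, ← sub_eq_add_neg, h, mul_pow, mul_pow, sq_abs, sq_abs]

variable (lam)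

/-- The potentials of the pair of exponential sums with normalized coefficients `a` and `b`,
symmetrized for the integration against even weights. -/
noncomputable def pairPotential {δ : ℝ} (hδ : 0 < δ)
    (hsep : ∀ k l, k ≠ l → δ ≤ |lam k - lam l|) (a b : ι → ℂ) (ha : ∑ k, ‖a k‖ ^ 2 = 1)
    (hb : ∑ k, ‖b k‖ ^ 2 = 1) : PairPotential δ⁻¹ where
  A x := (corr lam offDiag a a x + corr lam offDiag a a (-x)) / 2
  B x := (corr lam offDiag a b x - corr lam offDiag a b (-x)) / 2
  C x := (corr lam offDiag b b x + corr lam offDiag b b (-x)) / 2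
  H11 x := (corr lam (offDiagPrim lam) a a x - corr lam (offDiagPrim lam) a a (-x)) / 2
  H12 x := (corr lam (offDiagPrim lam) a b x + corr lam (offDiagPrim lam) a b (-x)) / 2
  H22 x := (corr lam (offDiagPrim lam) b b x - corr lam (offDiagPrim lam) b b (-x)) / 2
  P11 x := (corr lam (offDiagPrim₂ lam) a a x + corr lam (offDiagPrim₂ lam) a a (-x)) / 2
  P12 x := (corr lam (offDiagPrim₂ lam) a b x - corr lam (offDiagPrim₂ lam) a b (-x)) / 2
  P22 x := (corr lam (offDiagPrim₂ lam) b b x + corr lam (offDiagPrim₂ lam) b b (-x)) / 2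
  contA := by have := continuous_corr (lam := lam) offDiag a a; fun_prop
  contB := by have := continuous_corr (lam := lam) offDiag a b; fun_prop
  contC := by have := continuous_corr (lam := lam) offDiag b b; fun_prop
  derivH11 := hasDerivAt_antisymm (hasDerivAt_corr_prim (injective_of_separated hδ hsep) a a)
  derivH12 := hasDerivAt_symm (hasDerivAt_corr_prim (injective_of_separated hδ hsep) a b)
  derivH22 := hasDerivAt_antisymm (hasDerivAt_corr_prim (injective_of_separated hδ hsep) b b)
  derivP11 := hasDerivAt_symm (hasDerivAt_corr_prim₂ a a)
  derivP12 := hasDerivAt_antisymm (hasDerivAt_corr_prim₂ a b)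
  derivP22 := hasDerivAt_symm (hasDerivAt_corr_prim₂ b b)
  form_nonneg x := by
    have h1 := norm_sq_expSum_add (lam := lam) a b x
    have h2 := norm_sq_expSum_add (lam := lam) a b (-x)
    rw [ha, hb] at h1 h2
    have h3 : 0 ≤ ‖expSum lam a x + x * expSum lam b x‖ ^ 2 := sq_nonneg _
    have h4 : 0 ≤ ‖expSum lam a (-x) + (-x : ℝ) * expSum lam b (-x)‖ ^ 2 := sq_nonneg _
    rw [h1] at h3
    rw [h2] at h4
    nlinarith
  boundH x s t := by
    have h1 := abs_corr_prim_le hδ hsep (fun k => (s : ℂ) * a k + (t : ℂ) * b k) x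
    have h2 := abs_corr_prim_le hδ hsep (fun k => (s : ℂ) * a k + ((-t : ℝ) : ℂ) * b k) (-x)
    rw [corr_combination (offDiagPrim_swap lam)] at h1 h2
    have h3 := sum_norm_sq_add_sub a b s t
    rw [ha, hb, mul_one, mul_one] at h3
    have h4 : ∀ A B : ℝ, |(A - B) / 2| ≤ (|A| + |B|) / 2 := fun A B => by
      rw [abs_div, abs_two]; gcongr; simpa [sub_eq_add_neg] using abs_add_le A (-B)
    refine le_trans (le_of_eq (congrArg _ ?_)) ((h4 _ _).trans ((div_le_div_of_nonneg_right
      (add_le_add h1 h2) zero_le_two).trans (le_of_eq ?_)))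
    · ring
    · rw [← mul_add, h3]; ring
  boundP x s t := by
    have h1 := abs_corr_prim₂_le hδ hsep (fun k => (s : ℂ) * a k + (t : ℂ) * b k) x
    have h2 := abs_corr_prim₂_le hδ hsep (fun k => (s : ℂ) * a k + ((-t : ℝ) : ℂ) * b k) (-x)
    rw [corr_combination (offDiagPrim₂_swap lam)] at h1 h2
    have h3 := sum_norm_sq_add_sub a b s t
    rw [ha, hb, mul_one, mul_one] at h3
    have h4 : ∀ A B : ℝ, |(A + B) / 2| ≤ (|A| + |B|) / 2 := fun A B => by
      rw [abs_div, abs_two]; gcongr; exact abs_add_le _ _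
    refine le_trans (le_of_eq (congrArg _ ?_)) ((h4 _ _).trans ((div_le_div_of_nonneg_right
      (add_le_add h1 h2) zero_le_two).trans (le_of_eq ?_)))
    · ring
    · rw [← mul_add, h3]; ring
  H11_zero := by simp
  P12_zero := by simp

variable {lam}

theorem integral_eq_interval_symm {F : ℝ → ℝ} (hF : Continuous F) {R : ℝ} (hR : 0 ≤ R)
    (h : ∀ x, R ≤ |x| → F x = 0) : ∫ x, F x = ∫ x in (0 : ℝ)..R, (F x + F (-x)) := by
  have h1 : ∫ x, F x = ∫ x in (-R)..R, F x := by
    refine (intervalIntegral.integral_eq_integral_of_support_subset fun x hx => ?_).symm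
    by_contra hx'
    apply hx
    apply h
    simp only [Set.mem_Ioc, not_and_or, not_lt, not_le] at hx'
    rcases hx' with h' | h'
    · rw [abs_of_nonpos (by linarith)]; linarith
    · exact h'.le.trans (le_abs_self x)
  have h2 : ∫ x in (0 : ℝ)..R, F (-x) = ∫ x in (-R)..0, F x := by
    rw [intervalIntegral.integral_comp_neg (fun x => F x), neg_zero]
  have hn : Continuous fun x => F (-x) := hF.comp continuous_neg
  rw [h1, intervalIntegral.integral_add (hF.intervalIntegrable _ _) (hn.intervalIntegrable _ _), h2,
    add_comm, intervalIntegral.integral_add_adjacent_intervals (hF.intervalIntegrable _ _)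
    (hF.intervalIntegrable _ _)]

theorem integral_even_eq {F : ℝ → ℝ} (hF : Continuous F) {R : ℝ} (hR : 0 ≤ R)
    (h : ∀ x, R ≤ |x| → F x = 0) (he : ∀ x, F (-x) = F x) :
    ∫ x, F x = 2 * ∫ x in (0 : ℝ)..R, F x := by
  rw [integral_eq_interval_symm hF hR h, ← intervalIntegral.integral_const_mul]
  simp only [he, two_mul]

theorem deriv_odd_of_even {w w' : ℝ → ℝ} (hw : ∀ x, HasDerivAt w (w' x) x)
    (he : ∀ x, w (-x) = w x) (x : ℝ) : w' (-x) = -w' x := by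
  have h1 := (hw (-x)).comp x (hasDerivAt_neg x)
  have h2 : (w ∘ fun y => -y) = w := funext he
  have h3 : HasDerivAt w (w' (-x) * -1) x := by rw [← h2]; exact h1
  have := h3.unique (hw x)
  linarith

theorem exists_radius {w w' : ℝ → ℝ} (hw : ∀ x, HasDerivAt w (w' x) x) (hs : HasCompactSupport w) :
    ∃ R : ℝ, 0 < R ∧ ∀ x, R ≤ |x| → w x = 0 ∧ w' x = 0 := by
  have hd : w' = deriv w := funext fun x => (hw x).deriv.symm
  obtain ⟨R₁, h1, h1'⟩ := hs.exists_pos_le_norm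
  obtain ⟨R₂, h2, h2'⟩ := hs.deriv.exists_pos_le_norm
  refine ⟨max R₁ R₂, lt_max_of_lt_left h1, fun x hx => ⟨h1' x ?_, ?_⟩⟩
  · exact (le_max_left _ _).trans hx
  · rw [hd]; exact h2' x ((le_max_right _ _).trans hx)

/-- The lower bound for a pair of exponential sums whose coefficients have norm `1`: on the half-line
it is `PairPotential.exists_integral_nonneg`. -/
theorem integral_pair_ge_of_normalized {δ : ℝ} (hδ : 0 < δ)
    (hsep : ∀ k l, k ≠ l → δ ≤ |lam k - lam l|) {a b : ι → ℂ} (ha : ∑ k, ‖a k‖ ^ 2 = 1)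
    (hb : ∑ k, ‖b k‖ ^ 2 = 1) {w w' : ℝ → ℝ} (hw : ∀ x, HasDerivAt w (w' x) x)
    (hw' : Continuous w') (hw0 : ∀ x, 0 ≤ w x) (he : ∀ x, w (-x) = w x)
    (hs : HasCompactSupport w) (h : δ⁻¹ * ∫ x, |w' x| ≤ 3 / 2 * ∫ x, w x) :
    (∫ x, x ^ 2 * w x) - 2 / 3 * δ⁻¹ * ∫ x, |2 * x * w x + x ^ 2 * w' x|
      ≤ ∫ x, w x * ‖expSum lam a x + x * expSum lam b x‖ ^ 2 := by
  set D := pairPotential lam hδ hsep a b ha hb with hD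
  have hη : 0 < δ⁻¹ := inv_pos.2 hδ
  have hwc : Continuous w := continuous_iff_continuousAt.2 fun x => (hw x).continuousAt
  have hodd := deriv_odd_of_even hw he
  obtain ⟨R₀, hR₀, hR₀'⟩ := exists_radius hw hs
  obtain ⟨α, hα, c, hc⟩ := PairPotential.exists_integral_nonneg (D := D) hη hw hw' hw0
  set R := max c R₀ with hRdef
  have hR : 0 ≤ R := hR₀.le.trans (le_max_right _ _)
  have hz : ∀ x, R ≤ |x| → w x = 0 ∧ w' x = 0 := fun x hx =>
    hR₀' x ((le_max_right _ _).trans hx)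
  have key := hc R (le_max_left _ _) (hz R (le_abs_self R)).1
  have hca := continuous_expSum (lam := lam) a
  have hcb := continuous_expSum (lam := lam) b
  have hq : Continuous fun x : ℝ => w x * ‖expSum lam a x + x * expSum lam b x‖ ^ 2 := by fun_prop
  rw [integral_eq_interval_symm hq hR fun x hx => by rw [(hz x hx).1, zero_mul],
    integral_even_eq (by fun_prop) hR (fun x hx => by rw [(hz x hx).1, mul_zero])
      (fun x => by rw [he]; ring),
    integral_even_eq (F := fun x => |2 * x * w x + x ^ 2 * w' x|) (by fun_prop) hR
      (fun x hx => by rw [(hz x hx).1, (hz x hx).2]; simp)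
      (fun x => by rw [he, hodd, ← abs_neg]; congr 1; ring)]
  rw [integral_even_eq (F := fun x => |w' x|) (by fun_prop) hR
      (fun x hx => by rw [(hz x hx).2]; simp) (fun x => by rw [hodd, abs_neg]),
    integral_even_eq hwc hR (fun x hx => (hz x hx).1) he] at h
  have hA := D.contA
  have hB := D.contB
  have hC := D.contC
  have hex : Continuous D.excess := by unfold PairPotential.excess; fun_prop
  have e1 : ∀ x : ℝ, w x * ‖expSum lam a x + x * expSum lam b x‖ ^ 2
      + w (-x) * ‖expSum lam a (-x) + ((-x : ℝ) : ℂ) * expSum lam b (-x)‖ ^ 2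
      = 2 * (w x * D.excess x) + 2 * w x + 2 * (x ^ 2 * w x) := fun x => by
    rw [he, norm_sq_expSum_add, norm_sq_expSum_add, ha, hb]
    simp only [PairPotential.excess, hD, pairPotential]
    ring
  simp only [e1]
  have e2 : ∫ x in (0 : ℝ)..R, D.integrand α w w' x
      = (∫ x in (0 : ℝ)..R, w x * D.excess x) + δ⁻¹ * (α * (∫ x in (0 : ℝ)..R, |w' x|)
        + 2 / 3 * ∫ x in (0 : ℝ)..R, |2 * x * w x + x ^ 2 * w' x|)
        + (1 - 3 / 2 * α) * ∫ x in (0 : ℝ)..R, w x := by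
    unfold PairPotential.integrand
    rw [intervalIntegral.integral_add, intervalIntegral.integral_add,
      intervalIntegral.integral_const_mul, intervalIntegral.integral_const_mul,
      intervalIntegral.integral_add, intervalIntegral.integral_const_mul,
      intervalIntegral.integral_const_mul]
    all_goals
      apply Continuous.intervalIntegrable
      fun_prop
  have e3 : ∫ x in (0 : ℝ)..R, (2 * (w x * D.excess x) + 2 * w x + 2 * (x ^ 2 * w x))
      = 2 * (∫ x in (0 : ℝ)..R, w x * D.excess x) + 2 * (∫ x in (0 : ℝ)..R, w x)
        + 2 * ∫ x in (0 : ℝ)..R, x ^ 2 * w x := by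
    rw [intervalIntegral.integral_add, intervalIntegral.integral_add,
      intervalIntegral.integral_const_mul, intervalIntegral.integral_const_mul,
      intervalIntegral.integral_const_mul]
    all_goals
      apply Continuous.intervalIntegrable
      fun_prop
  rw [e2] at key
  rw [e3]
  -- the hypothesis on `‖w'‖₁` pays for the share `α` of the budget
  have h' := mul_le_mul_of_nonneg_left h hα
  linarith

/-- Integration by parts: the integral of `‖∑ₖ bₖ exp(-2 π i λₖ x)‖²` against a weight is close to
that of its diagonal part. -/
theorem abs_integral_norm_sq_expSum_sub_le {δ : ℝ} (hδ : 0 < δ)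
    (hsep : ∀ k l, k ≠ l → δ ≤ |lam k - lam l|) (b : ι → ℂ) {u u' : ℝ → ℝ}
    (hu : ∀ x, HasDerivAt u (u' x) x) (hu' : Continuous u') (hs : HasCompactSupport u) :
    |(∫ x, u x * ‖expSum lam b x‖ ^ 2) - (∑ k, ‖b k‖ ^ 2) * ∫ x, u x|
      ≤ (∑ k, ‖b k‖ ^ 2) * (δ⁻¹ / 2 * ∫ x, |u' x|) := by
  have hinj := injective_of_separated hδ hsep
  have huc : Continuous u := continuous_iff_continuousAt.2 fun x => (hu x).continuousAt
  have hd : u' = deriv u := funext fun x => (hu x).deriv.symm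
  have hs' : HasCompactSupport u' := hd ▸ hs.deriv
  have hc0 := continuous_corr (lam := lam) offDiag b b
  have hc1 := continuous_corr (lam := lam) (offDiagPrim lam) b b
  have i1 : Integrable fun x => u x * corr lam offDiag b b x :=
    (huc.mul hc0).integrable_of_hasCompactSupport hs.mul_right
  have i2 : Integrable fun x => u' x * corr lam (offDiagPrim lam) b b x :=
    (hu'.mul hc1).integrable_of_hasCompactSupport hs'.mul_right
  have i3 : Integrable fun x => u x * corr lam (offDiagPrim lam) b b x :=
    (huc.mul hc1).integrable_of_hasCompactSupport hs.mul_right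
  have iu : Integrable u := huc.integrable_of_hasCompactSupport hs
  have iu' : Integrable u' := hu'.integrable_of_hasCompactSupport hs'
  have hparts := integral_mul_deriv_eq_deriv_mul_of_integrable (fun x _ => hu x)
    (fun x _ => hasDerivAt_corr_prim hinj b b x) i1 i2 i3
  have e1 : ∫ x, u x * ‖expSum lam b x‖ ^ 2
      = (∑ k, ‖b k‖ ^ 2) * (∫ x, u x) + ∫ x, u x * corr lam offDiag b b x := by
    rw [← integral_const_mul, ← integral_add (iu.const_mul _) i1]
    refine integral_congr_ae (Filter.Eventually.of_forall fun x => ?_)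
    simp only [norm_sq_expSum]; ring
  rw [e1, add_sub_cancel_left, hparts, abs_neg]
  calc _ ≤ ∫ x, |u' x * corr lam (offDiagPrim lam) b b x| := abs_integral_le_integral_abs
    _ ≤ ∫ x, |u' x| * (δ⁻¹ / 2 * ∑ k, ‖b k‖ ^ 2) := by
      refine integral_mono i2.abs (iu'.abs.mul_const _) fun x => ?_
      simp only [abs_mul]
      exact mul_le_mul_of_nonneg_left (abs_corr_prim_le hδ hsep b x) (abs_nonneg _)
    _ = _ := by rw [integral_mul_const]; ring

/-- If `a = 0` there is no scale to normalize by, but a direct integration by parts is enough. -/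
theorem integral_pair_ge_of_zero {δ : ℝ} (hδ : 0 < δ)
    (hsep : ∀ k l, k ≠ l → δ ≤ |lam k - lam l|) {a : ι → ℂ} (b : ι → ℂ) {w w' : ℝ → ℝ}
    (hw : ∀ x, HasDerivAt w (w' x) x) (hw' : Continuous w') (hs : HasCompactSupport w)
    (ha : ∀ k, a k = 0) :
    (∑ k, ‖b k‖ ^ 2) * ((∫ x, x ^ 2 * w x)
        - 2 / 3 * δ⁻¹ * ∫ x, |2 * x * w x + x ^ 2 * w' x|)
      ≤ ∫ x, w x * ‖expSum lam a x + x * expSum lam b x‖ ^ 2 := by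
  have hwc : Continuous w := continuous_iff_continuousAt.2 fun x => (hw x).continuousAt
  have hd : ∀ x, HasDerivAt (fun x => x ^ 2 * w x) (2 * x * w x + x ^ 2 * w' x) x := fun x => by
    have := ((hasDerivAt_id' x).pow 2).mul (hw x)
    refine this.congr_deriv ?_
    simp
  have hsu : HasCompactSupport fun x => x ^ 2 * w x :=
    hs.mono fun x hx => right_ne_zero_of_mul hx
  have hB : 0 ≤ ∑ k, ‖b k‖ ^ 2 := Finset.sum_nonneg fun _ _ => sq_nonneg _
  have h1 := abs_integral_norm_sq_expSum_sub_le hδ hsep b hd (by fun_prop) hsu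
  have h2 : ∀ x : ℝ, w x * ‖expSum lam a x + x * expSum lam b x‖ ^ 2
      = x ^ 2 * w x * ‖expSum lam b x‖ ^ 2 := fun x => by
    have : expSum lam a x = 0 := by simp [expSum, ha]
    rw [this, zero_add, norm_mul, Complex.norm_real, mul_pow, Real.norm_eq_abs, sq_abs]; ring
  simp only [h2]
  have h3 := (abs_le.1 h1).1
  have h4 : 0 ≤ (∑ k, ‖b k‖ ^ 2) * (δ⁻¹ * ∫ x, |2 * x * w x + x ^ 2 * w' x|) :=
    mul_nonneg hB (mul_nonneg (inv_pos.2 hδ).le (integral_nonneg fun _ => abs_nonneg _))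
  linarith

/-- The lower bound for a pair of exponential sums with arbitrary coefficients, by rescaling the
variable by the ratio of the norms of `a` and `b`. -/
theorem integral_pair_ge {δ : ℝ} (hδ : 0 < δ)
    (hsep : ∀ k l, k ≠ l → δ ≤ |lam k - lam l|) (a b : ι → ℂ) {w w' : ℝ → ℝ}
    (hw : ∀ x, HasDerivAt w (w' x) x) (hw' : Continuous w') (hw0 : ∀ x, 0 ≤ w x)
    (he : ∀ x, w (-x) = w x) (hs : HasCompactSupport w)
    (h : δ⁻¹ * ∫ x, |w' x| ≤ 3 / 2 * ∫ x, w x) :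
    (∑ k, ‖b k‖ ^ 2) * ((∫ x, x ^ 2 * w x)
        - 2 / 3 * δ⁻¹ * ∫ x, |2 * x * w x + x ^ 2 * w' x|)
      ≤ ∫ x, w x * ‖expSum lam a x + x * expSum lam b x‖ ^ 2 := by
  have hnn : 0 ≤ ∫ x, w x * ‖expSum lam a x + x * expSum lam b x‖ ^ 2 :=
    integral_nonneg fun x => mul_nonneg (hw0 x) (sq_nonneg _)
  have hA0 : 0 ≤ ∑ k, ‖a k‖ ^ 2 := Finset.sum_nonneg fun _ _ => sq_nonneg _
  have hB0 : 0 ≤ ∑ k, ‖b k‖ ^ 2 := Finset.sum_nonneg fun _ _ => sq_nonneg _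
  rcases hB0.eq_or_lt with hB | hB
  · rw [← hB, zero_mul]; exact hnn
  rcases hA0.eq_or_lt with hA | hA
  · have ha : ∀ k, a k = 0 := fun k => by
      have := (Finset.sum_eq_zero_iff_of_nonneg (fun k _ => sq_nonneg ‖a k‖)).1 hA.symm k
        (Finset.mem_univ k)
      simpa using this
    exact integral_pair_ge_of_zero hδ hsep b hw hw' hs ha
  -- `γ` is the ratio of the norms
  set p := Real.sqrt (∑ k, ‖a k‖ ^ 2) with hp
  set q := Real.sqrt (∑ k, ‖b k‖ ^ 2) with hq
  have hp0 : 0 < p := Real.sqrt_pos.2 hA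
  have hq0 : 0 < q := Real.sqrt_pos.2 hB
  have hpsq : p ^ 2 = ∑ k, ‖a k‖ ^ 2 := Real.sq_sqrt hA0
  have hqsq : q ^ 2 = ∑ k, ‖b k‖ ^ 2 := Real.sq_sqrt hB0
  set γ := p / q with hγ
  have hγ0 : 0 < γ := by positivity
  have hscale : ∀ (F : ℝ → ℝ), ∫ x, F (γ * x) = γ⁻¹ * ∫ x, F x := fun F => by
    rw [Measure.integral_comp_mul_left F γ, abs_of_pos (by positivity), smul_eq_mul]
  have hexp : ∀ (r : ℝ) (u : ι → ℂ) (x : ℝ),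
      expSum (fun k => γ * lam k) (fun k => (r : ℂ) * u k) x = r * expSum lam u (γ * x) := by
    intro r u x
    unfold expSum
    rw [Finset.mul_sum]
    refine Finset.sum_congr rfl fun k _ => ?_
    rw [show 2 * Real.pi * (γ * lam k) * x = 2 * Real.pi * lam k * (γ * x) by ring]
    ring
  have hnorm : ∀ (r : ℝ) (u : ι → ℂ), 0 < r → r ^ 2 = ∑ k, ‖u k‖ ^ 2 →
      ∑ k, ‖((r⁻¹ : ℝ) : ℂ) * u k‖ ^ 2 = 1 := fun r u hr h => by
    simp only [norm_mul, mul_pow, ← Finset.mul_sum, Complex.norm_real, Real.norm_eq_abs, sq_abs, ← h]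
    field_simp
  have key := integral_pair_ge_of_normalized (lam := fun k => γ * lam k)
    (a := fun k => ((p⁻¹ : ℝ) : ℂ) * a k) (b := fun k => ((q⁻¹ : ℝ) : ℂ) * b k)
    (w := fun x => w (γ * x)) (w' := fun x => γ * w' (γ * x)) (δ := γ * δ) (mul_pos hγ0 hδ)
    (fun k l hkl => by
      rw [← mul_sub, abs_mul, abs_of_pos hγ0]
      exact mul_le_mul_of_nonneg_left (hsep k l hkl) hγ0.le)
    (hnorm p a hp0 hpsq) (hnorm q b hq0 hqsq)
    (fun x => by
      have := (hw (γ * x)).comp x ((hasDerivAt_id' x).const_mul γ)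
      refine this.congr_deriv (by ring))
    (by fun_prop) (fun x => hw0 _) (fun x => by rw [mul_neg, he])
    (hs.comp_homeomorph (Homeomorph.mulLeft₀ γ hγ0.ne'))
    (by
      have e1 : ∫ x, |γ * w' (γ * x)| = ∫ x, |w' x| := by
        have := hscale fun y => |γ * w' y|
        rw [this]
        simp only [abs_mul, abs_of_pos hγ0]
        rw [integral_const_mul]
        field_simp
      rw [e1, hscale fun y => w y, mul_inv]
      have := mul_le_mul_of_nonneg_left h (inv_pos.2 hγ0).le
      linarith)
  simp only [hexp] at key
  have e1 : ∫ x : ℝ, x ^ 2 * w (γ * x) = (γ⁻¹) ^ 3 * ∫ x, x ^ 2 * w x := by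
    have := hscale fun y => (γ⁻¹ * y) ^ 2 * w y
    simp only [inv_mul_cancel_left₀ hγ0.ne', mul_pow, mul_assoc] at this
    rw [this, integral_const_mul]; ring
  have e2 : ∫ x : ℝ, |2 * x * w (γ * x) + x ^ 2 * (γ * w' (γ * x))|
      = (γ⁻¹) ^ 2 * ∫ x, |2 * x * w x + x ^ 2 * w' x| := by
    have := hscale fun y => |2 * (γ⁻¹ * y) * w y + (γ⁻¹ * y) ^ 2 * (γ * w' y)|
    simp only [inv_mul_cancel_left₀ hγ0.ne'] at this
    have h5 : ∀ x, |2 * (γ⁻¹ * x) * w x + (γ⁻¹ * x) ^ 2 * (γ * w' x)|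
        = γ⁻¹ * |2 * x * w x + x ^ 2 * w' x| := fun x => by
      rw [show 2 * (γ⁻¹ * x) * w x + (γ⁻¹ * x) ^ 2 * (γ * w' x)
        = γ⁻¹ * (2 * x * w x + x ^ 2 * w' x) by field_simp, abs_mul, abs_of_pos (inv_pos.2 hγ0)]
    rw [this]
    simp only [h5]
    rw [integral_const_mul]
    ring
  have e3 : ∫ x : ℝ, w (γ * x) * ‖((p⁻¹ : ℝ) : ℂ) * expSum lam a (γ * x)
      + x * (((q⁻¹ : ℝ) : ℂ) * expSum lam b (γ * x))‖ ^ 2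
      = γ⁻¹ * (p⁻¹) ^ 2 * ∫ x, w x * ‖expSum lam a x + x * expSum lam b x‖ ^ 2 := by
    have := hscale fun y => w y * ‖((p⁻¹ : ℝ) : ℂ) * expSum lam a y
      + ((γ⁻¹ * y : ℝ) : ℂ) * (((q⁻¹ : ℝ) : ℂ) * expSum lam b y)‖ ^ 2
    simp only [inv_mul_cancel_left₀ hγ0.ne'] at this
    have h5 : ∀ x : ℝ, ((p⁻¹ : ℝ) : ℂ) * expSum lam a x
        + ((γ⁻¹ * x : ℝ) : ℂ) * (((q⁻¹ : ℝ) : ℂ) * expSum lam b x)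
        = ((p⁻¹ : ℝ) : ℂ) * (expSum lam a x + x * expSum lam b x) := fun x => by
      have h6 : ((γ⁻¹ * x : ℝ) : ℂ) * ((q⁻¹ : ℝ) : ℂ) = ((p⁻¹ : ℝ) : ℂ) * x := by
        rw [← Complex.ofReal_mul, ← Complex.ofReal_mul, hγ]
        congr 1
        field_simp
      rw [← mul_assoc, h6]; ring
    have h7 : ∀ x : ℝ, w x * ‖((p⁻¹ : ℝ) : ℂ) * (expSum lam a x + x * expSum lam b x)‖ ^ 2
        = (p⁻¹) ^ 2 * (w x * ‖expSum lam a x + x * expSum lam b x‖ ^ 2) := fun x => by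
      rw [norm_mul, Complex.norm_real, mul_pow, Real.norm_eq_abs, sq_abs]
      ring
    rw [this]
    simp only [h5, h7]
    rw [integral_const_mul]
    ring
  rw [e1, e2, e3] at key
  have hm : 0 < γ * p ^ 2 := by positivity
  have := mul_le_mul_of_nonneg_left key hm.le
  rw [← hqsq]
  have hpγ : p = γ * q := by rw [hγ]; field_simp
  calc _ = γ * p ^ 2 * ((γ⁻¹) ^ 3 * (∫ x, x ^ 2 * w x) - 2 / 3 * (γ * δ)⁻¹ *
        ((γ⁻¹) ^ 2 * ∫ x, |2 * x * w x + x ^ 2 * w' x|)) := by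
        rw [hpγ]; field_simp
    _ ≤ _ := this
    _ = _ := by field_simp

end

/-! ### From integrals to sums over a shifted integer lattice -/

/-- The double sums of `c (j - l)` over squares are the sums of the symmetric partial sums. -/
theorem sum_sum_range_int_sub (c : ℤ → ℂ) (M : ℕ) :
    ∑ j ∈ Finset.range M, ∑ l ∈ Finset.range M, c ((j : ℤ) - l)
      = ∑ n ∈ Finset.range M, (∑ i ∈ Finset.range (n + 1), (c i + c (-i)) - c 0) := by
  induction M with
  | zero => simp
  | succ M ih =>
    have h1 : ∑ l ∈ Finset.range (M + 1), c ((M : ℤ) - l) = ∑ i ∈ Finset.range (M + 1), c i := by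
      rw [← Finset.sum_range_reflect]
      refine Finset.sum_congr rfl fun i hi => ?_
      have := Finset.mem_range.1 hi
      congr 1
      omega
    have h2 : ∑ j ∈ Finset.range M, c ((j : ℤ) - M) + c 0
        = ∑ i ∈ Finset.range (M + 1), c (-i) := by
      rw [← Finset.sum_range_reflect, Finset.sum_range_succ']
      congr 1
      · refine Finset.sum_congr rfl fun i hi => ?_
        have := Finset.mem_range.1 hi
        congr 1
        omega
    rw [Finset.sum_range_succ (fun n => ∑ i ∈ Finset.range (n + 1), (c i + c (-i)) - c 0), ← ih,
      Finset.sum_add_distrib, ← h1, ← h2, Finset.sum_range_succ,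
      Finset.sum_congr rfl fun j _ => Finset.sum_range_succ _ M, Finset.sum_add_distrib]
    ring

/-- Fejér's theorem for an absolutely convergent series, at the origin. -/
theorem tendsto_fejer {c : ℤ → ℂ} (hc : Summable c) :
    Filter.Tendsto (fun M : ℕ => (M : ℝ)⁻¹ •
      ∑ j ∈ Finset.range M, ∑ l ∈ Finset.range M, c ((j : ℤ) - l)) Filter.atTop
      (nhds (∑' n, c n)) := by
  have h1 := hc.hasSum.nat_add_neg.tendsto_sum_nat
  have h2 : Filter.Tendsto
      (fun n : ℕ => ∑ i ∈ Finset.range (n + 1), (c i + c (-i)) - c 0) Filter.atTop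
      (nhds (∑' n, c n)) := by
    simpa using (h1.comp (Filter.tendsto_add_atTop_nat 1)).sub_const (c 0)
  simpa only [sum_sum_range_int_sub] using h2.cesaro_smul

/-- The coefficients whose exponential sum over `0, …, M - 1` has as its squared norm the Fejér
kernel of total mass `1` per period, centred at `θ`. -/
noncomputable def fejerCoeff (M : ℕ) (θ : ℝ) (j : Fin M) : ℂ :=
  (((Real.sqrt M)⁻¹ : ℝ) : ℂ) * Complex.exp (((2 * Real.pi * j * θ : ℝ) : ℂ) * Complex.I)

theorem sum_norm_sq_fejerCoeff {M : ℕ} (hM : 0 < M) (θ : ℝ) :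
    ∑ j, ‖fejerCoeff M θ j‖ ^ 2 = 1 := by
  have hM' : (0 : ℝ) < M := by exact_mod_cast hM
  simp only [fejerCoeff, norm_mul, Complex.norm_exp_ofReal_mul_I, Complex.norm_real, mul_one,
    Real.norm_eq_abs, sq_abs, inv_pow, Real.sq_sqrt hM'.le, Finset.sum_const, Finset.card_univ,
    Fintype.card_fin, nsmul_eq_mul]
  field_simp

theorem norm_sq_expSum_fejerCoeff (M : ℕ) (θ x : ℝ) :
    ((‖expSum (fun j : Fin M => (j : ℝ)) (fejerCoeff M θ) x‖ ^ 2 : ℝ) : ℂ)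
      = (M : ℝ)⁻¹ • ∑ j ∈ Finset.range M, ∑ l ∈ Finset.range M,
        Complex.exp (((-2 * Real.pi * x * ((j : ℤ) - l : ℤ) : ℝ) : ℂ) * Complex.I)
          * fourier ((j : ℤ) - l) (θ : UnitAddCircle) := by
  have h1 : expSum (fun j : Fin M => (j : ℝ)) (fejerCoeff M θ) x
      = (((Real.sqrt M)⁻¹ : ℝ) : ℂ) * ∑ j ∈ Finset.range M,
        Complex.exp (((2 * Real.pi * j * (θ - x) : ℝ) : ℂ) * Complex.I) := by
    rw [expSum, ← Fin.sum_univ_eq_sum_range (fun j : ℕ =>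
      Complex.exp (((2 * Real.pi * j * (θ - x) : ℝ) : ℂ) * Complex.I)), Finset.mul_sum]
    refine Finset.sum_congr rfl fun j _ => ?_
    rw [fejerCoeff, mul_assoc, ← Complex.exp_add]
    congr 2
    push_cast; ring
  rw [← Complex.normSq_eq_norm_sq, ← Complex.mul_conj, h1, map_mul, mul_mul_mul_comm, map_sum,
    Finset.sum_mul_sum, Complex.conj_ofReal, ← Complex.ofReal_mul, ← mul_inv,
    Real.mul_self_sqrt (Nat.cast_nonneg M), Complex.real_smul]
  congr 1
  refine Finset.sum_congr rfl fun j _ => Finset.sum_congr rfl fun l _ => ?_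
  rw [fourier_coe_apply, ← Complex.exp_conj, ← Complex.exp_add, ← Complex.exp_add]
  congr 1
  simp only [map_mul, Complex.conj_ofReal, Complex.conj_I]
  push_cast
  ring

open SchwartzMap in
/-- Integrals against Fejér kernels tend to sums over the shifted lattice (Poisson summation). -/
theorem tendsto_integral_mul_fejer (φ : 𝓢(ℝ, ℂ)) (θ : ℝ) :
    Filter.Tendsto (fun M : ℕ => ∫ x, φ x *
      ((‖expSum (fun j : Fin M => (j : ℝ)) (fejerCoeff M θ) x‖ ^ 2 : ℝ) : ℂ)) Filter.atTop
      (nhds (∑' n : ℤ, φ (θ + n))) := by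
  have hs : Summable fun n : ℤ => 𝓕 φ n * fourier n (θ : UnitAddCircle) := by
    have h1 : Summable fun n : ℤ => 𝓕 φ (n : ℝ) := summable_of_isBigO
      (Real.summable_abs_int_rpow one_lt_two)
      (((𝓕 φ).isBigO_cocompact_rpow (-2)).comp_tendsto Int.tendsto_coe_cofinite)
    refine Summable.of_norm ?_
    have h2 : ∀ n : ℤ, ‖𝓕 φ n * fourier n (θ : UnitAddCircle)‖ = ‖𝓕 φ (n : ℝ)‖ := fun n => by
      rw [norm_mul, fourier_apply, Circle.norm_coe, mul_one]
    simpa only [h2] using h1.norm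
  rw [φ.tsum_eq_tsum_fourier θ]
  refine (tendsto_fejer hs).congr fun M => ?_
  have hi : ∀ (j l : ℕ), Integrable fun x => φ x *
      (Complex.exp (((-2 * Real.pi * x * ((j : ℤ) - l : ℤ) : ℝ) : ℂ) * Complex.I)
          * fourier ((j : ℤ) - l) (θ : UnitAddCircle)) := fun j l => by
    refine φ.integrable.mul_bdd (c := 1) (by fun_prop)
      (Filter.Eventually.of_forall fun x => ?_)
    rw [norm_mul, fourier_apply, Circle.norm_coe, mul_one, Complex.norm_exp_ofReal_mul_I]
  simp only [norm_sq_expSum_fejerCoeff, mul_smul_comm, Finset.mul_sum]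
  rw [integral_smul, integral_finsetSum _ fun j _ => integrable_finsetSum _ fun l _ => hi j l]
  congr 1
  refine Finset.sum_congr rfl fun j _ => ?_
  rw [integral_finsetSum _ fun l _ => hi j l]
  refine Finset.sum_congr rfl fun l _ => ?_
  rw [fourier_coe, Real.fourier_real_eq_integral_exp_smul, ← integral_mul_const]
  congr 1
  ext x
  rw [smul_eq_mul]
  ring

/-- The real form of `tendsto_integral_mul_fejer` for compactly supported smooth functions. -/
theorem tendsto_integral_mul_fejer_real {φ : ℝ → ℝ} (hφ : ContDiff ℝ ∞ φ)
    (hs : HasCompactSupport φ) (θ : ℝ) :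
    Filter.Tendsto (fun M : ℕ => ∫ x, φ x *
      ‖expSum (fun j : Fin M => (j : ℝ)) (fejerCoeff M θ) x‖ ^ 2) Filter.atTop
      (nhds (∑' n : ℤ, φ (θ + n))) := by
  have hs' : HasCompactSupport fun x => (φ x : ℂ) := hs.comp_left (g := ((↑) : ℝ → ℂ)) rfl
  have h := tendsto_integral_mul_fejer
    (hs'.toSchwartzMap (Complex.ofRealCLM.contDiff.comp hφ)) θ
  have h1 : (fun M : ℕ => ∫ x, (hs'.toSchwartzMap (Complex.ofRealCLM.contDiff.comp hφ)) x *
      ((‖expSum (fun j : Fin M => (j : ℝ)) (fejerCoeff M θ) x‖ ^ 2 : ℝ) : ℂ))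
      = fun M : ℕ => ((∫ x, φ x *
      ‖expSum (fun j : Fin M => (j : ℝ)) (fejerCoeff M θ) x‖ ^ 2 : ℝ) : ℂ) := by
    ext M
    rw [← integral_complex_ofReal]
    congr 1
    ext x
    rw [Complex.ofReal_mul]
    rfl
  have h2 : ∑' n : ℤ, (hs'.toSchwartzMap (Complex.ofRealCLM.contDiff.comp hφ)) (θ + n)
      = ((∑' n : ℤ, φ (θ + n) : ℝ) : ℂ) := by
    rw [Complex.ofReal_tsum]
    rfl
  rw [h1, h2] at h
  exact (Complex.continuous_re.tendsto _).comp h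

section
variable {ι : Type*} {τ : ι → ℝ}

/-- A family that is `δ`-separated modulo `1`, with all its translates by `0, …, M - 1`, is
`δ`-separated. -/
theorem separated_add_nat {δ : ℝ} (hδ : δ ≤ 1)
    (hsep : ∀ k l, k ≠ l → ∀ j : ℤ, δ ≤ |τ k - τ l + (j : ℝ)|) (M : ℕ) (p q : ι × Fin M)
    (hpq : p ≠ q) : δ ≤ |(τ p.1 + (p.2 : ℝ)) - (τ q.1 + (q.2 : ℝ))| := by
  by_cases h : p.1 = q.1
  · have h2 : (p.2 : ℕ) ≠ q.2 := fun h2 => hpq (Prod.ext h (Fin.ext h2))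
    rw [h, add_sub_add_left_eq_sub]
    refine hδ.trans ?_
    have : (1 : ℤ) ≤ |(p.2 : ℤ) - (q.2 : ℤ)| := Int.one_le_abs (by omega)
    exact_mod_cast this
  · have := hsep _ _ h ((p.2 : ℤ) - (q.2 : ℤ))
    push_cast at this
    rwa [add_sub_add_comm]

variable [Fintype ι]

/-- Frequencies `τ k + μ j` with product coefficients: the exponential sums multiply. -/
theorem expSum_prod {κ : Type*} [Fintype κ] (μ : κ → ℝ) (a : ι → ℂ) (c : κ → ℂ) (x : ℝ) :
    expSum (fun p : ι × κ => τ p.1 + μ p.2) (fun p => a p.1 * c p.2) x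
      = expSum τ a x * expSum μ c x := by
  rw [expSum, expSum, expSum, Finset.sum_mul_sum, Fintype.sum_prod_type]
  refine Finset.sum_congr rfl fun k _ => Finset.sum_congr rfl fun j _ => ?_
  rw [mul_mul_mul_comm, ← Complex.exp_add]
  congr 2
  push_cast; ring

theorem contDiff_expSum (a : ι → ℂ) : ContDiff ℝ ∞ (expSum τ a) := by
  unfold expSum
  refine ContDiff.sum fun k _ => contDiff_const.mul (ContDiff.cexp ?_)
  refine ContDiff.mul (Complex.ofRealCLM.contDiff.comp ?_) contDiff_const
  exact (contDiff_const.mul contDiff_id).neg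

theorem sum_norm_sq_mul_fejerCoeff {M : ℕ} (hM : 0 < M) (θ : ℝ) (b : ι → ℂ) :
    ∑ p : ι × Fin M, ‖b p.1 * fejerCoeff M θ p.2‖ ^ 2 = ∑ k, ‖b k‖ ^ 2 := by
  simp only [norm_mul, mul_pow, Fintype.sum_prod_type, ← Finset.mul_sum,
    sum_norm_sq_fejerCoeff hM, mul_one]

/-- The discrete form of `integral_pair_ge`, for frequencies separated modulo `1`. -/
theorem tsum_pair_ge {δ : ℝ} (hδ0 : 0 < δ) (hδ : δ ≤ 1)
    (hsep : ∀ k l, k ≠ l → ∀ j : ℤ, δ ≤ |τ k - τ l + (j : ℝ)|) (a b : ι → ℂ) {w : ℝ → ℝ}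
    (hw : ContDiff ℝ ∞ w) (hw0 : ∀ x, 0 ≤ w x) (he : ∀ x, w (-x) = w x)
    (hs : HasCompactSupport w) (h : δ⁻¹ * ∫ x, |deriv w x| ≤ 3 / 2 * ∫ x, w x) (θ : ℝ) :
    (∑ k, ‖b k‖ ^ 2) * ((∫ x, x ^ 2 * w x)
        - 2 / 3 * δ⁻¹ * ∫ x, |2 * x * w x + x ^ 2 * deriv w x|)
      ≤ ∑' n : ℤ, w (θ + n) *
        ‖expSum τ a (θ + n) + ((θ + n : ℝ) : ℂ) * expSum τ b (θ + n)‖ ^ 2 := by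
  have hφ : ContDiff ℝ ∞ fun x : ℝ => w x * ‖expSum τ a x + (x : ℂ) * expSum τ b x‖ ^ 2 :=
    hw.mul (ContDiff.norm_sq ℝ ((contDiff_expSum a).add
      (Complex.ofRealCLM.contDiff.mul (contDiff_expSum b))))
  refine ge_of_tendsto (tendsto_integral_mul_fejer_real hφ hs.mul_right θ) ?_
  filter_upwards [Filter.eventually_gt_atTop 0] with M hM
  -- the Fejér kernel is absorbed into the frequencies `τ k + j`, which are `δ`-separated on the line
  have key := integral_pair_ge hδ0 (separated_add_nat hδ hsep M)
    (fun p => a p.1 * fejerCoeff M θ p.2) (fun p => b p.1 * fejerCoeff M θ p.2)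
    (fun x => (hw.differentiable (by simp) x).hasDerivAt) (hw.continuous_deriv (by simp)) hw0 he hs h
  rw [sum_norm_sq_mul_fejerCoeff hM] at key
  refine key.trans_eq (integral_congr_ae (Filter.Eventually.of_forall fun x => ?_))
  have hp := fun u : ι → ℂ =>
    expSum_prod (τ := τ) (fun j : Fin M => (j : ℝ)) u (fejerCoeff M θ) x
  simp only [hp]
  rw [← mul_assoc, ← add_mul, norm_mul, mul_pow, mul_assoc]

/-- The discrete form of `abs_integral_norm_sq_expSum_sub_le`, for frequencies separated
modulo `1`. -/
theorem tsum_norm_sq_expSum_le {δ : ℝ} (hδ0 : 0 < δ) (hδ : δ ≤ 1)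
    (hsep : ∀ k l, k ≠ l → ∀ j : ℤ, δ ≤ |τ k - τ l + (j : ℝ)|) (b : ι → ℂ) {u : ℝ → ℝ}
    (hu : ContDiff ℝ ∞ u) (hs : HasCompactSupport u) (θ : ℝ) :
    ∑' n : ℤ, u (θ + n) * ‖expSum τ b (θ + n)‖ ^ 2
      ≤ (∑ k, ‖b k‖ ^ 2) * ((∫ x, u x) + δ⁻¹ / 2 * ∫ x, |deriv u x|) := by
  have hφ : ContDiff ℝ ∞ fun x : ℝ => u x * ‖expSum τ b x‖ ^ 2 :=
    hu.mul (ContDiff.norm_sq ℝ (contDiff_expSum b))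
  refine le_of_tendsto (tendsto_integral_mul_fejer_real hφ hs.mul_right θ) ?_
  filter_upwards [Filter.eventually_gt_atTop 0] with M hM
  have key := (abs_le.1 (abs_integral_norm_sq_expSum_sub_le hδ0 (separated_add_nat hδ hsep M)
    (fun p => b p.1 * fejerCoeff M θ p.2)
    (fun x => (hu.differentiable (by simp) x).hasDerivAt) (hu.continuous_deriv (by simp)) hs)).2
  rw [sum_norm_sq_mul_fejerCoeff hM, sub_le_iff_le_add, add_comm, ← mul_add] at key
  refine le_of_eq_of_le (integral_congr_ae (Filter.Eventually.of_forall fun x => ?_)) key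
  have hp := expSum_prod (τ := τ) (fun j : Fin M => (j : ℝ)) b (fejerCoeff M θ) x
  simp only [hp]
  rw [norm_mul, mul_pow, mul_assoc]

end

/-! ### Total variation and mollification -/

/-- The total variation of `W` is at most `V`, in terms of real numbers. -/
def VariationLE (W : ℝ → ℝ) (V : ℝ) : Prop :=
  ∀ φ : ℝ → ℝ, ContDiff ℝ ∞ φ → HasCompactSupport φ → (∀ x, |φ x| ≤ 1) →
    ∫ x, W x * deriv φ x ≤ V

theorem variationLE_toReal {W : ℝ → ℝ} (h : totalVariation W ≠ (⊤ : ℝ≥0∞)) :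
    VariationLE W (totalVariation W).toReal := by
  intro φ h1 h2 h3
  refine (ENNReal.ofReal_le_iff_le_toReal h).1 ?_
  unfold totalVariation
  exact le_iSup₂_of_le φ h1 (le_iSup₂_of_le h2 h3 le_rfl)

namespace VariationLE
variable {W : ℝ → ℝ} {V : ℝ}

theorem nonneg (h : VariationLE W V) : 0 ≤ V := by
  have := h (fun _ => 0) contDiff_const HasCompactSupport.zero (by simp)
  simpa using this

theorem integral_le (h : VariationLE W V) {φ : ℝ → ℝ} (h1 : ContDiff ℝ ∞ φ)
    (h2 : HasCompactSupport φ) {C : ℝ} (h3 : ∀ x, |φ x| ≤ C) :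
    ∫ x, W x * deriv φ x ≤ C * V := by
  have hC : 0 ≤ C := (abs_nonneg _).trans (h3 0)
  rcases hC.eq_or_lt with hC | hC
  · have : φ = fun _ => 0 := funext fun x => abs_nonpos_iff.1 (hC ▸ h3 x)
    rw [this, ← hC]
    simp
  · have := h (fun x => C⁻¹ * φ x) (contDiff_const.mul h1) h2.mul_left fun x => by
      rw [abs_mul, abs_of_pos (inv_pos.2 hC), inv_mul_le_one₀ hC]
      exact h3 x
    have hd : ∀ x, W x * deriv (fun x => C⁻¹ * φ x) x = C⁻¹ * (W x * deriv φ x) := fun x => by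
      rw [deriv_const_mul _ (h1.differentiable (by simp) x)]; ring
    simp only [hd] at this
    rw [integral_const_mul, inv_mul_le_iff₀ hC] at this
    exact this

/-- Dilations do not increase the total variation. -/
theorem comp_div (h : VariationLE W V) {s : ℝ} (hs : 0 < s) :
    VariationLE (fun x => W (x / s)) V := by
  intro φ h1 h2 h3
  have := h (fun x => φ (s * x)) (h1.comp (contDiff_const.mul contDiff_id))
    (h2.comp_homeomorph (Homeomorph.mulLeft₀ s hs.ne')) fun x => h3 _
  have hd : ∀ x, W x * deriv (fun x => φ (s * x)) x = s * (W x * deriv φ (s * x)) := fun x => by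
    have h5 := ((h1.differentiable (by simp) (s * x)).hasDerivAt.comp x
      ((hasDerivAt_id' x).const_mul s)).deriv
    simp only [Function.comp_def] at h5
    rw [h5]; ring
  simp only [hd] at this
  rw [integral_const_mul] at this
  have h6 := Measure.integral_comp_div (fun x => W x * deriv φ (s * x)) s
  simp only [mul_div_cancel₀ _ hs.ne', smul_eq_mul, abs_of_pos hs] at h6
  rw [h6]
  exact this

theorem const_mul (h : VariationLE W V) {c : ℝ} (hc : 0 ≤ c) :
    VariationLE (fun x => c * W x) (c * V) := by
  intro φ h1 h2 h3
  simp only [mul_assoc]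
  rw [integral_const_mul]
  exact mul_le_mul_of_nonneg_left (h φ h1 h2 h3) hc

/-- For smooth functions the total variation is the integral of `|u'|`. The test functions are the
smooth approximations `-u' / √(u'² + κ²)` of the sign of `-u'`. -/
theorem integral_abs_deriv_le {u : ℝ → ℝ} (h : VariationLE u V) (hu : ContDiff ℝ ∞ u)
    (hs : HasCompactSupport u) : ∫ x, |deriv u x| ≤ V := by
  obtain ⟨R, hR0, hR⟩ := exists_radius
    (fun x => (hu.differentiable (by simp) x).hasDerivAt) hs
  have hu' : ContDiff ℝ ∞ (deriv u) := (contDiff_infty_iff_deriv.1 hu).2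
  have hs' : HasCompactSupport (deriv u) := hs.deriv
  have hi : Integrable fun x => |deriv u x| :=
    (hu'.continuous.integrable_of_hasCompactSupport hs').abs
  have key : ∀ κ : ℝ, 0 < κ → ∫ x, |deriv u x| ≤ V + κ * (volume (tsupport (deriv u))).toReal := by
    intro κ hκ
    have hpos : ∀ x, 0 < deriv u x ^ 2 + κ ^ 2 := fun x => by positivity
    have hsq : ContDiff ℝ ∞ fun x => Real.sqrt (deriv u x ^ 2 + κ ^ 2) :=
      ((hu'.pow 2).add contDiff_const).sqrt fun x => (hpos x).ne'
    have hφ : ContDiff ℝ ∞ fun x => -(deriv u x / Real.sqrt (deriv u x ^ 2 + κ ^ 2)) :=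
      (hu'.div hsq fun x => (Real.sqrt_pos.2 (hpos x)).ne').neg
    have hφs : HasCompactSupport fun x => -(deriv u x / Real.sqrt (deriv u x ^ 2 + κ ^ 2)) := by
      refine hs'.mono fun x hx => ?_
      intro h0
      exact hx (by simp [h0])
    have hle : ∀ x, |deriv u x| ≤ Real.sqrt (deriv u x ^ 2 + κ ^ 2) := fun x =>
      Real.abs_le_sqrt (by nlinarith [sq_nonneg κ])
    have h1 := h _ hφ hφs fun x => by
      rw [abs_neg, abs_div, abs_of_pos (Real.sqrt_pos.2 (hpos x)),
        div_le_one (Real.sqrt_pos.2 (hpos x))]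
      exact hle x
    have hφd : ∀ x, HasDerivAt (fun x => -(deriv u x / Real.sqrt (deriv u x ^ 2 + κ ^ 2)))
        (deriv (fun x => -(deriv u x / Real.sqrt (deriv u x ^ 2 + κ ^ 2))) x) x := fun x =>
      (hφ.differentiable (by simp) x).hasDerivAt
    have i1 : Integrable fun x =>
        deriv u x * -(deriv u x / Real.sqrt (deriv u x ^ 2 + κ ^ 2)) :=
      (hu'.continuous.mul hφ.continuous).integrable_of_hasCompactSupport hs'.mul_right
    rw [integral_mul_deriv_eq_deriv_mul_of_integrable
      (fun x _ => (hu.differentiable (by simp) x).hasDerivAt) (fun x _ => hφd x)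
      ((hu.continuous.mul (hφ.continuous_deriv (by simp))).integrable_of_hasCompactSupport
        hs.mul_right) i1
      ((hu.continuous.mul hφ.continuous).integrable_of_hasCompactSupport hs.mul_right),
      ← integral_neg] at h1
    have i2 : Integrable fun x => (tsupport (deriv u)).indicator (fun _ => κ) x :=
      (integrable_indicator_iff hs'.isCompact.isClosed.measurableSet).2
        (integrableOn_const hs'.isCompact.measure_lt_top.ne)
    have h2 : ∫ x, (tsupport (deriv u)).indicator (fun _ => κ) x
        = κ * (volume (tsupport (deriv u))).toReal := by
      rw [integral_indicator hs'.isCompact.isClosed.measurableSet, setIntegral_const, smul_eq_mul,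
        mul_comm]
      rfl
    rw [← h2]
    refine le_trans ?_ (add_le_add_left h1 _)
    have i3 : Integrable fun x =>
        -(deriv u x * -(deriv u x / Real.sqrt (deriv u x ^ 2 + κ ^ 2))) := i1.neg
    rw [← integral_add i3 i2]
    refine integral_mono hi (i3.add i2) fun x => ?_
    simp only
    by_cases hx : x ∈ tsupport (deriv u)
    · rw [Set.indicator_of_mem hx]
      set S := Real.sqrt (deriv u x ^ 2 + κ ^ 2) with hS
      have hS0 : 0 < S := Real.sqrt_pos.2 (hpos x)
      have hS2 : S ^ 2 = deriv u x ^ 2 + κ ^ 2 := Real.sq_sqrt (hpos x).le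
      have hSa := hle x
      rw [← hS] at hSa
      have h5 : -(deriv u x * -(deriv u x / S)) = |deriv u x| ^ 2 / S := by
        rw [sq_abs]; ring
      -- `|t| S ≤ t² + κ S`, as `S ≤ |t| + κ` and `|t| ≤ S`
      have h6 : S ≤ |deriv u x| + κ := by
        refine abs_le_of_sq_le_sq' ?_ (by positivity) |>.2
        rw [hS2]
        nlinarith [abs_nonneg (deriv u x), sq_abs (deriv u x)]
      rw [h5, ← sub_le_iff_le_add, le_div_iff₀ hS0]
      nlinarith [abs_nonneg (deriv u x)]
    · rw [image_eq_zero_of_notMem_tsupport hx]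
      simp [Set.indicator_of_notMem hx]
  refine le_of_forall_pos_le_add fun ε hε => ?_
  set m := (volume (tsupport (deriv u))).toReal
  have hm : 0 ≤ m := ENNReal.toReal_nonneg
  refine (key (ε / (m + 1)) (by positivity)).trans ?_
  gcongr
  rw [div_mul_eq_mul_div, div_le_iff₀ (by positivity)]
  nlinarith

end VariationLE

/-- The convolution of two real functions on the line. -/
noncomputable def mollify (k W : ℝ → ℝ) : ℝ → ℝ :=
  convolution k W (ContinuousLinearMap.lsmul ℝ ℝ) volume

theorem mollify_apply (k W : ℝ → ℝ) (x : ℝ) : mollify k W x = ∫ t, k t * W (x - t) :=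
  convolution_lsmul

section
variable {k W : ℝ → ℝ} {V : ℝ}

theorem contDiff_mollify (hk : ContDiff ℝ ∞ k) (hks : HasCompactSupport k) (hW : Integrable W) :
    ContDiff ℝ ∞ (mollify k W) :=
  hks.contDiff_convolution_left _ hk hW.locallyIntegrable

theorem hasCompactSupport_mollify (hks : HasCompactSupport k) (hWs : HasCompactSupport W) :
    HasCompactSupport (mollify k W) := hks.convolution _ hWs

theorem integral_mollify (hk : Integrable k) (hW : Integrable W) :
    ∫ x, mollify k W x = (∫ x, k x) * ∫ x, W x :=
  integral_convolution _ hk hW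

theorem integral_abs_mollify_le (hk : Integrable k) (hW : Integrable W) :
    ∫ x, |mollify k W x| ≤ (∫ x, |k x|) * ∫ x, |W x| := by
  rw [← integral_mollify hk.abs hW.abs]
  refine integral_mono (hk.integrable_convolution _ hW).abs
    (hk.abs.integrable_convolution _ hW.abs) fun x => ?_
  simp only [mollify_apply]
  refine abs_integral_le_integral_abs.trans_eq ?_
  simp only [abs_mul]

theorem mollify_nonneg (hk : ∀ x, 0 ≤ k x) (hW : ∀ x, 0 ≤ W x) (x : ℝ) : 0 ≤ mollify k W x := by
  rw [mollify_apply]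
  exact integral_nonneg fun t => mul_nonneg (hk t) (hW _)

theorem mollify_neg (hk : ∀ x, k (-x) = k x) (hW : ∀ᵐ x, W (-x) = W x) (x : ℝ) :
    mollify k W (-x) = mollify k W x := by
  rw [mollify_apply, mollify_apply, ← integral_neg_eq_self]
  refine integral_congr_ae ?_
  have h : ∀ᵐ t, W (-(x - t)) = W (x - t) :=
    (quasiMeasurePreserving_sub_left_of_right_invariant volume x).ae hW
  filter_upwards [h] with t ht
  rw [hk, ← ht]
  congr 2
  ring

theorem mollify_eq_zero {r R x : ℝ} (hk : ∀ t, r ≤ |t| → k t = 0) (hW : ∀ t, R < |t| → W t = 0)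
    (hx : R + r ≤ |x|) : mollify k W x = 0 := by
  rw [mollify_apply]
  refine integral_eq_zero_of_ae (Filter.Eventually.of_forall fun t => ?_)
  simp only [Pi.zero_apply]
  rcases le_or_gt r |t| with h | h
  · rw [hk t h, zero_mul]
  · rw [hW (x - t), mul_zero]
    have := abs_sub_abs_le_abs_sub x t
    linarith

/-- Moving a convolution to the other factor of an integral. -/
theorem integral_mollify_mul {φ : ℝ → ℝ} (hk : Integrable k) (hW : Integrable W)
    (hφ : Continuous φ) (hφs : HasCompactSupport φ) :
    ∫ x, mollify k W x * φ x = ∫ x, W x * mollify (fun t => k (-t)) φ x := by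
  obtain ⟨C, hC⟩ := hφs.exists_bound_of_continuous hφ
  have i1 : Integrable (Function.uncurry fun x t => k t * W (x - t) * φ x)
      (volume.prod volume) :=
    (hk.convolution_integrand (ContinuousLinearMap.lsmul ℝ ℝ) hW).mul_bdd (c := C)
      (hφ.comp continuous_fst).aestronglyMeasurable (Filter.Eventually.of_forall fun p => hC _)
  have i2 : Integrable (Function.uncurry fun t x => k t * W x * φ (x + t))
      (volume.prod volume) :=
    (hk.mul_prod hW).mul_bdd (c := C) (by fun_prop) (Filter.Eventually.of_forall fun p => hC _)
  calc ∫ x, mollify k W x * φ x = ∫ x, ∫ t, k t * W (x - t) * φ x := by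
        simp only [mollify_apply, integral_mul_const]
    _ = ∫ t, ∫ x, k t * W (x - t) * φ x := integral_integral_swap i1
    _ = ∫ t, ∫ x, k t * W x * φ (x + t) := by
        congr 1; ext t
        rw [← integral_sub_right_eq_self (fun x => k t * W x * φ (x + t)) t]
        simp only [sub_add_cancel]
    _ = ∫ x, ∫ t, k t * W x * φ (x + t) := integral_integral_swap i2
    _ = _ := by
        congr 1; ext x
        rw [mollify_apply, ← integral_neg_eq_self fun t => k (-t) * φ (x - t),
          ← integral_const_mul]
        congr 1; ext t
        rw [neg_neg, sub_neg_eq_add]; ring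

/-- Convolution with `k` multiplies the total variation by at most `‖k‖₁`. -/
theorem VariationLE.mollify (h : VariationLE W V) (hW : Integrable W) (hk : ContDiff ℝ ∞ k)
    (hks : HasCompactSupport k) : VariationLE (mollify k W) ((∫ x, |k x|) * V) := by
  intro φ h1 h2 h3
  have hki : Integrable k := hk.continuous.integrable_of_hasCompactSupport hks
  have h1' : ContDiff ℝ ∞ (deriv φ) := (contDiff_infty_iff_deriv.1 h1).2
  have hk' : HasCompactSupport fun t => k (-t) := hks.comp_homeomorph (Homeomorph.neg ℝ)
  have hki' : Integrable fun t => k (-t) := hki.comp_neg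
  rw [integral_mollify_mul hki hW h1'.continuous h2.deriv]
  have hd : deriv (PulseSensitivity.mollify (fun t => k (-t)) φ)
      = PulseSensitivity.mollify (fun t => k (-t)) (deriv φ) := funext fun x =>
    (h2.hasDerivAt_convolution_right (ContinuousLinearMap.lsmul ℝ ℝ) hki'.locallyIntegrable
      (h1.of_le (by simp)) x).deriv
  rw [← hd]
  refine h.integral_le (h2.contDiff_convolution_right _ hki'.locallyIntegrable h1)
    (hasCompactSupport_mollify hk' h2) fun x => ?_
  change |PulseSensitivity.mollify (fun t => k (-t)) φ x| ≤ _
  rw [mollify_apply]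
  refine abs_integral_le_integral_abs.trans ?_
  rw [← integral_neg_eq_self fun x => |k x|]
  refine integral_mono_of_nonneg (Filter.Eventually.of_forall fun _ => abs_nonneg _) hki'.abs
    (Filter.Eventually.of_forall fun t => ?_)
  simp only [abs_mul]
  exact mul_le_of_le_one_right (abs_nonneg _) (h3 _)

theorem integral_abs_deriv_mollify_le (h : VariationLE W V) (hW : Integrable W)
    (hWs : HasCompactSupport W) (hk : ContDiff ℝ ∞ k) (hks : HasCompactSupport k) :
    ∫ x, |deriv (mollify k W) x| ≤ (∫ x, |k x|) * V :=
  (h.mollify hW hk hks).integral_abs_deriv_le (contDiff_mollify hk hks hW)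
    (hasCompactSupport_mollify hks hWs)

end

/-! ### Smoothing a weight of bounded variation -/

/-- A smooth even bump of total mass `1`, supported in `[-ε/4, ε/4]`. -/
noncomputable def evenBump {ε : ℝ} (hε : 0 < ε) : ContDiffBump (0 : ℝ) where
  rIn := ε / 8
  rOut := ε / 4
  rIn_pos := by positivity
  rIn_lt_rOut := by linarith

theorem evenBump_rOut {ε : ℝ} (hε : 0 < ε) : (evenBump hε).rOut = ε / 4 := rfl

/-- A smooth approximation of the weight `W`: its convolution with a narrow bump. The dilation by
`1 + ε` lets the approximation see the values of `W` at the ends of its support only from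
inside. -/
noncomputable def smoothing {ε : ℝ} (hε : 0 < ε) (W : ℝ → ℝ) : ℝ → ℝ :=
  mollify ((evenBump hε).normed volume) fun x => W (x / (1 + ε))

section
variable {ε : ℝ} (hε : 0 < ε)

local notation "η" => ContDiffBump.normed (evenBump hε) volume

theorem evenBump_eq_zero {t : ℝ} (ht : ε / 4 ≤ |t|) : η t = 0 := by
  by_contra h
  have h1 : t ∈ Function.support η := h
  rw [ContDiffBump.support_normed_eq, Metric.mem_ball, dist_zero_right, Real.norm_eq_abs,
    evenBump_rOut] at h1
  linarith

theorem contDiff_evenBump : ContDiff ℝ ∞ η := ContDiffBump.contDiff_normed _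

theorem hasCompactSupport_evenBump : HasCompactSupport η := ContDiffBump.hasCompactSupport_normed _

/-- The absolute moments of the bump. -/
theorem integral_abs_pow_mul_evenBump_le (n : ℕ) : ∫ t, |t ^ n * η t| ≤ (ε / 4) ^ n := by
  have hi : Integrable η :=
    (contDiff_evenBump hε).continuous.integrable_of_hasCompactSupport
      (hasCompactSupport_evenBump hε)
  have h1 : ∀ t, |t ^ n * η t| ≤ (ε / 4) ^ n * η t := fun t => by
    rw [abs_mul, abs_of_nonneg (ContDiffBump.nonneg_normed _ t), abs_pow]
    rcases le_or_gt (ε / 4) |t| with h | h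
    · rw [evenBump_eq_zero hε h, mul_zero, mul_zero]
    · exact mul_le_mul_of_nonneg_right (pow_le_pow_left₀ (abs_nonneg t) h.le n)
        (ContDiffBump.nonneg_normed _ t)
  calc _ ≤ ∫ t, (ε / 4) ^ n * η t := integral_mono_of_nonneg
        (Filter.Eventually.of_forall fun _ => abs_nonneg _) (hi.const_mul _)
        (Filter.Eventually.of_forall h1)
    _ = _ := by rw [integral_const_mul, ContDiffBump.integral_normed, mul_one]

variable {W : ℝ → ℝ} {B V₀ V₁ : ℝ}

theorem smoothing_nonneg (hW0 : ∀ x, 0 ≤ W x) (x : ℝ) : 0 ≤ smoothing hε W x :=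
  mollify_nonneg (fun t => ContDiffBump.nonneg_normed _ t) (fun _ => hW0 _) x

theorem smoothing_neg (he : ∀ᵐ x, W (-x) = W x) (x : ℝ) :
    smoothing hε W (-x) = smoothing hε W x := by
  refine mollify_neg (ContDiffBump.normed_neg _) ?_ x
  have hs : (1 + ε)⁻¹ ≠ 0 := by positivity
  have hq : Measure.QuasiMeasurePreserving (fun x : ℝ => (1 + ε)⁻¹ * x) volume volume :=
    ⟨measurable_const_mul _, by
      rw [Real.map_volume_mul_left hs]; exact Measure.smul_absolutelyContinuous⟩
  filter_upwards [hq.ae he] with t ht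
  rw [div_eq_inv_mul, div_eq_inv_mul, mul_neg, ht]

include hε in
theorem dilate_eq_zero (hWs : ∀ x, B < |x| → W x = 0) {x : ℝ} (hx : (1 + ε) * B < |x|) :
    W (x / (1 + ε)) = 0 := by
  refine hWs _ ?_
  rw [abs_div, abs_of_pos (show 0 < 1 + ε by positivity), lt_div_iff₀ (by positivity), mul_comm]
  exact hx

include hε in
theorem hasCompactSupport_dilate (hWs : ∀ x, B < |x| → W x = 0) :
    HasCompactSupport fun x => W (x / (1 + ε)) := by
  refine HasCompactSupport.intro (isCompact_Icc (a := -((1 + ε) * B)) (b := (1 + ε) * B))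
    fun x hx => dilate_eq_zero hε hWs ?_
  by_contra h
  exact hx (abs_le.1 (not_lt.1 h))

theorem smoothing_eq_zero (hWs : ∀ x, B < |x| → W x = 0) {x : ℝ}
    (hx : (1 + ε) * B + ε / 4 ≤ |x|) : smoothing hε W x = 0 :=
  mollify_eq_zero (fun _ h => evenBump_eq_zero hε h)
    (fun _ h => dilate_eq_zero hε hWs h) hx

include hε in
theorem integrable_dilate (hWi : Integrable W) : Integrable fun x => W (x / (1 + ε)) :=
  hWi.comp_div (by positivity)

theorem contDiff_smoothing (hWi : Integrable W) : ContDiff ℝ ∞ (smoothing hε W) :=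
  contDiff_mollify (contDiff_evenBump hε) (hasCompactSupport_evenBump hε)
    (integrable_dilate hε hWi)

theorem hasCompactSupport_smoothing (hWs : ∀ x, B < |x| → W x = 0) :
    HasCompactSupport (smoothing hε W) :=
  hasCompactSupport_mollify (hasCompactSupport_evenBump hε) (hasCompactSupport_dilate hε hWs)

theorem integral_smoothing (hWi : Integrable W) :
    ∫ x, smoothing hε W x = (1 + ε) * ∫ x, W x := by
  have hi : Integrable η :=
    (contDiff_evenBump hε).continuous.integrable_of_hasCompactSupport
      (hasCompactSupport_evenBump hε)
  rw [smoothing, integral_mollify hi (integrable_dilate hε hWi), ContDiffBump.integral_normed,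
    one_mul, Measure.integral_comp_div, smul_eq_mul, abs_of_pos (by positivity)]

theorem integral_abs_deriv_smoothing_le (hWi : Integrable W) (hWs : ∀ x, B < |x| → W x = 0)
    (hV : VariationLE W V₀) : ∫ x, |deriv (smoothing hε W) x| ≤ V₀ := by
  have h := integral_abs_deriv_mollify_le (hV.comp_div (show 0 < 1 + ε by positivity))
    (integrable_dilate hε hWi) (hasCompactSupport_dilate hε hWs) (contDiff_evenBump hε)
    (hasCompactSupport_evenBump hε)
  refine h.trans (mul_le_of_le_one_left hV.nonneg ?_)
  simpa using integral_abs_pow_mul_evenBump_le hε 0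

/-- The commutator of the convolution with a bump and the multiplication by `x²`. -/
theorem sq_mul_smoothing (hWi : Integrable W) (x : ℝ) :
    x ^ 2 * smoothing hε W x
      = mollify η (fun x => (1 + ε) ^ 2 * ((x / (1 + ε)) ^ 2 * W (x / (1 + ε)))) x
        + (2 * x * mollify (fun t => t ^ 1 * η t) (fun x => W (x / (1 + ε))) x
        - mollify (fun t => t ^ 2 * η t) (fun x => W (x / (1 + ε))) x) := by
  have hd := (integrable_dilate hε hWi).locallyIntegrable
  have hc := (contDiff_evenBump hε).continuous
  have hs := hasCompactSupport_evenBump hε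
  have i0 : ∀ n : ℕ, Integrable fun t => t ^ n * η t * W ((x - t) / (1 + ε)) := fun n =>
    HasCompactSupport.convolutionExists_left (ContinuousLinearMap.lsmul ℝ ℝ)
      (f := fun t => t ^ n * η t) hs.mul_left (by fun_prop) hd x
  have h0 : 1 + ε ≠ 0 := by positivity
  have i1 : Integrable fun t => 2 * x * (t ^ 1 * η t * W ((x - t) / (1 + ε))) := (i0 1).const_mul _
  have i2 : Integrable fun t => 2 * x * (t ^ 1 * η t * W ((x - t) / (1 + ε)))
      - t ^ 2 * η t * W ((x - t) / (1 + ε)) := i1.sub (i0 2)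
  simp only [smoothing, mollify_apply]
  rw [← integral_const_mul, ← integral_const_mul, ← integral_sub i1 (i0 2),
    ← integral_add ?_ i2]
  · congr 1; ext t
    field_simp
    ring
  · have h1 := ((i0 0).const_mul (x ^ 2)).sub i2
    refine h1.congr (Filter.Eventually.of_forall fun t => ?_)
    simp only [Pi.sub_apply]
    field_simp
    ring

/-- The integral and the total variation of the smoothed weight times `x²` are those of `x² W`, up to
the dilation and the commutators of `sq_mul_smoothing`, which are of order `ε`. -/
theorem sq_mul_smoothing_bounds (hε1 : ε ≤ 1) (hB : 0 ≤ B) (hW0 : ∀ x, 0 ≤ W x)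
    (hWi : Integrable W) (hWs : ∀ x, B < |x| → W x = 0) (hV₀ : VariationLE W V₀)
    (hV₁ : VariationLE (fun x => x ^ 2 * W x) V₁) :
    |(∫ x, x ^ 2 * smoothing hε W x) - (1 + ε) ^ 3 * ∫ x, x ^ 2 * W x|
        ≤ ε * ((4 * B + 3) * ∫ x, W x) ∧
      ∫ x, |deriv (fun x => x ^ 2 * smoothing hε W x) x|
        ≤ (1 + ε) ^ 2 * V₁ + ε * (4 * (∫ x, W x) + (4 * B + 3) * V₀) := by
  set s := 1 + ε with hs_def
  have hs0 : 0 < s := by positivity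
  have hs2 : s ≤ 2 := by linarith
  set I₀ := ∫ x, W x with hI₀
  have hI0 : 0 ≤ I₀ := integral_nonneg hW0
  have hV0 := hV₀.nonneg
  set D : ℝ → ℝ := fun x => W (x / s) with hD
  have hDi : Integrable D := integrable_dilate hε hWi
  have hDs : HasCompactSupport D := hasCompactSupport_dilate hε hWs
  have hDV : VariationLE D V₀ := hV₀.comp_div hs0
  have hDI : ∫ x, |D x| = s * I₀ := by
    have : ∀ x, |D x| = W (x / s) := fun x => abs_of_nonneg (hW0 _)
    simp only [this]
    rw [Measure.integral_comp_div, smul_eq_mul, abs_of_pos hs0]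
  have hx2i : Integrable fun x => x ^ 2 * W x := by
    refine (hWi.const_mul (B ^ 2)).mono ((by fun_prop : Continuous fun x : ℝ =>
      x ^ 2).aestronglyMeasurable.mul hWi.aestronglyMeasurable)
      (Filter.Eventually.of_forall fun x => ?_)
    rw [norm_mul, norm_mul, Real.norm_eq_abs, Real.norm_eq_abs, Real.norm_eq_abs]
    rcases lt_or_ge B |x| with h | h
    · rw [hWs x h, abs_zero, mul_zero, mul_zero]
    · refine mul_le_mul_of_nonneg_right ?_ (abs_nonneg _)
      rw [abs_pow, abs_pow]
      exact pow_le_pow_left₀ (abs_nonneg x) (h.trans (le_abs_self B)) 2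
  set Q : ℝ → ℝ := fun x => s ^ 2 * ((x / s) ^ 2 * W (x / s)) with hQ
  have hQi : Integrable Q := (hx2i.comp_div hs0.ne').const_mul _
  have hQs : HasCompactSupport Q := hDs.mono fun x hx =>
    right_ne_zero_of_mul (right_ne_zero_of_mul hx)
  have hQV : VariationLE Q (s ^ 2 * V₁) := (hV₁.comp_div hs0).const_mul (sq_nonneg s)
  have hc : ∀ n : ℕ, ContDiff ℝ ∞ fun t => t ^ n * η t := fun n =>
    (contDiff_id.pow n).mul (contDiff_evenBump hε)
  have hcs : ∀ n : ℕ, HasCompactSupport fun t => t ^ n * η t := fun n =>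
    (hasCompactSupport_evenBump hε).mul_left
  have hki : ∀ n : ℕ, Integrable fun t => t ^ n * η t := fun n =>
    (hc n).continuous.integrable_of_hasCompactSupport (hcs n)
  have hkn := integral_abs_pow_mul_evenBump_le hε
  set m : ℕ → ℝ → ℝ := fun n => mollify (fun t => t ^ n * η t) D with hm
  set v : ℝ → ℝ := mollify η Q with hv
  have hmc : ∀ n, ContDiff ℝ ∞ (m n) := fun n => contDiff_mollify (hc n) (hcs n) hDi
  have hmd : ∀ n x, HasDerivAt (m n) (deriv (m n) x) x := fun n x =>
    ((hmc n).differentiable (by simp) x).hasDerivAt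
  have hmdc : ∀ n, Continuous (deriv (m n)) := fun n => (hmc n).continuous_deriv (by simp)
  have hms : ∀ n, HasCompactSupport (m n) := fun n => hasCompactSupport_mollify (hcs n) hDs
  have hmi : ∀ n, Integrable (m n) := fun n =>
    (hmc n).continuous.integrable_of_hasCompactSupport (hms n)
  have hmdi : ∀ n, Integrable (deriv (m n)) := fun n =>
    (hmdc n).integrable_of_hasCompactSupport (hms n).deriv
  have hvc : ContDiff ℝ ∞ v :=
    contDiff_mollify (contDiff_evenBump hε) (hasCompactSupport_evenBump hε) hQi
  have hvs : HasCompactSupport v := hasCompactSupport_mollify (hasCompactSupport_evenBump hε) hQs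
  have hvd : ∀ x, HasDerivAt v (deriv v x) x := fun x =>
    (hvc.differentiable (by simp) x).hasDerivAt
  have hvi : Integrable v := hvc.continuous.integrable_of_hasCompactSupport hvs
  have hvdi : Integrable (deriv v) :=
    (hvc.continuous_deriv (by simp)).integrable_of_hasCompactSupport hvs.deriv
  have hid : (fun x => x ^ 2 * smoothing hε W x)
      = fun x => v x + (2 * x * m 1 x - m 2 x) := funext fun x => sq_mul_smoothing hε hWi x
  -- the supports lie in `[-R, R]`
  set R := 2 * B + 1 with hR
  have hmz : ∀ n x, R ≤ |x| → m n x = 0 := fun n x hx => by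
    refine mollify_eq_zero (r := ε / 4) (R := s * B) (fun t ht => ?_)
      (fun t ht => dilate_eq_zero hε hWs ht) ?_
    · rw [evenBump_eq_zero hε ht, mul_zero]
    · nlinarith
  have hmdz : ∀ n x, R < |x| → deriv (m n) x = 0 := fun n x hx => by
    have h1 : m n =ᶠ[nhds x] fun _ => 0 := by
      filter_upwards [(isOpen_lt continuous_const continuous_abs).mem_nhds hx] with y hy
      exact hmz n y (le_of_lt hy)
    rw [h1.deriv_eq, deriv_const]
  have hm1 : ∀ n, ∫ x, |m n x| ≤ (ε / 4) ^ n * (s * I₀) := fun n =>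
    (integral_abs_mollify_le (hki n) hDi).trans (by
      rw [hDI]; exact mul_le_mul_of_nonneg_right (hkn n) (by positivity))
  have hm2 : ∀ n, ∫ x, |deriv (m n) x| ≤ (ε / 4) ^ n * V₀ := fun n =>
    (integral_abs_deriv_mollify_le hDV hDi hDs (hc n) (hcs n)).trans
      (mul_le_mul_of_nonneg_right (hkn n) hV0)
  have hxm : ∀ x, |2 * x * m 1 x| ≤ 2 * R * |m 1 x| := fun x => by
    rw [abs_mul, abs_mul, abs_two]
    rcases le_or_gt R |x| with h | h
    · rw [hmz 1 x h, abs_zero, mul_zero, mul_zero]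
    · gcongr
  have hxmd : ∀ x, |2 * x * deriv (m 1) x| ≤ 2 * R * |deriv (m 1) x| := fun x => by
    rw [abs_mul, abs_mul, abs_two]
    rcases lt_or_ge R |x| with h | h
    · rw [hmdz 1 x h, abs_zero, mul_zero, mul_zero]
    · gcongr
  have hsq : ε ^ 2 ≤ ε := by nlinarith
  have hR0 : 0 ≤ R := by positivity
  constructor
  · have hxmi : Integrable fun x => 2 * x * m 1 x :=
      (by fun_prop (disch := exact (hmc 1).continuous) : Continuous fun x => 2 * x * m 1 x)
        |>.integrable_of_hasCompactSupport (hms 1).mul_left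
    have hvI : ∫ x, v x = s ^ 3 * ∫ x, x ^ 2 * W x := by
      rw [hv, integral_mollify (by simpa using hki 0) hQi, ContDiffBump.integral_normed, one_mul,
        hQ, integral_const_mul, Measure.integral_comp_div (fun x => x ^ 2 * W x), smul_eq_mul,
        abs_of_pos hs0]
      ring
    have hxmi' : Integrable fun x => 2 * x * m 1 x - m 2 x := hxmi.sub (hmi 2)
    rw [hid, integral_add hvi hxmi', hvI, add_sub_cancel_left,
      integral_sub hxmi (hmi 2)]
    have h1 : |∫ x, 2 * x * m 1 x| ≤ 2 * R * ∫ x, |m 1 x| := by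
      rw [← integral_const_mul]
      exact abs_integral_le_integral_abs.trans
        (integral_mono hxmi.abs ((hmi 1).abs.const_mul _) hxm)
    have h2 : |∫ x, m 2 x| ≤ ∫ x, |m 2 x| := abs_integral_le_integral_abs
    have h3 := hm1 1
    have h4 := hm1 2
    have h5 := abs_sub (∫ x, 2 * x * m 1 x) (∫ x, m 2 x)
    have h6 : s * I₀ ≤ 2 * I₀ := mul_le_mul_of_nonneg_right hs2 hI0
    calc _ ≤ 2 * R * ((ε / 4) ^ 1 * (s * I₀)) + (ε / 4) ^ 2 * (s * I₀) := by
          refine h5.trans (add_le_add (h1.trans ?_) (h2.trans h4))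
          gcongr
      _ ≤ 2 * R * ((ε / 4) ^ 1 * (2 * I₀)) + (ε / 4) ^ 2 * (2 * I₀) := by gcongr
      _ ≤ _ := by
          rw [hR]
          nlinarith [mul_nonneg (sub_nonneg.2 hsq) hI0, mul_nonneg hε.le hI0]
  · have hder : deriv (fun x => x ^ 2 * smoothing hε W x)
        = fun x => deriv v x + (2 * m 1 x + 2 * x * deriv (m 1) x - deriv (m 2) x) := by
      rw [hid]
      ext x
      have h1 := (hvd x).add ((((hasDerivAt_id' x).const_mul 2).mul (hmd 1 x)).sub (hmd 2 x))
      refine (h1.congr_deriv ?_).deriv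
      ring
    rw [hder]
    have h3 := hm1 1
    have h4 := hm2 1
    have h5 := hm2 2
    have h6 : ∫ x, |deriv v x| ≤ s ^ 2 * V₁ := by
      refine (integral_abs_deriv_mollify_le hQV hQi hQs (contDiff_evenBump hε)
        (hasCompactSupport_evenBump hε)).trans (mul_le_of_le_one_left hQV.nonneg ?_)
      simpa using hkn 0
    have h7 : s * I₀ ≤ 2 * I₀ := mul_le_mul_of_nonneg_right hs2 hI0
    have j1 : Integrable fun x => 2 * |m 1 x| := (hmi 1).abs.const_mul _
    have j2 : Integrable fun x => 2 * R * |deriv (m 1) x| := (hmdi 1).abs.const_mul _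
    have j3 : Integrable fun x => 2 * |m 1 x| + 2 * R * |deriv (m 1) x| := j1.add j2
    have j4 : Integrable fun x => 2 * |m 1 x| + 2 * R * |deriv (m 1) x| + |deriv (m 2) x| :=
      j3.add (hmdi 2).abs
    calc _ ≤ ∫ x, (|deriv v x| + (2 * |m 1 x| + 2 * R * |deriv (m 1) x| + |deriv (m 2) x|)) := by
          refine integral_mono_of_nonneg (Filter.Eventually.of_forall fun _ => abs_nonneg _)
            (hvdi.abs.add j4) (Filter.Eventually.of_forall fun x => ?_)
          simp only
          refine (abs_add_le _ _).trans (add_le_add le_rfl ((abs_sub _ _).trans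
            (add_le_add ((abs_add_le _ _).trans (add_le_add ?_ (hxmd x))) le_rfl)))
          rw [abs_mul, abs_two]
      _ = (∫ x, |deriv v x|) + ((2 * ∫ x, |m 1 x|) + (2 * R * ∫ x, |deriv (m 1) x|)
          + ∫ x, |deriv (m 2) x|) := by
          rw [integral_add hvdi.abs j4, integral_add j3 (hmdi 2).abs, integral_add j1 j2,
            integral_const_mul, integral_const_mul]
      _ ≤ s ^ 2 * V₁ + (2 * ((ε / 4) ^ 1 * (2 * I₀)) + 2 * R * ((ε / 4) ^ 1 * V₀)
          + (ε / 4) ^ 2 * V₀) := by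
          have h8 : (ε / 4) ^ 1 * (s * I₀) ≤ (ε / 4) ^ 1 * (2 * I₀) := by gcongr
          have h9 := h3.trans h8
          gcongr
      _ ≤ _ := by
          rw [hR]
          nlinarith [mul_nonneg (sub_nonneg.2 hsq) hV0, mul_nonneg hε.le hI0,
            mul_nonneg hε.le hV0, mul_nonneg (mul_nonneg hε.le hB) hV0]

end

/-! ### Sums over the sampling frequencies -/

section
variable {W : ℝ → ℝ} {B V₀ V₁ : ℝ}

/-- The widths of the bumps in the sequence of approximations. -/
noncomputable def bumpWidth (n : ℕ) : ℝ := 1 / ((n : ℝ) + 1)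

theorem bumpWidth_pos (n : ℕ) : 0 < bumpWidth n := Nat.one_div_pos_of_nat

theorem bumpWidth_le_one (n : ℕ) : bumpWidth n ≤ 1 := by
  rw [bumpWidth, div_le_one (by positivity)]
  linarith [Nat.cast_nonneg (α := ℝ) n]

theorem tendsto_bumpWidth : Filter.Tendsto bumpWidth Filter.atTop (nhds 0) :=
  tendsto_one_div_add_atTop_nhds_zero_nat

/-- Pointwise convergence at every point where `W` is continuous from inside `[-B, B]`: since
`ε / 4 ≤ ε B`, the smoothed weight at `y` only sees values of `W` in `[-B, B]`. -/
theorem tendsto_smoothing (hB : 1 / 4 ≤ B) (hWi : Integrable W) {y : ℝ} (hy : |y| ≤ B)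
    (hc : ContinuousWithinAt W (Set.Icc (-B) B) y) :
    Filter.Tendsto (fun n => smoothing (bumpWidth_pos n) W y) Filter.atTop (nhds (W y)) := by
  rw [Metric.tendsto_atTop']
  intro κ hκ
  obtain ⟨d, hd, hd'⟩ := Metric.continuousWithinAt_iff.1 hc (κ / 4) (by positivity)
  have h1 : ∀ᶠ n in Filter.atTop, bumpWidth n < d / (B + 1) :=
    tendsto_bumpWidth.eventually_lt_const (by positivity)
  obtain ⟨n₀, hn₀⟩ := Filter.eventually_atTop.1 h1
  refine ⟨n₀, fun n hn => ?_⟩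
  have hε := bumpWidth_pos n
  have hlt := (lt_div_iff₀ (by positivity)).1 (hn₀ n hn.le)
  set ε := bumpWidth n
  have hs : 0 < 1 + ε := by positivity
  have hin : ∀ x, |x - y| < ε / 4 → dist (W (x / (1 + ε))) (W y) < κ / 4 := by
    intro x hx
    have hx1 : |x| ≤ B + ε / 4 := by
      have := abs_sub_abs_le_abs_sub x y
      linarith
    refine hd' (abs_le.1 ?_) ?_
    · rw [abs_div, abs_of_pos hs, div_le_iff₀ hs]
      nlinarith
    · have h2 : x / (1 + ε) - y = (x - y - ε * y) / (1 + ε) := by field_simp; ring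
      have h3 : |x - y - ε * y| ≤ ε / 4 + ε * B := by
        refine (abs_sub _ _).trans (add_le_add hx.le ?_)
        rw [abs_mul, abs_of_pos hε]
        exact mul_le_mul_of_nonneg_left hy hε.le
      rw [Real.dist_eq, h2, abs_div, abs_of_pos hs, div_lt_iff₀ hs]
      nlinarith
  have h2 : dist (smoothing (bumpWidth_pos n) W y) (W (y / (1 + ε))) ≤ κ / 2 := by
    refine ContDiffBump.dist_normed_convolution_le (φ := evenBump (bumpWidth_pos n))
      (g := fun x => W (x / (1 + ε)))
      (integrable_dilate hε hWi).aestronglyMeasurable fun x hx => ?_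
    rw [Metric.mem_ball, evenBump_rOut, Real.dist_eq] at hx
    have h3 := dist_triangle_right (W (x / (1 + ε))) (W (y / (1 + ε))) (W y)
    have h4 := hin x hx
    have h5 := hin y (by rw [sub_self, abs_zero]; positivity)
    linarith
  have h3 := dist_triangle (smoothing (bumpWidth_pos n) W y) (W (y / (1 + ε))) (W y)
  have h5 := hin y (by rw [sub_self, abs_zero]; positivity)
  linarith

theorem freq_eq (N : ℕ) (i : Fin N) : freq N i = -(((N : ℝ) - 1) / 2) + ((i : ℤ) : ℝ) := by
  rw [freq]; push_cast; ring

theorem abs_freq_le (N : ℕ) (i : Fin N) : |freq N i| ≤ ((N : ℝ) - 1) / 2 := by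
  have h : ((i : ℕ) : ℝ) + 1 ≤ N := by exact_mod_cast i.2
  have h0 : (0 : ℝ) ≤ (i : ℕ) := Nat.cast_nonneg _
  rw [freq, abs_le]
  constructor <;> linarith

/-- A sum over the shifted integers reduces to the sampling frequencies if the terms vanish outside
the band. -/
theorem tsum_shifted_eq_sum_freq (N : ℕ) {ψ : ℝ → ℝ}
    (h : ∀ x, ((N : ℝ) - 1) / 2 + 1 ≤ |x| → ψ x = 0) :
    ∑' n : ℤ, ψ (-(((N : ℝ) - 1) / 2) + n) = ∑ i : Fin N, ψ (freq N i) := by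
  have hinj : Function.Injective fun i : Fin N => ((i : ℕ) : ℤ) := fun i j hij =>
    Fin.ext (Int.natCast_inj.1 hij)
  rw [tsum_eq_sum (s := Finset.univ.map ⟨_, hinj⟩), Finset.sum_map]
  · exact Finset.sum_congr rfl fun i _ => by rw [freq_eq]; rfl
  · intro n hn
    refine h _ ?_
    rcases lt_or_ge n 0 with h0 | h0
    · have : (n : ℝ) ≤ -1 := by exact_mod_cast Int.le_sub_one_of_lt h0
      refine le_trans ?_ (neg_le_abs _)
      linarith
    · rcases lt_or_ge n N with h1 | h1
      · exact absurd (Finset.mem_map.2 ⟨⟨n.toNat, by omega⟩, Finset.mem_univ _, by simp [h0]⟩) hn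
      · have : (N : ℝ) ≤ n := by exact_mod_cast h1
        refine le_trans ?_ (le_abs_self _)
        linarith

variable {ι : Type*} [Fintype ι] {τ : ι → ℝ} {δ : ℝ} {N : ℕ}

/-- The smoothed weights vanish at the points of the shifted lattice outside the band. -/
theorem eventually_smoothing_eq_zero (hB : 0 ≤ B) (hWs : ∀ x, B < |x| → W x = 0) :
    ∀ᶠ n in Filter.atTop, ∀ x, B + 1 ≤ |x| → smoothing (bumpWidth_pos n) W x = 0 := by
  filter_upwards [tendsto_bumpWidth.eventually_lt_const (show 0 < 1 / (B + 1) by positivity)]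
    with n hn x hx
  rw [lt_div_iff₀ (by positivity)] at hn
  refine smoothing_eq_zero _ hWs (le_trans ?_ hx)
  nlinarith [bumpWidth_pos n]

/-- The lower bound for pairs of exponential sums, sampled at the frequencies `f_i` with the weights
`W (f_i)`, for a weight `W` of bounded variation. -/
theorem sum_freq_pair_ge (hN : 2 ≤ N) (hδ0 : 0 < δ) (hδ : δ ≤ 1)
    (hsep : ∀ k l, k ≠ l → ∀ j : ℤ, δ ≤ |τ k - τ l + (j : ℝ)|)
    (hW0 : ∀ x, 0 ≤ W x) (hWi : Integrable W) (hWs : ∀ x, x ∉ band N → W x = 0)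
    (he : ∀ᵐ x, W (-x) = W x) (hV₀ : VariationLE W V₀)
    (hV₁ : VariationLE (fun x => x ^ 2 * W x) V₁)
    (hc : ∀ i, ContinuousWithinAt W (band N) (freq N i))
    (h : δ⁻¹ * V₀ ≤ 3 / 2 * ∫ x, W x) (a b : ι → ℂ) :
    (∑ k, ‖b k‖ ^ 2) * ((∫ x, x ^ 2 * W x) - 2 / 3 * δ⁻¹ * V₁)
      ≤ ∑ i, W (freq N i) * ‖expSum τ a (freq N i)
        + (freq N i : ℂ) * expSum τ b (freq N i)‖ ^ 2 := by
  set B : ℝ := ((N : ℝ) - 1) / 2 with hBdef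
  have hN' : (2 : ℝ) ≤ N := by exact_mod_cast hN
  have hB : 1 / 4 ≤ B := by rw [hBdef]; linarith
  have hB0 : 0 ≤ B := by linarith
  have hWs' : ∀ x, B < |x| → W x = 0 := fun x hx => hWs x fun hm =>
    absurd (abs_le.2 hm) (not_le.2 hx)
  have hI0 : 0 ≤ ∫ x, W x := integral_nonneg hW0
  have hb0 : 0 ≤ ∑ k, ‖b k‖ ^ 2 := Finset.sum_nonneg fun _ _ => sq_nonneg _
  set I₀ := ∫ x, W x
  set I₂ := ∫ x, x ^ 2 * W x
  have hlim : Filter.Tendsto (fun n => (∑ k, ‖b k‖ ^ 2) *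
      (((1 + bumpWidth n) ^ 3 * I₂ - bumpWidth n * ((4 * B + 3) * I₀)) - 2 / 3 * δ⁻¹ *
        ((1 + bumpWidth n) ^ 2 * V₁ + bumpWidth n * (4 * I₀ + (4 * B + 3) * V₀))))
      Filter.atTop (nhds ((∑ k, ‖b k‖ ^ 2) * (I₂ - 2 / 3 * δ⁻¹ * V₁))) := by
    refine (Continuous.tendsto' (f := fun ε : ℝ => (∑ k, ‖b k‖ ^ 2) *
      (((1 + ε) ^ 3 * I₂ - ε * ((4 * B + 3) * I₀)) - 2 / 3 * δ⁻¹ *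
        ((1 + ε) ^ 2 * V₁ + ε * (4 * I₀ + (4 * B + 3) * V₀)))) (by fun_prop) 0 _ ?_).comp
      tendsto_bumpWidth
    simp
  have hlim' : Filter.Tendsto (fun n => ∑ i, smoothing (bumpWidth_pos n) W (freq N i) *
      ‖expSum τ a (freq N i) + (freq N i : ℂ) * expSum τ b (freq N i)‖ ^ 2) Filter.atTop
      (nhds (∑ i, W (freq N i) * ‖expSum τ a (freq N i)
        + (freq N i : ℂ) * expSum τ b (freq N i)‖ ^ 2)) :=
    tendsto_finsetSum _ fun i _ =>
      (tendsto_smoothing hB hWi (abs_freq_le N i) (hc i)).mul_const _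
  -- apply `tsum_pair_ge` to the smoothed weights and let their widths tend to `0`
  refine le_of_tendsto_of_tendsto hlim hlim' ?_
  filter_upwards [eventually_smoothing_eq_zero hB0 hWs'] with n hn
  have hε := bumpWidth_pos n
  have hε1 := bumpWidth_le_one n
  have hb := sq_mul_smoothing_bounds hε hε1 hB0 hW0 hWi hWs' hV₀ hV₁
  have hw := contDiff_smoothing hε hWi
  have key := tsum_pair_ge hδ0 hδ hsep a b hw (smoothing_nonneg hε hW0) (smoothing_neg hε he)
    (hasCompactSupport_smoothing hε hWs') (by
      rw [integral_smoothing hε hWi]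
      have h1 := mul_le_mul_of_nonneg_left (integral_abs_deriv_smoothing_le hε hWi hWs' hV₀)
        (inv_pos.2 hδ0).le
      nlinarith) (-B)
  rw [tsum_shifted_eq_sum_freq N (ψ := fun x => smoothing hε W x *
    ‖expSum τ a x + (x : ℂ) * expSum τ b x‖ ^ 2) fun x hx => by rw [hn x hx, zero_mul]] at key
  refine le_trans (mul_le_mul_of_nonneg_left (sub_le_sub ?_ ?_) hb0) key
  · linarith [(abs_le.1 hb.1).1]
  · refine mul_le_mul_of_nonneg_left (le_trans (le_of_eq ?_) hb.2) (by positivity)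
    congr 1; ext x
    have h1 := ((hasDerivAt_id' x).pow 2).mul (hw.differentiable (by simp) x).hasDerivAt
    have h2 : deriv (fun x => x ^ 2 * smoothing hε W x) x
        = 2 * x * smoothing hε W x + x ^ 2 * deriv (smoothing hε W) x := by
      refine (h1.congr_deriv ?_).deriv
      simp
    rw [h2]

/-- The upper bound for the second term of the pair alone. -/
theorem sum_freq_norm_sq_expSum_le (hN : 2 ≤ N) (hδ0 : 0 < δ) (hδ : δ ≤ 1)
    (hsep : ∀ k l, k ≠ l → ∀ j : ℤ, δ ≤ |τ k - τ l + (j : ℝ)|)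
    (hW0 : ∀ x, 0 ≤ W x) (hWi : Integrable W) (hWs : ∀ x, x ∉ band N → W x = 0)
    (hV₀ : VariationLE W V₀) (hV₁ : VariationLE (fun x => x ^ 2 * W x) V₁)
    (hc : ∀ i, ContinuousWithinAt W (band N) (freq N i)) (b : ι → ℂ) :
    ∑ i, W (freq N i) * (freq N i ^ 2 * ‖expSum τ b (freq N i)‖ ^ 2)
      ≤ (∑ k, ‖b k‖ ^ 2) * ((∫ x, x ^ 2 * W x) + δ⁻¹ / 2 * V₁) := by
  set B : ℝ := ((N : ℝ) - 1) / 2 with hBdef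
  have hN' : (2 : ℝ) ≤ N := by exact_mod_cast hN
  have hB : 1 / 4 ≤ B := by rw [hBdef]; linarith
  have hB0 : 0 ≤ B := by linarith
  have hWs' : ∀ x, B < |x| → W x = 0 := fun x hx => hWs x fun hm =>
    absurd (abs_le.2 hm) (not_le.2 hx)
  have hb0 : 0 ≤ ∑ k, ‖b k‖ ^ 2 := Finset.sum_nonneg fun _ _ => sq_nonneg _
  set I₀ := ∫ x, W x
  set I₂ := ∫ x, x ^ 2 * W x
  have hlim : Filter.Tendsto (fun n => (∑ k, ‖b k‖ ^ 2) *
      (((1 + bumpWidth n) ^ 3 * I₂ + bumpWidth n * ((4 * B + 3) * I₀)) + δ⁻¹ / 2 *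
        ((1 + bumpWidth n) ^ 2 * V₁ + bumpWidth n * (4 * I₀ + (4 * B + 3) * V₀))))
      Filter.atTop (nhds ((∑ k, ‖b k‖ ^ 2) * (I₂ + δ⁻¹ / 2 * V₁))) := by
    refine (Continuous.tendsto' (f := fun ε : ℝ => (∑ k, ‖b k‖ ^ 2) *
      (((1 + ε) ^ 3 * I₂ + ε * ((4 * B + 3) * I₀)) + δ⁻¹ / 2 *
        ((1 + ε) ^ 2 * V₁ + ε * (4 * I₀ + (4 * B + 3) * V₀)))) (by fun_prop) 0 _ ?_).comp
      tendsto_bumpWidth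
    simp
  have hlim' : Filter.Tendsto (fun n => ∑ i, smoothing (bumpWidth_pos n) W (freq N i) *
      (freq N i ^ 2 * ‖expSum τ b (freq N i)‖ ^ 2)) Filter.atTop
      (nhds (∑ i, W (freq N i) * (freq N i ^ 2 * ‖expSum τ b (freq N i)‖ ^ 2))) :=
    tendsto_finsetSum _ fun i _ =>
      (tendsto_smoothing hB hWi (abs_freq_le N i) (hc i)).mul_const _
  refine le_of_tendsto_of_tendsto hlim' hlim ?_
  filter_upwards [eventually_smoothing_eq_zero hB0 hWs'] with n hn
  have hε := bumpWidth_pos n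
  have hε1 := bumpWidth_le_one n
  have hb := sq_mul_smoothing_bounds hε hε1 hB0 hW0 hWi hWs' hV₀ hV₁
  have hw := contDiff_smoothing hε hWi
  have key := tsum_norm_sq_expSum_le hδ0 hδ hsep b
    (u := fun x => x ^ 2 * smoothing hε W x) ((contDiff_id.pow 2).mul hw)
    (hasCompactSupport_smoothing hε hWs').mul_left (-B)
  rw [tsum_shifted_eq_sum_freq N (ψ := fun x => x ^ 2 * smoothing hε W x *
    ‖expSum τ b x‖ ^ 2) fun x hx => by rw [hn x hx, mul_zero, zero_mul]] at key
  refine le_of_eq_of_le (Finset.sum_congr rfl fun i _ => by ring) (key.trans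
    (mul_le_mul_of_nonneg_left (add_le_add ?_ ?_) hb0))
  · linarith [(abs_le.1 hb.1).2]
  · exact mul_le_mul_of_nonneg_left hb.2 (by positivity)

end

/-! ### The Fourier transform of a real function and of its derivative -/

section
open SchwartzMap

/-- A smooth compactly supported real function as a complex Schwartz function. -/
noncomputable def testFunction {φ : ℝ → ℝ} (hφ : ContDiff ℝ ∞ φ) (hs : HasCompactSupport φ) :
    𝓢(ℝ, ℂ) :=
  (show HasCompactSupport fun x => (φ x : ℂ) from
    hs.comp_left (g := ((↑) : ℝ → ℂ)) rfl).toSchwartzMap (Complex.ofRealCLM.contDiff.comp hφ)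

theorem testFunction_apply {φ : ℝ → ℝ} (hφ : ContDiff ℝ ∞ φ) (hs : HasCompactSupport φ) (x : ℝ) :
    testFunction hφ hs x = φ x := rfl

/-- The Fourier transform can be moved to a Schwartz function. -/
theorem integral_mul_fourierL2 {u : ℝ → ℝ} (hu : MemLp u 2 volume) (φ : 𝓢(ℝ, ℂ)) :
    ∫ x, φ x * fourierL2 u hu x = ∫ x, 𝓕 φ x * (u x : ℂ) := by
  have h := congrArg (fun T : 𝓢'(ℝ, ℂ) => T φ) (Lp.fourier_toTemperedDistribution_eq
    ((hu.ofReal (K := ℂ)).toLp (fun t => (u t : ℂ))))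
  simp only [TemperedDistribution.fourier_apply, Lp.toTemperedDistribution_apply,
    smul_eq_mul] at h
  rw [fourierL2, ← h]
  refine integral_congr_ae ?_
  filter_upwards [(hu.ofReal (K := ℂ)).coeFn_toLp] with x hx
  exact congrArg (𝓕 φ x * ·) hx

theorem locallyIntegrable_fourierL2 {u : ℝ → ℝ} (hu : MemLp u 2 volume) :
    LocallyIntegrable (fourierL2 u hu) :=
  (Lp.memLp _).locallyIntegrable one_le_two

/-- The Fourier transform turns the derivative into the multiplication by `2 π i f`. -/
theorem fourierL2_deriv {g : ℝ → ℝ} (hg : MemLp g 2 volume) (hdiff : Differentiable ℝ g)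
    (hg' : MemLp (deriv g) 2 volume) :
    ∀ᵐ f, fourierL2 (deriv g) hg' f = 2 * Real.pi * Complex.I * f * fourierL2 g hg f := by
  refine ae_eq_of_integral_contDiff_smul_eq (locallyIntegrable_fourierL2 hg') ?_
    fun φ hφ hs => ?_
  · exact (locallyIntegrable_fourierL2 hg).continuous_mul
      (g := fun f : ℝ => 2 * Real.pi * Complex.I * (f : ℂ)) (by fun_prop)
  set c : ℂ := -2 * Real.pi * Complex.I with hc
  set Φ := testFunction hφ hs with hΦ
  set Ψ := testFunction (φ := fun x => x * φ x) (contDiff_id.mul hφ) hs.mul_left with hΨ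
  have hΨΦ : ∀ x, Ψ x = x * Φ x := fun x => by
    rw [hΨ, hΦ, testFunction_apply, testFunction_apply, Complex.ofReal_mul]
  have hder : ∀ w, HasDerivAt (𝓕 (Φ : ℝ → ℂ)) (c * 𝓕 (Ψ : ℝ → ℂ) w) w := fun w => by
    have h := Real.hasDerivAt_fourier (f := Φ) Φ.integrable
      (Ψ.integrable.congr (Filter.Eventually.of_forall fun x => by
        simp only [hΨΦ, Complex.real_smul])) w
    refine h.congr_deriv ?_
    rw [Real.fourier_real_eq_integral_exp_smul, Real.fourier_real_eq_integral_exp_smul,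
      ← integral_const_mul]
    congr 1; ext x
    rw [hΨΦ, smul_eq_mul, smul_eq_mul, smul_eq_mul, hc]
    ring
  have hgd : ∀ x, HasDerivAt (fun x => (g x : ℂ)) ((deriv g x : ℝ) : ℂ) x := fun x =>
    (hdiff x).hasDerivAt.ofReal_comp
  have hΦ2 : MemLp (𝓕 (Φ : ℝ → ℂ)) 2 volume := by
    rw [← fourier_coe]; exact (𝓕 Φ).memLp 2
  have hΨ2 : MemLp (𝓕 (Ψ : ℝ → ℂ)) 2 volume := by
    rw [← fourier_coe]; exact (𝓕 Ψ).memLp 2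
  have hparts := integral_mul_deriv_eq_deriv_mul_of_integrable
    (fun x _ => hder x) (fun x _ => hgd x) (hΦ2.integrable_mul hg'.ofReal)
    ((hΨ2.const_mul c).integrable_mul hg.ofReal) (hΦ2.integrable_mul hg.ofReal)
  calc ∫ x, φ x • fourierL2 (deriv g) hg' x = ∫ x, Φ x * fourierL2 (deriv g) hg' x := by
        simp only [Complex.real_smul]; rfl
    _ = ∫ x, 𝓕 (Φ : ℝ → ℂ) x * ((deriv g x : ℝ) : ℂ) := integral_mul_fourierL2 hg' Φ
    _ = -(c * ∫ x, 𝓕 (Ψ : ℝ → ℂ) x * (g x : ℂ)) := by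
        rw [hparts, ← integral_const_mul]
        simp only [mul_assoc]
    _ = -(c * ∫ x, Ψ x * fourierL2 g hg x) := by
        rw [integral_mul_fourierL2 hg Ψ]; rfl
    _ = _ := by
        rw [← integral_const_mul, ← integral_neg]
        congr 1; ext x
        rw [hΨΦ, hΦ, testFunction_apply, Complex.real_smul, hc]
        ring

/-- The modulus of the Fourier transform of a real function is even. -/
theorem norm_fourierL2_neg {g : ℝ → ℝ} (hg : MemLp g 2 volume) :
    ∀ᵐ f, ‖fourierL2 g hg (-f)‖ = ‖fourierL2 g hg f‖ := by
  have hneg := Measure.measurePreserving_neg (volume : Measure ℝ)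
  have h : ∀ᵐ f, (starRingEnd ℂ) (fourierL2 g hg (-f)) = fourierL2 g hg f := by
    refine ae_eq_of_integral_contDiff_smul_eq ?_ (locallyIntegrable_fourierL2 hg)
      fun φ hφ hs => ?_
    · have h1 : MemLp (fun f => fourierL2 g hg (-f)) 2 volume :=
        (Lp.memLp (fourierL2 g hg)).comp_measurePreserving hneg
      exact h1.star.locallyIntegrable one_le_two
    have hφ' : ContDiff ℝ ∞ fun x => φ (-x) := hφ.comp contDiff_neg
    have hs' : HasCompactSupport fun x => φ (-x) := hs.comp_homeomorph (Homeomorph.neg ℝ)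
    set Φ := testFunction hφ hs with hΦ
    set Ψ := testFunction hφ' hs' with hΨ
    have hΨΦ : ∀ x, Ψ x = Φ (-x) := fun x => rfl
    have hΦr : ∀ x, (starRingEnd ℂ) (Φ x) = Φ x := fun x => Complex.conj_ofReal _
    have hF : ∀ t, (starRingEnd ℂ) (𝓕 (Ψ : ℝ → ℂ) t) = 𝓕 (Φ : ℝ → ℂ) t := fun t => by
      rw [Real.fourier_real_eq_integral_exp_smul, Real.fourier_real_eq_integral_exp_smul,
        ← integral_conj, ← integral_neg_eq_self]
      congr 1; ext x
      rw [hΨΦ, neg_neg, smul_eq_mul, smul_eq_mul, map_mul, hΦr, ← Complex.exp_conj, map_mul,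
        Complex.conj_ofReal, Complex.conj_I]
      congr 2
      push_cast; ring
    calc ∫ x, φ x • (starRingEnd ℂ) (fourierL2 g hg (-x))
        = (starRingEnd ℂ) (∫ x, Ψ x * fourierL2 g hg x) := by
          rw [← integral_conj, ← integral_neg_eq_self]
          congr 1; ext x
          rw [neg_neg, map_mul, hΨΦ, hΦr, Complex.real_smul]
          rfl
      _ = (starRingEnd ℂ) (∫ x, 𝓕 (Ψ : ℝ → ℂ) x * (g x : ℂ)) := by
          rw [integral_mul_fourierL2 hg Ψ]; rfl
      _ = ∫ x, 𝓕 (Φ : ℝ → ℂ) x * (g x : ℂ) := by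
          rw [← integral_conj]
          simp only [map_mul, hF, Complex.conj_ofReal]
      _ = ∫ x, Φ x * fourierL2 g hg x := (integral_mul_fourierL2 hg Φ).symm
      _ = _ := by simp only [Complex.real_smul]; rfl
  filter_upwards [h] with f hf
  rw [← hf, RCLike.norm_conj]

end

/-! ### The quadratic form of the Schur complement -/

section
variable {K N : ℕ}

open scoped InnerProductSpace

/-- The spectral norm of a Hermitian matrix is bounded by its quadratic form. -/
theorem norm_le_of_isHermitian {A : Matrix (Fin K) (Fin K) ℂ} (hA : A.IsHermitian) {c : ℝ}
    (hc : 0 ≤ c) (h : ∀ x : EuclideanSpace ℂ (Fin K),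
      |(⟪Matrix.toEuclideanCLM (n := Fin K) (𝕜 := ℂ) A x, x⟫_ℂ).re| ≤ c * ‖x‖ ^ 2) : ‖A‖ ≤ c := by
  have hT : IsSelfAdjoint (Matrix.toEuclideanCLM (n := Fin K) (𝕜 := ℂ) A) := by
    rw [IsSelfAdjoint, ← map_star]
    exact congrArg _ hA
  rw [← Matrix.l2_opNorm_toEuclideanCLM,
    ContinuousLinearMap.norm_eq_iSup_rayleighQuotient _ hT.isSymmetric]
  refine ciSup_le fun x => ?_
  rw [ContinuousLinearMap.rayleighQuotient, ContinuousLinearMap.reApplyInnerSelf_apply, abs_div,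
    abs_of_nonneg (sq_nonneg ‖x‖)]
  exact div_le_of_le_mul₀ (sq_nonneg _) hc (h x)

theorem isHermitian_projPerp (A : Matrix (Fin N) (Fin K) ℂ) : (projPerp A).IsHermitian := by
  refine EquivLike.injective (Matrix.toEuclideanCLM (n := Fin N) (𝕜 := ℂ)) ?_
  rw [← Matrix.star_eq_conjTranspose, map_star, projPerp, StarAlgEquiv.apply_symm_apply]
  exact isSelfAdjoint_starProjection _

theorem S_eq (ghat : ℝ → ℂ) (τ : Fin K → ℝ) :
    S N ghat τ = (G N ghat * Lam N * Phi N τ)ᴴ * projPerp (G N ghat * Phi N τ) *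
      (G N ghat * Lam N * Phi N τ) := by
  simp only [S, Matrix.conjTranspose_mul, Matrix.mul_assoc]

theorem isHermitian_S (ghat : ℝ → ℂ) (τ : Fin K → ℝ) : (S N ghat τ).IsHermitian := by
  rw [S_eq]
  exact Matrix.isHermitian_conjTranspose_mul_mul _ (isHermitian_projPerp _)

/-- The quadratic form of `S` at `x` is the squared distance of `G Λ Φ x` from the range of
`G Φ`. -/
theorem inner_S (ghat : ℝ → ℂ) (τ : Fin K → ℝ) (x : EuclideanSpace ℂ (Fin K)) :
    (⟪Matrix.toEuclideanCLM (n := Fin K) (𝕜 := ℂ) (S N ghat τ) x, x⟫_ℂ).re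
      = ‖(LinearMap.range (Matrix.toEuclideanLin (G N ghat * Phi N τ)))ᗮ.starProjection
          (Matrix.toEuclideanLin (G N ghat * Lam N * Phi N τ) x)‖ ^ 2 := by
  set V := G N ghat * Lam N * Phi N τ with hV
  set A := G N ghat * Phi N τ with hA
  have h1 : Matrix.toEuclideanCLM (n := Fin K) (𝕜 := ℂ) (S N ghat τ) x
      = Matrix.toEuclideanLin Vᴴ (Matrix.toEuclideanCLM (n := Fin N) (𝕜 := ℂ) (projPerp A)
        (Matrix.toEuclideanLin V x)) := by
    change WithLp.toLp 2 (S N ghat τ *ᵥ x.ofLp)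
      = WithLp.toLp 2 (Vᴴ *ᵥ (projPerp A *ᵥ (V *ᵥ x.ofLp)))
    rw [Matrix.mulVec_mulVec, Matrix.mulVec_mulVec, S_eq, Matrix.mul_assoc]
  rw [h1, Matrix.toEuclideanLin_conjTranspose_eq_adjoint, LinearMap.adjoint_inner_left, projPerp,
    StarAlgEquiv.apply_symm_apply]
  set U := (LinearMap.range (Matrix.toEuclideanLin A))ᗮ
  set v := Matrix.toEuclideanLin V x
  exact Submodule.re_inner_starProjection_eq_normSq U v

theorem expSum_const_mul {ι : Type*} [Fintype ι] {τ : ι → ℝ} (c : ℂ) (a : ι → ℂ) (f : ℝ) :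
    expSum τ (fun k => c * a k) f = c * expSum τ a f := by
  simp only [expSum, Finset.mul_sum, mul_assoc]

theorem Phi_mulVec (τ : Fin K → ℝ) (a : Fin K → ℂ) (i : Fin N) :
    (Phi N τ *ᵥ a) i = expSum τ a (freq N i) := by
  rw [Matrix.mulVec, dotProduct, expSum]
  refine Finset.sum_congr rfl fun k _ => ?_
  rw [Phi, Matrix.of_apply, mul_comm]
  congr 2
  push_cast; ring

/-- The factor `-2 π i f_i` of `Λ` is pulled out, so that the residual is a pair of exponential
sums. -/
theorem norm_sq_residual (ghat : ℝ → ℂ) (τ : Fin K → ℝ) (a b : EuclideanSpace ℂ (Fin K)) :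
    ‖Matrix.toEuclideanLin (G N ghat * Lam N * Phi N τ) b
        - Matrix.toEuclideanLin (G N ghat * Phi N τ) a‖ ^ 2
      = (2 * Real.pi) ^ 2 * ∑ i, ‖ghat (freq N i)‖ ^ 2 *
        ‖expSum τ (fun k => (2 * Real.pi * Complex.I)⁻¹ * a k) (freq N i)
          + (freq N i : ℂ) * expSum τ (fun k => b k) (freq N i)‖ ^ 2 := by
  rw [EuclideanSpace.norm_sq_eq, Finset.mul_sum]
  refine Finset.sum_congr rfl fun i _ => ?_
  have h1 : (Matrix.toEuclideanLin (G N ghat * Lam N * Phi N τ) b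
        - Matrix.toEuclideanLin (G N ghat * Phi N τ) a).ofLp i
      = ghat (freq N i) * (-(Complex.I * 2 * (Real.pi : ℂ) * (freq N i : ℂ))
        * expSum τ (fun k => b k) (freq N i)) - ghat (freq N i) * expSum τ (fun k => a k) (freq N i) := by
    change ((G N ghat * Lam N * Phi N τ) *ᵥ b.ofLp) i - ((G N ghat * Phi N τ) *ᵥ a.ofLp) i = _
    rw [Matrix.mul_assoc, ← Matrix.mulVec_mulVec, ← Matrix.mulVec_mulVec, ← Matrix.mulVec_mulVec,
      G, Lam, Matrix.mulVec_diagonal, Matrix.mulVec_diagonal, Matrix.mulVec_diagonal, Phi_mulVec,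
      Phi_mulVec]
  have hpi : (2 * Real.pi * Complex.I : ℂ) ≠ 0 := Complex.two_pi_I_ne_zero
  have h2 : ghat (freq N i) * (-(Complex.I * 2 * (Real.pi : ℂ) * (freq N i : ℂ))
        * expSum τ (fun k => b k) (freq N i)) - ghat (freq N i) * expSum τ (fun k => a k) (freq N i)
      = -(2 * Real.pi * Complex.I) * (ghat (freq N i) *
        (expSum τ (fun k => (2 * Real.pi * Complex.I)⁻¹ * a k) (freq N i)
          + (freq N i : ℂ) * expSum τ (fun k => b k) (freq N i))) := by
    rw [expSum_const_mul]
    field_simp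
    ring
  have h3 : ‖-(2 * Real.pi * Complex.I : ℂ)‖ = 2 * Real.pi := by
    rw [norm_neg, norm_mul, norm_mul, Complex.norm_I, Complex.norm_real, Real.norm_eq_abs,
      abs_of_pos Real.pi_pos]
    simp
  rw [h1, h2, norm_mul, norm_mul, h3]
  ring

/-- Two-sided bounds for the quadratic form of `S - E` from bounds for exponential sums. -/
theorem norm_S_sub_le {ghat : ℝ → ℂ} {τ : Fin K → ℝ} {E c : ℝ} (hc : 0 ≤ c)
    (hlow : ∀ a b : Fin K → ℂ, (∑ k, ‖b k‖ ^ 2) * (E - c)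
      ≤ (2 * Real.pi) ^ 2 * ∑ i, ‖ghat (freq N i)‖ ^ 2 *
        ‖expSum τ a (freq N i) + (freq N i : ℂ) * expSum τ b (freq N i)‖ ^ 2)
    (hup : ∀ b : Fin K → ℂ, (2 * Real.pi) ^ 2 * ∑ i, ‖ghat (freq N i)‖ ^ 2 *
        (freq N i ^ 2 * ‖expSum τ b (freq N i)‖ ^ 2) ≤ (∑ k, ‖b k‖ ^ 2) * (E + c)) :
    ‖S N ghat τ - (E : ℂ) • (1 : Matrix (Fin K) (Fin K) ℂ)‖ ≤ c := by
  refine norm_le_of_isHermitian ?_ hc fun x => ?_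
  · refine (isHermitian_S ghat τ).sub ?_
    rw [Matrix.IsHermitian, Matrix.conjTranspose_smul, Matrix.conjTranspose_one]
    simp
  have hx : ‖x‖ ^ 2 = ∑ k, ‖x k‖ ^ 2 := EuclideanSpace.norm_sq_eq x
  have h1 : (⟪Matrix.toEuclideanCLM (n := Fin K) (𝕜 := ℂ)
      (S N ghat τ - (E : ℂ) • (1 : Matrix (Fin K) (Fin K) ℂ)) x, x⟫_ℂ).re
      = (⟪Matrix.toEuclideanCLM (n := Fin K) (𝕜 := ℂ) (S N ghat τ) x, x⟫_ℂ).re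
        - E * ‖x‖ ^ 2 := by
    rw [map_sub, map_smul, map_one, sub_apply, inner_sub_left,
      Complex.sub_re, smul_apply, one_apply_eq_self,
      inner_smul_left, Complex.conj_ofReal, Complex.re_ofReal_mul]
    congr 2
    exact inner_self_eq_norm_sq (𝕜 := ℂ) x
  rw [h1, inner_S, abs_le]
  set U := LinearMap.range (Matrix.toEuclideanLin (G N ghat * Phi N τ))
  set v := Matrix.toEuclideanLin (G N ghat * Lam N * Phi N τ) x with hv
  constructor
  · obtain ⟨a, ha⟩ : U.starProjection v ∈ U := Submodule.starProjection_apply_mem _ _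
    have h2 : Uᗮ.starProjection v = v - Matrix.toEuclideanLin (G N ghat * Phi N τ) a := by
      rw [ha, Submodule.starProjection_orthogonal_val]
    rw [h2, hv, norm_sq_residual]
    have h3 := hlow (fun k => (2 * Real.pi * Complex.I)⁻¹ * a k) (fun k => x k)
    rw [← hx] at h3
    linarith
  · have h2 : ‖Uᗮ.starProjection v‖ ^ 2 ≤ ‖v‖ ^ 2 :=
      pow_le_pow_left₀ (norm_nonneg _) (Submodule.norm_starProjection_apply_le _ _) 2
    have h3 := norm_sq_residual (N := N) ghat τ 0 x
    have h4 : expSum τ (fun k => (2 * Real.pi * Complex.I)⁻¹ * (0 : EuclideanSpace ℂ (Fin K)) k)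
        = fun _ => 0 := by
      ext f; simp [expSum]
    simp only [h4, map_zero, sub_zero, zero_add, norm_mul, mul_pow, Complex.norm_real,
      Real.norm_eq_abs, sq_abs] at h3
    have h5 := hup (fun k => x k)
    rw [← hx] at h5
    rw [← mul_pow] at h3
    linarith

end

/-! ### The spectrum of the pulse in the band -/

section
variable {N : ℕ}

theorem neg_mem_band {x : ℝ} : -x ∈ band N ↔ x ∈ band N := by
  simp only [band, Set.mem_Icc]
  constructor <;> intro h <;> constructor <;> linarith [h.1, h.2]

theorem freq_mem_band (i : Fin N) : freq N i ∈ band N := abs_le.1 (abs_freq_le N i)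

/-- A band of positive energy contains at least two sampling frequencies. -/
theorem two_le_of_bandEnergy_pos {u : ℝ → ℝ} {hu : MemLp u 2 volume}
    (h : 0 < bandEnergy N u hu) : 2 ≤ N := by
  by_contra hN
  have hN' : (N : ℝ) ≤ 1 := by exact_mod_cast Nat.lt_succ_iff.1 (not_le.1 hN)
  have h0 : volume (band N) = 0 := by
    rw [band, Real.volume_Icc]
    exact ENNReal.ofReal_of_nonpos (by linarith)
  refine h.ne' ?_
  rw [bandEnergy]
  refine integral_eq_zero_of_ae ?_
  filter_upwards [compl_mem_ae_iff.2 h0] with x hx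
  exact Set.indicator_of_notMem hx _

variable {g : ℝ → ℝ} {hg : MemLp g 2 volume} {hg' : MemLp (deriv g) 2 volume} {ghat : ℝ → ℂ}

/-- A version of the spectral density of `g` in the band. -/
noncomputable def bandWeight (N : ℕ) (ghat : ℝ → ℂ) : ℝ → ℝ :=
  (band N).indicator fun f => ‖ghat f‖ ^ 2

theorem bandWeight_nonneg (x : ℝ) : 0 ≤ bandWeight N ghat x :=
  Set.indicator_nonneg (fun _ _ => sq_nonneg _) x

theorem bandWeight_freq (i : Fin N) : bandWeight N ghat (freq N i) = ‖ghat (freq N i)‖ ^ 2 :=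
  Set.indicator_of_mem (freq_mem_band i) _

theorem bandSpectrum_ae_eq (h : ghat =ᵐ[volume] fourierL2 g hg) :
    bandSpectrum N g hg =ᵐ[volume] bandWeight N ghat := by
  filter_upwards [h] with x hx
  simp only [bandSpectrum, bandWeight, Set.indicator, hx]

theorem bandSpectrum_deriv_ae_eq (hdiff : Differentiable ℝ g)
    (h : ghat =ᵐ[volume] fourierL2 g hg) :
    bandSpectrum N (deriv g) hg'
      =ᵐ[volume] fun x => (2 * Real.pi) ^ 2 * (x ^ 2 * bandWeight N ghat x) := by
  filter_upwards [h, fourierL2_deriv hg hdiff hg'] with x hx hx'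
  simp only [bandSpectrum, bandWeight, Set.indicator, hx']
  split_ifs
  · rw [hx]
    simp only [norm_mul, Complex.norm_I, Complex.norm_real, Real.norm_eq_abs, mul_pow, sq_abs]
    norm_num
    ring
  · simp

theorem integrable_bandWeight (h : ghat =ᵐ[volume] fourierL2 g hg) :
    Integrable (bandWeight N ghat) := by
  have h1 : Integrable fun f => ‖fourierL2 g hg f‖ ^ 2 := (Lp.memLp _).integrable_norm_pow (by simp)
  exact ((h1.indicator measurableSet_Icc).congr (bandSpectrum_ae_eq (N := N) h))

theorem bandWeight_neg (h : ghat =ᵐ[volume] fourierL2 g hg) :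
    ∀ᵐ x, bandWeight N ghat (-x) = bandWeight N ghat x := by
  have h' := (Measure.measurePreserving_neg (volume : Measure ℝ)).quasiMeasurePreserving.ae h
  filter_upwards [h, h', norm_fourierL2_neg hg] with x hx hx' hn
  simp only [bandWeight]
  by_cases hb : x ∈ band N
  · rw [Set.indicator_of_mem hb, Set.indicator_of_mem (neg_mem_band.2 hb), hx, hx', hn]
  · rw [Set.indicator_of_notMem hb, Set.indicator_of_notMem fun h => hb (neg_mem_band.1 h)]

theorem continuousWithinAt_bandWeight {i : Fin N}
    (h : ContinuousWithinAt ghat (band N) (freq N i)) :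
    ContinuousWithinAt (bandWeight N ghat) (band N) (freq N i) :=
  (h.norm.pow 2).congr (fun _ hx => Set.indicator_of_mem hx _) (bandWeight_freq i)

theorem bandEnergy_eq (h : ghat =ᵐ[volume] fourierL2 g hg) :
    bandEnergy N g hg = ∫ x, bandWeight N ghat x := integral_congr_ae (bandSpectrum_ae_eq h)

theorem bandEnergy_deriv_eq (hdiff : Differentiable ℝ g)
    (h : ghat =ᵐ[volume] fourierL2 g hg) :
    bandEnergy N (deriv g) hg' = (2 * Real.pi) ^ 2 * ∫ x, x ^ 2 * bandWeight N ghat x := by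
  rw [bandEnergy, integral_congr_ae (bandSpectrum_deriv_ae_eq hdiff h), integral_const_mul]

theorem bandEnergy_pos (hdiff : Differentiable ℝ g) (h : ghat =ᵐ[volume] fourierL2 g hg)
    (hE : 0 < bandEnergy N (deriv g) hg') : 0 < bandEnergy N g hg := by
  rw [bandEnergy_eq h]
  refine (integral_nonneg bandWeight_nonneg).lt_of_ne fun h0 => hE.ne' ?_
  have h1 := (integral_eq_zero_iff_of_nonneg bandWeight_nonneg (integrable_bandWeight h)).1 h0.symm
  rw [bandEnergy_deriv_eq hdiff h, integral_eq_zero_of_ae, mul_zero]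
  filter_upwards [h1] with x hx
  rw [hx]
  simp

/-- A finite normalized variation bounds the variation by its multiple of the energy. -/
theorem variationLE_of_normalizedVariation_le {u : ℝ → ℝ} {hu : MemLp u 2 volume}
    (hE : 0 < bandEnergy N u hu) {r : ℝ≥0∞} (hr : r ≠ ⊤) (h : normalizedVariation N u hu ≤ r) :
    VariationLE (bandSpectrum N u hu) (r.toReal * bandEnergy N u hu) := by
  have hE' : ENNReal.ofReal (bandEnergy N u hu) ≠ 0 := (ENNReal.ofReal_pos.2 hE).ne'
  have h1 : totalVariation (bandSpectrum N u hu) ≤ r * ENNReal.ofReal (bandEnergy N u hu) :=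
    (ENNReal.div_le_iff hE' ENNReal.ofReal_ne_top).1 h
  have h2 : r * ENNReal.ofReal (bandEnergy N u hu) ≠ ⊤ :=
    ENNReal.mul_ne_top hr ENNReal.ofReal_ne_top
  intro φ hφ hs hb
  refine (variationLE_toReal (ne_top_of_le_ne_top h2 h1) φ hφ hs hb).trans
    ((ENNReal.toReal_mono h2 h1).trans_eq ?_)
  rw [ENNReal.toReal_mul, ENNReal.toReal_ofReal hE.le]

theorem VariationLE.congr_ae {W W' : ℝ → ℝ} {V : ℝ} (h : VariationLE W V)
    (hW : W =ᵐ[volume] W') : VariationLE W' V := by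
  intro φ h1 h2 h3
  refine (integral_congr_ae ?_).trans_le (h φ h1 h2 h3)
  filter_upwards [hW] with x hx
  rw [hx]

end

end PulseSensitivity

theorem lemma3 (N K : ℕ)
    (g : ℝ → ℝ) (hg : MemLp g 2 volume) (hdiff : Differentiable ℝ g)
    (hg' : MemLp (deriv g) 2 volume)
    -- a version of the Fourier transform of `g` whose samples are meaningful
    (ghat : ℝ → ℂ) (hghat : ghat =ᵐ[volume] PulseSensitivity.fourierL2 g hg)
    (hcont : ∀ i : Fin N,
      ContinuousWithinAt ghat (PulseSensitivity.band N) (PulseSensitivity.freq N i))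
    -- the band is not empty of energy, so that `ρ` is defined
    (hE₁ : 0 < PulseSensitivity.bandEnergy N (deriv g) hg')
    (τ : Fin K → ℝ) (Δ : ℝ)
    -- the locations are `Δ`-separated on the torus `ℝ / ℤ`, whose length is `1`
    (hΔ_le : Δ ≤ 1)
    (hsep : ∀ k k' : Fin K, k ≠ k' → ∀ j : ℤ, Δ ≤ |τ k - τ k' + (j : ℝ)|)
    (hΔ : 2 / 3 * PulseSensitivity.rho N g hg hg' < ENNReal.ofReal Δ) :
    ‖PulseSensitivity.S N ghat τ -
        (PulseSensitivity.bandEnergy N (deriv g) hg' : ℂ) • (1 : Matrix (Fin K) (Fin K) ℂ)‖ ≤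
      2 / 3 * PulseSensitivity.bandEnergy N (deriv g) hg' *
        (PulseSensitivity.rho N g hg hg').toReal * Δ⁻¹ := by
  open PulseSensitivity in
  have hN := two_le_of_bandEnergy_pos hE₁
  have hE₀ := bandEnergy_pos hdiff hghat hE₁
  have hΔ0 : 0 < Δ := ENNReal.ofReal_pos.1 (bot_le.trans_lt hΔ)
  set r := rho N g hg hg' with hr
  have hr_top : r ≠ ⊤ := fun h => by
    rw [h, ENNReal.mul_top (by simp)] at hΔ
    exact not_top_lt hΔ
  have hrΔ : 2 / 3 * r.toReal < Δ := by
    have := (ENNReal.lt_ofReal_iff_toReal_lt (ENNReal.mul_ne_top (by finiteness) hr_top)).1 hΔ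
    rw [ENNReal.toReal_mul] at this
    simpa using this
  have hr0 : 0 ≤ r.toReal := ENNReal.toReal_nonneg
  set W := bandWeight N ghat with hW
  have hV₀ : VariationLE W (r.toReal * bandEnergy N g hg) :=
    (variationLE_of_normalizedVariation_le hE₀ hr_top (le_max_left _ _)).congr_ae
      (bandSpectrum_ae_eq hghat)
  set E := bandEnergy N (deriv g) hg' with hE
  have hpi : (0 : ℝ) < (2 * Real.pi) ^ 2 := by positivity
  have hEW : E = (2 * Real.pi) ^ 2 * ∫ x, x ^ 2 * W x := bandEnergy_deriv_eq hdiff hghat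
  have hV₁ : VariationLE (fun x => x ^ 2 * W x) (((2 * Real.pi) ^ 2)⁻¹ * (r.toReal * E)) := by
    have h1 := ((variationLE_of_normalizedVariation_le hE₁ hr_top (le_max_right _ _)).congr_ae
      (bandSpectrum_deriv_ae_eq hdiff hghat)).const_mul (inv_pos.2 hpi).le
    simpa only [inv_mul_cancel_left₀ hpi.ne'] using h1
  have hWs : ∀ x, x ∉ band N → W x = 0 := fun x hx => Set.indicator_of_notMem hx _
  have hc := fun i => continuousWithinAt_bandWeight (hcont i)
  have hX : 0 ≤ E * r.toReal * Δ⁻¹ := by positivity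
  refine norm_S_sub_le (by linarith) (fun a b => ?_) fun b => ?_
  · have key := sum_freq_pair_ge hN hΔ0 hΔ_le hsep bandWeight_nonneg
      (integrable_bandWeight hghat) hWs (bandWeight_neg hghat) hV₀ hV₁ hc (by
        rw [← bandEnergy_eq hghat, inv_mul_le_iff₀ hΔ0]
        nlinarith) a b
    have := mul_le_mul_of_nonneg_left key hpi.le
    simp only [bandWeight_freq] at this
    refine le_of_eq_of_le ?_ this
    rw [← hW, hEW]
    field_simp
  · have key := sum_freq_norm_sq_expSum_le hN hΔ0 hΔ_le hsep bandWeight_nonneg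
      (integrable_bandWeight hghat) hWs hV₀ hV₁ hc b
    have := mul_le_mul_of_nonneg_left key hpi.le
    simp only [bandWeight_freq] at this
    refine this.trans ?_
    have h2 : (2 * Real.pi) ^ 2 * ((∑ k, ‖b k‖ ^ 2) * ((∫ x, x ^ 2 * W x)
        + Δ⁻¹ / 2 * (((2 * Real.pi) ^ 2)⁻¹ * (r.toReal * E))))
        = (∑ k, ‖b k‖ ^ 2) * (E + 1 / 2 * (E * r.toReal * Δ⁻¹)) := by
      rw [hEW]
      field_simp
    rw [← hW, h2]
    refine mul_le_mul_of_nonneg_left ?_ (Finset.sum_nonneg fun _ _ => sq_nonneg _)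
    linarith
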